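/- Let $\Gamma$ be a finite connected distance-regular graph with vertex set $X$, path-length distance $\partial$, diameter $D\ge 3$ and valency $k\ge 3$. Write $\Gamma_i(x)=\{y:\partial(x,y)=i\}$, $\Gamma(x)=\Gamma_1(x)$, let $p^h_{i,j}=|\Gamma_i(x)\cap\Gamma_j(y)|$ ($\partial(x,y)=h$) be the intersection numbers, and put $c_i=p^i_{1,i-1}$, $a_i=p^i_{1,i}$, $b_i=p^i_{1,i+1}$, $k_i=p^0_{i,i}$. Let $A_i$ be the $i$th distance matrix. Let $E$ be a $Q$-polynomial primitive idempotent of $\Gamma$, i.e. $E=E_1$ for some ordering $E_0=|X|^{-1}J,E_1,\dots,E_D$ of the primitive idempotents of the (real) Bose–Mesner algebra whose Krein parameters $q^h_{i,j}$, given by $E_i\circ E_j=|X|^{-1}\sum_h q^h_{i,j}E_h$ ($\circ$ the entrywise product), vanish if one of $h,i,j$ exceeds the sum of the other two and are nonzero if one of them equals the sum of the other two. Let $\theta^*_0,\dots,\theta^*_D$ be the dual eigenvalues: $E=|X|^{-1}\sum_{i=0}^D\theta^*_iA_i$. For $x\in X$ let $\hat x\in\mathbb R^X$ be the corresponding standard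 basis vector. The set $\{E\hat x\mid x\in X\}$ is *Norton-balanced* if for all $x,y\in X$ and $0\le i,j\le D$ $$\sum_{z\in\Gamma_i(x)\cap\Gamma_j(y)}E\hat z\in\mathrm{Span}\{E\hat x,\,E\hat y,\,E\hat x\star E\hat y\},\qquad u\star v=E(u\circ v).$$ For $2\le i\le D$ and $\partial(x,y)=i$, $\partial(x,z)=1$, $\partial(y,z)=i-1$ let $\zeta_i(x,y,z)=|\Gamma(x)\cap\Gamma_{i-1}(y)\cap\Gamma(z)|$. The graph $\Gamma$ is *reinforced* if for $2\le i\le D$ the average of $\zeta_i(x,y,z)$ over $z\in\Gamma(x)\cap\Gamma_{i-1}(y)$ is the same for all $x,y$ with $\partial(x,y)=i$, and the average of $\zeta_i(x,y,z)$ over $x\in\Gamma_i(y)\cap\Gamma(z)$ is the same for all $y,z$ with $\partial(y,z)=i-1$. Let $z_i$ ($2\le i\le D$) be the number of 4-tuples $(x,y,z,w)$ with $\partial(x,y)=i$, $\partial(x,z)=\partial(x,w)=\partial(z,w)=1$, $\partial(y,z)=\partial(y,w)=i-1$, divided by $|X|k_ic_i$. Let $\beta+1$ be the common value of $(\theta^*_{i-2}-\theta^*_{i+1})/(\theta^*_{i-1}-\theta^*_i)$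 ($2\le i\le D-1$) and $\gamma^*$ the common value of $\theta^*_{i-1}-\beta\theta^*_i+\theta^*_{i+1}$ ($1\le i\le D-1$). For $2\le i\le D$ put $$\alpha_i=\frac{(\theta^*_1-\theta^*_2)(\theta^*_0+\theta^*_1-\theta^*_{i-1}-\theta^*_i)}{(\theta^*_0-\theta^*_2)(\theta^*_{i-1}-\theta^*_i)},\qquad \beta_i=\frac{(\theta^*_0-\theta^*_1)(\theta^*_2-\theta^*_i)-(\theta^*_1-\theta^*_2)(\theta^*_1-\theta^*_{i-1})}{(\theta^*_0-\theta^*_2)(\theta^*_{i-1}-\theta^*_i)},$$ and for $2\le i\le D-1$ put $$r_i=c_i\frac{\theta^*_0\theta^*_1-\theta^*_{i-1}\theta^*_i}{\theta_0^{*2}-\theta_i^{*2}},\quad s_i=c_i\frac{\theta^*_0\theta^*_{i-1}-\theta^*_1\theta^*_i}{\theta_0^{*2}-\theta_i^{*2}},\quad R_i=b_i\frac{\theta^*_0\theta^*_1-\theta^*_{i+1}\theta^*_i}{\theta_0^{*2}-\theta_i^{*2}},\quad S_i=b_i\frac{\theta^*_0\theta^*_{i+1}-\theta^*_1\theta^*_i}{\theta_0^{*2}-\theta_i^{*2}},$$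 $$z_i^-=\frac{r_i\theta^*_1+s_i\theta^*_{i-1}-\theta^*_0-(c_i-1)\theta^*_2}{\theta^*_1-\theta^*_2},\qquad z_{i+1}^+=\frac{\theta^*_0+a_1\theta^*_1+(b_i-1-a_1)\theta^*_2-R_i\theta^*_1-S_i\theta^*_{i+1}}{\theta^*_1-\theta^*_2},$$ and $\Phi_i(\lambda)=u_i\lambda^2+v_i\lambda+w_i$ with $u_i=-\alpha_i\alpha_{i+1}$, $v_i=\alpha_i(z^+_{i+1}-a_1\beta_{i+1})-\alpha_{i+1}(a_1\beta_i-z^-_i)$ and $$w_i=(a_1\beta_i-z_i^-)(z_{i+1}^+-a_1\beta_{i+1})-c_ib_i\Bigl(\frac{\gamma^*}{\theta^*_1-\theta^*_2}\,\frac{\theta^*_i-\theta^*_1}{\theta^*_i+\theta^*_0}\Bigr)^2.$$ Assume that $\Gamma$ is reinforced. (1) If $\gamma^*=0$, then $\{E\hat x\mid x\in X\}$ is Norton-balanced if and only if $\Phi_i(z_2)=0$ for $2\le i\le D-1$. (2) Suppose $\gamma^*\ne0$, and for $2\le i\le D-1$ let $$\lambda_i=(\theta^*_1-\theta^*_2)\,\frac{z_i-z_i^-}{\theta^*_i-\theta^*_1}\,\frac{\theta^*_i+\theta^*_0}{\gamma^*b_i}.$$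 If $\Phi_i(z_2)=0$, then for all $x,y\in X$ with $\partial(x,y)=i$ the scalar $\lambda_i$ is the unique real number (the *dependency scalar*) such that $$Ex_y^--r_iE\hat x-s_iE\hat y=\lambda_i\bigl(Ex_y^+-R_iE\hat x-S_iE\hat y\bigr),\qquad x_y^{\pm}=\sum_{z\in\Gamma(x)\cap\Gamma_{i\pm1}(y)}\hat z.$$ Moreover $\{E\hat x\mid x\in X\}$ is Norton-balanced if and only if for $2\le i\le D-1$ both $$\Phi_i(z_2)=0\qquad\text{and}\qquad\lambda_i\ne\frac{\theta^*_i-\theta^*_{i+1}}{\theta^*_{i-1}-\theta^*_i}.$$ -/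

import Mathlib

open scoped Matrix

noncomputable section

namespace NortonBalanced

/-! Distance-regular graphs -/

section Graph

variable {X : Type*} [Fintype X] [DecidableEq X]

/-- `Γ_i(x) ∩ Γ_j(y)`: the vertices at distance `i` from `x` and `j` from `y`. -/
def sphereInter (G : SimpleGraph X) (i j : ℕ) (x y : X) : Finset X :=
  Finset.univ.filter fun z => G.dist x z = i ∧ G.dist y z = j

/-- `G` is distance-regular with diameter `D` and intersection numbers `p h i j = p^h_{i,j}`
(`0 ≤ h, i, j ≤ D`). The values of `p` outside this range are irrelevant. -/
structure IsDistanceRegularWith (G : SimpleGraph X) (D : ℕ) (p : ℕ → ℕ → ℕ → ℕ) : Prop where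
  connected : G.Connected
  diam_eq : G.diam = D
  card_eq : ∀ h i j : ℕ, h ≤ D → i ≤ D → j ≤ D → ∀ x y : X, G.dist x y = h →
    (sphereInter G i j x y).card = p h i j

/-- `c_i = p^i_{1,i-1}` (used for `1 ≤ i`). -/
def cNum (p : ℕ → ℕ → ℕ → ℕ) (i : ℕ) : ℕ := p i 1 (i - 1)

/-- `a_i = p^i_{1,i}`. -/
def aNum (p : ℕ → ℕ → ℕ → ℕ) (i : ℕ) : ℕ := p i 1 i

/-- `b_i = p^i_{1,i+1}`. -/
def bNum (p : ℕ → ℕ → ℕ → ℕ) (i : ℕ) : ℕ := p i 1 (i + 1)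

/-- `k_i = p^0_{i,i}`. -/
def kNum (p : ℕ → ℕ → ℕ → ℕ) (i : ℕ) : ℕ := p 0 i i

/-! The Bose-Mesner algebra and the Q-polynomial property -/

/-- The `i`th distance matrix `A_i`. -/
def distMatrix (G : SimpleGraph X) (i : ℕ) : Matrix X X ℝ :=
  Matrix.of fun x y => if G.dist x y = i then 1 else 0

/-- The Bose-Mesner algebra, as the span of the distance matrices `A_0, …, A_D`. -/
def boseMesner (G : SimpleGraph X) (D : ℕ) : Submodule ℝ (Matrix X X ℝ) :=
  Submodule.span ℝ (Set.range fun i : Fin (D + 1) => distMatrix G i)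

/-- `E 0, …, E D` is an ordering of the primitive idempotents of `G`, with `E 0` the trivial one:
a basis of the Bose-Mesner algebra consisting of symmetric, mutually orthogonal idempotents that
sum to the identity, with `E 0 = |X|⁻¹ J`. -/
structure IsPrimitiveIdempotentOrdering (G : SimpleGraph X) (D : ℕ) (E : ℕ → Matrix X X ℝ) :
    Prop where
  linearIndependent : LinearIndependent ℝ fun i : Fin (D + 1) => E i
  span_eq : Submodule.span ℝ (Set.range fun i : Fin (D + 1) => E i) = boseMesner G D
  zero_eq : E 0 = (Fintype.card X : ℝ)⁻¹ • Matrix.of fun _ _ => (1 : ℝ)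
  sum_eq : ∑ i ∈ Finset.range (D + 1), E i = 1
  transpose_eq : ∀ i ≤ D, (E i)ᵀ = E i
  mul_eq : ∀ i ≤ D, ∀ j ≤ D, E i * E j = if i = j then E i else 0

/-- The ordering `E 0, …, E D` of the primitive idempotents is Q-polynomial. The scalars
`q h i j = q^h_{i,j}` are the Krein parameters. -/
def IsQPolynomialOrdering (G : SimpleGraph X) (D : ℕ) (E : ℕ → Matrix X X ℝ) : Prop :=
  IsPrimitiveIdempotentOrdering G D E ∧
  ∃ q : ℕ → ℕ → ℕ → ℝ,
    (∀ i ≤ D, ∀ j ≤ D,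
      Matrix.hadamard (E i) (E j) =
        (Fintype.card X : ℝ)⁻¹ • ∑ h ∈ Finset.range (D + 1), q h i j • E h) ∧
    (∀ h ≤ D, ∀ i ≤ D, ∀ j ≤ D,
      (h > i + j ∨ i > h + j ∨ j > h + i → q h i j = 0) ∧
      (h = i + j ∨ i = h + j ∨ j = h + i → q h i j ≠ 0))

/-- `E` is a Q-polynomial primitive idempotent: it is the `E_1` of a Q-polynomial ordering. -/
def IsQPolynomialIdempotent (G : SimpleGraph X) (D : ℕ) (E : Matrix X X ℝ) : Prop :=
  ∃ F : ℕ → Matrix X X ℝ, IsQPolynomialOrdering G D F ∧ F 1 = E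

/-- `θs 0, …, θs D` are the dual eigenvalues `θ*_0, …, θ*_D` associated with `E`. -/
def IsDualEigenvalueSeq (G : SimpleGraph X) (D : ℕ) (E : Matrix X X ℝ) (θs : ℕ → ℝ) : Prop :=
  E = (Fintype.card X : ℝ)⁻¹ • ∑ i ∈ Finset.range (D + 1), θs i • distMatrix G i

/-! The Norton product and the Norton-balanced condition -/

/-- The vector `x̂`. -/
def hat (x : X) : X → ℝ := Pi.single x 1

/-- The Norton product `u ⋆ v = E (u ∘ v)`, with `∘` the coordinatewise product. -/
def nortonProd (E : Matrix X X ℝ) (u v : X → ℝ) : X → ℝ := E *ᵥ (u * v)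

/-- The set `{E x̂ | x ∈ X}` is Norton-balanced. -/
def IsNortonBalanced (G : SimpleGraph X) (D : ℕ) (E : Matrix X X ℝ) : Prop :=
  ∀ x y : X, ∀ i ≤ D, ∀ j ≤ D,
    ∑ z ∈ sphereInter G i j x y, E *ᵥ hat z ∈
      Submodule.span ℝ
        {E *ᵥ hat x, E *ᵥ hat y, nortonProd E (E *ᵥ hat x) (E *ᵥ hat y)}

/-- `x_y^- = ∑ ẑ` over the neighbours `z` of `x` with `∂(y,z) = ∂(x,y) - 1`. -/
def minusVec (G : SimpleGraph X) (x y : X) : X → ℝ :=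
  ∑ z ∈ Finset.univ.filter (fun z => G.dist x z = 1 ∧ G.dist y z + 1 = G.dist x y), hat z

/-- `x_y^+ = ∑ ẑ` over the neighbours `z` of `x` with `∂(y,z) = ∂(x,y) + 1`. -/
def plusVec (G : SimpleGraph X) (x y : X) : X → ℝ :=
  ∑ z ∈ Finset.univ.filter (fun z => G.dist x z = 1 ∧ G.dist y z = G.dist x y + 1), hat z

/-! Kites and the reinforced condition -/

/-- `(x, y, z, w)` is an `i`-kite (used for `2 ≤ i ≤ D`). -/
def IsKite (G : SimpleGraph X) (i : ℕ) (x y z w : X) : Prop :=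
  G.dist x y = i ∧ G.dist x z = 1 ∧ G.dist y z = i - 1 ∧
    G.dist x w = 1 ∧ G.dist y w = i - 1 ∧ G.dist z w = 1

/-- The `i`th kite number `z_i`. -/
def kiteNumber (G : SimpleGraph X) (p : ℕ → ℕ → ℕ → ℕ) (i : ℕ) : ℝ :=
  (Set.ncard {t : X × X × X × X | IsKite G i t.1 t.2.1 t.2.2.1 t.2.2.2} : ℝ) /
    ((Fintype.card X : ℝ) * kNum p i * cNum p i)

/-- The `i`th kite function `ζ_i(x,y,z) = |Γ(x) ∩ Γ_{i-1}(y) ∩ Γ(z)|`. -/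
def kiteFun (G : SimpleGraph X) (i : ℕ) (x y z : X) : ℕ :=
  (Finset.univ.filter fun w => G.dist x w = 1 ∧ G.dist y w = i - 1 ∧ G.dist z w = 1).card

/-- `ζ_i(x,y,*)`: the average of `ζ_i(x,y,z)` over `z ∈ Γ(x) ∩ Γ_{i-1}(y)`. -/
def kiteAvgLeft (G : SimpleGraph X) (p : ℕ → ℕ → ℕ → ℕ) (i : ℕ) (x y : X) : ℝ :=
  (cNum p i : ℝ)⁻¹ * ∑ z ∈ sphereInter G 1 (i - 1) x y, (kiteFun G i x y z : ℝ)

/-- `ζ_i(*,y,z)`: the average of `ζ_i(x,y,z)` over `x ∈ Γ_i(y) ∩ Γ(z)`. -/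
def kiteAvgRight (G : SimpleGraph X) (p : ℕ → ℕ → ℕ → ℕ) (i : ℕ) (y z : X) : ℝ :=
  (bNum p (i - 1) : ℝ)⁻¹ * ∑ x ∈ sphereInter G i 1 y z, (kiteFun G i x y z : ℝ)

/-- `G` is reinforced. -/
def IsReinforced (G : SimpleGraph X) (D : ℕ) (p : ℕ → ℕ → ℕ → ℕ) : Prop :=
  ∀ i : ℕ, 2 ≤ i → i ≤ D →
    (∀ x y x' y' : X, G.dist x y = i → G.dist x' y' = i →
      kiteAvgLeft G p i x y = kiteAvgLeft G p i x' y') ∧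
    (∀ y z y' z' : X, G.dist y z = i - 1 → G.dist y' z' = i - 1 →
      kiteAvgRight G p i y z = kiteAvgRight G p i y' z')

end Graph

/-! Scalars attached to the intersection numbers `p` and the dual eigenvalues `θs` -/

/-- `β`, where `β + 1` is the common value of `(θ*_{i-2} - θ*_{i+1}) / (θ*_{i-1} - θ*_i)` for
`2 ≤ i ≤ D - 1`; it is read off at `i = 2`. -/
def betaPar (θs : ℕ → ℝ) : ℝ := (θs 0 - θs 3) / (θs 1 - θs 2) - 1

/-- `γ*`, the common value of `θ*_{i-1} - β θ*_i + θ*_{i+1}` for `1 ≤ i ≤ D - 1`; it is read off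
at `i = 1`. -/
def gammaStar (θs : ℕ → ℝ) : ℝ := θs 0 - betaPar θs * θs 1 + θs 2

/-- `α_i`. -/
def kiteAlpha (θs : ℕ → ℝ) (i : ℕ) : ℝ :=
  ((θs 1 - θs 2) * (θs 0 + θs 1 - θs (i - 1) - θs i)) /
    ((θs 0 - θs 2) * (θs (i - 1) - θs i))

/-- `β_i`. -/
def kiteBeta (θs : ℕ → ℝ) (i : ℕ) : ℝ :=
  ((θs 0 - θs 1) * (θs 2 - θs i) - (θs 1 - θs 2) * (θs 1 - θs (i - 1))) /
    ((θs 0 - θs 2) * (θs (i - 1) - θs i))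

/-- `r_i`. -/
def rLow (p : ℕ → ℕ → ℕ → ℕ) (θs : ℕ → ℝ) (i : ℕ) : ℝ :=
  cNum p i * ((θs 0 * θs 1 - θs (i - 1) * θs i) / (θs 0 ^ 2 - θs i ^ 2))

/-- `s_i`. -/
def sLow (p : ℕ → ℕ → ℕ → ℕ) (θs : ℕ → ℝ) (i : ℕ) : ℝ :=
  cNum p i * ((θs 0 * θs (i - 1) - θs 1 * θs i) / (θs 0 ^ 2 - θs i ^ 2))

/-- `R_i`. -/
def rUp (p : ℕ → ℕ → ℕ → ℕ) (θs : ℕ → ℝ) (i : ℕ) : ℝ :=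
  bNum p i * ((θs 0 * θs 1 - θs (i + 1) * θs i) / (θs 0 ^ 2 - θs i ^ 2))

/-- `S_i`. -/
def sUp (p : ℕ → ℕ → ℕ → ℕ) (θs : ℕ → ℝ) (i : ℕ) : ℝ :=
  bNum p i * ((θs 0 * θs (i + 1) - θs 1 * θs i) / (θs 0 ^ 2 - θs i ^ 2))

/-- `z_i^-`. -/
def zMinus (p : ℕ → ℕ → ℕ → ℕ) (θs : ℕ → ℝ) (i : ℕ) : ℝ :=
  (rLow p θs i * θs 1 + sLow p θs i * θs (i - 1) - θs 0 - ((cNum p i : ℝ) - 1) * θs 2) /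
    (θs 1 - θs 2)

/-- `z_{i+1}^+` (note the shift: the argument is `i`). -/
def zPlusSucc (p : ℕ → ℕ → ℕ → ℕ) (θs : ℕ → ℝ) (i : ℕ) : ℝ :=
  (θs 0 + aNum p 1 * θs 1 + ((bNum p i : ℝ) - 1 - aNum p 1) * θs 2
      - rUp p θs i * θs 1 - sUp p θs i * θs (i + 1)) /
    (θs 1 - θs 2)

/-- `u_i`. -/
def phiU (θs : ℕ → ℝ) (i : ℕ) : ℝ := -(kiteAlpha θs i * kiteAlpha θs (i + 1))

/-- `v_i`. -/
def phiV (p : ℕ → ℕ → ℕ → ℕ) (θs : ℕ → ℝ) (i : ℕ) : ℝ :=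
  kiteAlpha θs i * (zPlusSucc p θs i - aNum p 1 * kiteBeta θs (i + 1)) -
    kiteAlpha θs (i + 1) * (aNum p 1 * kiteBeta θs i - zMinus p θs i)

/-- `w_i`. -/
def phiW (p : ℕ → ℕ → ℕ → ℕ) (θs : ℕ → ℝ) (i : ℕ) : ℝ :=
  (aNum p 1 * kiteBeta θs i - zMinus p θs i) *
      (zPlusSucc p θs i - aNum p 1 * kiteBeta θs (i + 1)) -
    cNum p i * bNum p i *
      (gammaStar θs / (θs 1 - θs 2) * ((θs i - θs 1) / (θs i + θs 0))) ^ 2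

/-- The polynomial `Φ_i(λ) = u_i λ² + v_i λ + w_i` (used for `2 ≤ i ≤ D - 1`). -/
def Phi (p : ℕ → ℕ → ℕ → ℕ) (θs : ℕ → ℝ) (i : ℕ) : Polynomial ℝ :=
  Polynomial.C (phiU θs i) * Polynomial.X ^ 2 + Polynomial.C (phiV p θs i) * Polynomial.X +
    Polynomial.C (phiW p θs i)

section Dependency

variable {X : Type*} [Fintype X] [DecidableEq X]

/-- The relation `E x_y^- - r_i E x̂ - s_i E ŷ = l (E x_y^+ - R_i E x̂ - S_i E ŷ)`. -/
def DependencyRel (G : SimpleGraph X) (p : ℕ → ℕ → ℕ → ℕ) (E : Matrix X X ℝ) (θs : ℕ → ℝ)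
    (i : ℕ) (x y : X) (l : ℝ) : Prop :=
  E *ᵥ minusVec G x y - rLow p θs i • (E *ᵥ hat x) - sLow p θs i • (E *ᵥ hat y) =
    l • (E *ᵥ plusVec G x y - rUp p θs i • (E *ᵥ hat x) - sUp p θs i • (E *ᵥ hat y))

/-- The dependency scalar
`λ_i = (θ*_1 - θ*_2) (z_i - z_i^-) (θ*_i + θ*_0) / ((θ*_i - θ*_1) γ* b_i)`
(used for `2 ≤ i ≤ D - 1` and `γ* ≠ 0`). -/
def depScalar (G : SimpleGraph X) (p : ℕ → ℕ → ℕ → ℕ) (θs : ℕ → ℝ) (i : ℕ) : ℝ :=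
  (θs 1 - θs 2) * ((kiteNumber G p i - zMinus p θs i) / (θs i - θs 1) *
    ((θs i + θs 0) / (gammaStar θs * bNum p i)))

end Dependency

end NortonBalanced

end

noncomputable section

set_option linter.unusedSectionVars false

namespace NortonBalanced

/-! ### Distance-regular graphs: double counting and matrices that depend only on distance. -/

section DistanceRegular

variable {X : Type*} [Fintype X] [DecidableEq X] {G : SimpleGraph X} {D : ℕ}
  {p : ℕ → ℕ → ℕ → ℕ}

/-! The argument works with the vectors T(M,N) = ∑_w M(y,w) N(w,x) Eŵ (`tripleVec`), bilinear in M,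
N from the Bose–Mesner algebra. Distance matrices give the sphere sums of the Norton-balanced
condition; M = N = E gives the Norton product. The Q-polynomial property enters as T(E_i,E_j) = 0
for |i-j| > 1. Hence T(M,N) - T(N,M) is a multiple of Ex̂ - Eŷ (`balanced_set`), and, the
eigenvalues being distinct, every T(M,N) lies in the span of Ex̂, Eŷ, Ex_y^-, Ex_y^+
(`tripleVec_mem`). Put s = θ*_{i-1} - θ*_i and t = θ*_i - θ*_{i+1} for ∂(x,y) = i. Modulo Ex̂ and
Eŷ, a nonzero multiple of the Norton product is s Ex_y^- - t Ex_y^+ (`norton_mem`). So the condition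
at (x,y) only asks that Ex_y^± lie in the span of Ex̂, Eŷ, Ex̂ ⋆ Eŷ, which is automatic at distances
0, 1 and D.

For 2 ≤ i ≤ D-1 let a, b be the components of Ex_y^-, Ex_y^+ orthogonal to Ex̂ and Eŷ (`lowVec`,
`upVec`). The condition becomes: a and b are both multiples of sa - tb
(`isNortonBalancedAt_iff_exists`). This forces the Gram determinant of a, b to vanish; conversely,
once it vanishes, the only obstruction is sa - tb = 0 with a, b not both zero. Reinforcement makes
⟨a,a⟩ and ⟨b,b⟩ depend on i alone, as affine functions of z_i and z_{i+1}, while ⟨a,b⟩ is an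
explicit multiple of γ*. If γ* = 0, a zero determinant kills a or b, and s, t ≠ 0 leaves no
obstruction. If γ* ≠ 0, then ⟨a,b⟩ ≠ 0, so a zero determinant means a = λ_i b with λ_i =
⟨a,a⟩/⟨a,b⟩, and the obstruction is λ_i = t/s.

It remains to express z_i through z_2 (`kiteNumber_eq`). For an edge xz the sums of Eŵ over Γ_h(x) ∩
Γ_{h-1}(z) are, modulo Ex̂ and Eẑ, known multiples of one vector (`edge_proportional`). Pairing with
a vector orthogonal to Ex̂ and Eẑ and summing over edges gives z_i = α_i z_2 + a_1 β_i. Thus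
Φ_i(z_2) is the Gram determinant up to a nonzero factor. -/

lemma dist_symm (G : SimpleGraph X) (x y : X) : G.dist x y = G.dist y x := G.dist_comm

/-- The sphere `Γ_i(x)`. -/
def sphere (G : SimpleGraph X) (i : ℕ) (x : X) : Finset X :=
  Finset.univ.filter fun z => G.dist x z = i

@[simp] lemma mem_sphere {i : ℕ} {x z : X} : z ∈ sphere G i x ↔ G.dist x z = i := by
  simp [sphere]

@[simp] lemma mem_sphereInter {i j : ℕ} {x y z : X} :
    z ∈ sphereInter G i j x y ↔ G.dist x z = i ∧ G.dist y z = j := by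
  simp [sphereInter]

namespace IsDistanceRegularWith

lemma triangle (hG : IsDistanceRegularWith G D p) (x y z : X) :
    G.dist x z ≤ G.dist x y + G.dist y z := hG.connected.dist_triangle

lemma dist_le (hG : IsDistanceRegularWith G D p) (x y : X) : G.dist x y ≤ D := by
  have := hG.connected.nonempty
  rw [← hG.diam_eq]
  exact SimpleGraph.dist_le_diam (SimpleGraph.connected_iff_ediam_ne_top.1 hG.connected)

lemma dist_eq_zero (hG : IsDistanceRegularWith G D p) {x y : X} : G.dist x y = 0 ↔ x = y :=
  hG.connected.dist_eq_zero_iff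

lemma exists_between (hG : IsDistanceRegularWith G D p) (x y : X) {j : ℕ}
    (hj : j ≤ G.dist x y) : ∃ z, G.dist x z = j ∧ G.dist z y = G.dist x y - j := by
  obtain ⟨w, hw⟩ := hG.connected.exists_walk_length_eq_dist x y
  refine ⟨w.getVert j, ?_⟩
  have h1 := SimpleGraph.dist_le (w.take j)
  have h2 := SimpleGraph.dist_le (w.drop j)
  have h3 := hG.triangle x (w.getVert j) y
  rw [SimpleGraph.Walk.take_length] at h1
  rw [SimpleGraph.Walk.drop_length] at h2
  omega

lemma exists_dist_eq (hG : IsDistanceRegularWith G D p) {i : ℕ} (hi : i ≤ D) :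
    ∃ x y, G.dist x y = i := by
  have := hG.connected.nonempty
  obtain ⟨u, v, h⟩ := G.exists_dist_eq_diam
  rw [hG.diam_eq] at h
  obtain ⟨z, hz, -⟩ := hG.exists_between u v (j := i) (by omega)
  exact ⟨u, z, hz⟩

lemma card_sphere (hG : IsDistanceRegularWith G D p) {i : ℕ} (hi : i ≤ D) (x : X) :
    (sphere G i x).card = kNum p i := by
  rw [kNum, ← hG.card_eq 0 i i (by omega) hi hi x x (by simp)]
  congr 1
  ext z
  simp

lemma kNum_pos (hG : IsDistanceRegularWith G D p) {i : ℕ} (hi : i ≤ D) : 0 < kNum p i := by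
  obtain ⟨x, y, h⟩ := hG.exists_dist_eq hi
  rw [← hG.card_sphere hi x]
  exact Finset.card_pos.2 ⟨y, by simpa using h⟩

lemma exists_closer (hG : IsDistanceRegularWith G D p) {i : ℕ} (hi : 1 ≤ i) {x y : X}
    (h : G.dist x y = i) : ∃ z, G.dist x z = 1 ∧ G.dist y z = i - 1 := by
  obtain ⟨z, h1, h2⟩ := hG.exists_between x y (j := 1) (by omega)
  exact ⟨z, h1, by rw [G.dist_comm, h2, h]⟩

lemma card_closer (hG : IsDistanceRegularWith G D p) {i : ℕ} (hi : 1 ≤ i) {x y : X}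
    (h : G.dist x y = i) : (sphereInter G 1 (i - 1) x y).card = cNum p i := by
  have := hG.dist_le x y
  exact hG.card_eq i 1 (i - 1) (by omega) (by omega) (by omega) x y h

lemma card_farther (hG : IsDistanceRegularWith G D p) {i : ℕ} (hi : i < D) {x y : X}
    (h : G.dist x y = i) : (sphereInter G 1 (i + 1) x y).card = bNum p i :=
  hG.card_eq i 1 (i + 1) (by omega) (by omega) (by omega) x y h

lemma cNum_pos (hG : IsDistanceRegularWith G D p) {i : ℕ} (hi : 1 ≤ i) (hiD : i ≤ D) :
    0 < cNum p i := by
  obtain ⟨x, y, h⟩ := hG.exists_dist_eq hiD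
  rw [← hG.card_closer hi h]
  obtain ⟨z, hz⟩ := hG.exists_closer hi h
  exact Finset.card_pos.2 ⟨z, by simpa using hz⟩

lemma bNum_pos (hG : IsDistanceRegularWith G D p) {i : ℕ} (hi : i < D) : 0 < bNum p i := by
  obtain ⟨x, y, h⟩ := hG.exists_dist_eq (i := i + 1) (by omega)
  obtain ⟨z, h1, h2⟩ := hG.exists_closer (by omega) h
  rw [← hG.card_farther hi (x := z) (y := y) (by rw [G.dist_comm, h2]; omega)]
  exact Finset.card_pos.2 ⟨x, by simp [-SimpleGraph.dist_eq_one_iff_adj, dist_symm G z x, dist_symm G y x, h1, h]⟩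

lemma exists_farther (hG : IsDistanceRegularWith G D p) {i : ℕ} (hi : i < D) {x y : X}
    (h : G.dist x y = i) : ∃ z, G.dist x z = 1 ∧ G.dist y z = i + 1 := by
  have h1 := hG.bNum_pos hi
  rw [← hG.card_farther hi h] at h1
  obtain ⟨z, hz⟩ := Finset.card_pos.1 h1
  exact ⟨z, by simpa using hz⟩

/-- `|Γ_i(x) ∩ Γ_{i-1}(z)|` for an edge `xz`, times the valency, is `k_i c_i`. -/
lemma valency_mul_edge (hG : IsDistanceRegularWith G D p) {i : ℕ} (hi : 1 ≤ i) (hiD : i ≤ D) :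
    kNum p 1 * p 1 i (i - 1) = kNum p i * cNum p i := by
  have hD : 1 ≤ D := by omega
  obtain ⟨x⟩ := hG.connected.nonempty
  have key := Finset.sum_card_bipartiteAbove_eq_sum_card_bipartiteBelow
    (s := sphere G 1 x) (t := sphere G i x) (fun z w => G.dist z w = i - 1)
  rw [Finset.sum_const_nat (m := p 1 i (i - 1)), Finset.sum_const_nat (m := cNum p i),
    hG.card_sphere hD, hG.card_sphere hiD] at key
  · exact key
  · intro w hw
    rw [mem_sphere] at hw
    rw [← hG.card_closer hi hw]
    congr 1
    ext z
    simp [-SimpleGraph.dist_eq_one_iff_adj, Finset.bipartiteBelow, dist_symm G w z]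
  · intro z hz
    rw [mem_sphere] at hz
    rw [← hG.card_eq 1 i (i - 1) (by omega) hiD (by omega) x z hz]
    congr 1
    ext w
    simp [-SimpleGraph.dist_eq_one_iff_adj, Finset.bipartiteAbove]

lemma kNum_mul_bNum (hG : IsDistanceRegularWith G D p) {i : ℕ} (hiD : i < D) :
    kNum p i * bNum p i = kNum p (i + 1) * cNum p (i + 1) := by
  obtain ⟨y⟩ := hG.connected.nonempty
  have key := Finset.sum_card_bipartiteAbove_eq_sum_card_bipartiteBelow
    (s := sphere G i y) (t := sphere G (i + 1) y) (fun z w => G.dist z w = 1)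
  rw [Finset.sum_const_nat (m := bNum p i), Finset.sum_const_nat (m := cNum p (i + 1)),
    hG.card_sphere hiD.le, hG.card_sphere hiD] at key
  · exact key
  · intro w hw
    rw [mem_sphere, G.dist_comm] at hw
    rw [← hG.card_closer (by omega) hw]
    congr 1
    ext z
    simp [-SimpleGraph.dist_eq_one_iff_adj, Finset.bipartiteBelow, dist_symm G w z, and_comm]
  · intro z hz
    rw [mem_sphere, G.dist_comm] at hz
    rw [← hG.card_farther hiD hz]
    congr 1
    ext w
    simp [-SimpleGraph.dist_eq_one_iff_adj, Finset.bipartiteAbove, and_comm]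

lemma card_pos (hG : IsDistanceRegularWith G D p) : (0 : ℝ) < Fintype.card X := by
  have := hG.connected.nonempty
  exact_mod_cast Fintype.card_pos

end IsDistanceRegularWith

/-- The matrix whose `(x, y)` entry is `f (∂(x,y))`. -/
def distFun (G : SimpleGraph X) (f : ℕ → ℝ) : Matrix X X ℝ :=
  Matrix.of fun x y => f (G.dist x y)

@[simp] lemma distFun_apply (f : ℕ → ℝ) (x y : X) : distFun G f x y = f (G.dist x y) := rfl

@[simp] lemma distMatrix_apply (i : ℕ) (x y : X) :
    distMatrix G i x y = if G.dist x y = i then 1 else 0 := rfl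

lemma sum_smul_distMatrix_apply (hG : IsDistanceRegularWith G D p) (f : ℕ → ℝ) (x y : X) :
    (∑ i ∈ Finset.range (D + 1), f i • distMatrix G i) x y = f (G.dist x y) := by
  have h := hG.dist_le x y
  simp only [Matrix.sum_apply, Matrix.smul_apply, distMatrix_apply, smul_eq_mul, mul_ite, mul_one,
    mul_zero]
  rw [Finset.sum_ite_eq, if_pos (Finset.mem_range.2 (by omega))]

lemma distFun_eq_sum (hG : IsDistanceRegularWith G D p) (f : ℕ → ℝ) :
    distFun G f = ∑ i ∈ Finset.range (D + 1), f i • distMatrix G i := by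
  ext x y
  rw [sum_smul_distMatrix_apply hG, distFun_apply]

lemma distFun_mem_boseMesner (hG : IsDistanceRegularWith G D p) (f : ℕ → ℝ) :
    distFun G f ∈ boseMesner G D := by
  rw [distFun_eq_sum hG]
  refine Submodule.sum_mem _ fun i hi => Submodule.smul_mem _ _ (Submodule.subset_span ?_)
  exact ⟨⟨i, Finset.mem_range.1 hi⟩, rfl⟩

lemma exists_distFun_of_mem_boseMesner {M : Matrix X X ℝ} (hM : M ∈ boseMesner G D) :
    ∃ f, M = distFun G f := by
  induction hM using Submodule.span_induction with
  | mem M hM =>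
    obtain ⟨i, rfl⟩ := hM
    exact ⟨fun j => if j = i then 1 else 0, by ext; simp⟩
  | zero => exact ⟨0, by ext; simp⟩
  | add M M' _ _ h h' =>
    obtain ⟨f, rfl⟩ := h
    obtain ⟨g, rfl⟩ := h'
    exact ⟨f + g, by ext; simp⟩
  | smul c M _ h =>
    obtain ⟨f, rfl⟩ := h
    exact ⟨c • f, by ext; simp⟩

lemma distMatrix_eq_distFun (i : ℕ) :
    distMatrix G i = distFun G fun j => if j = i then 1 else 0 := by
  ext; simp

/-- The indicator of distance less than `h`. -/
def ballMatrix (G : SimpleGraph X) (h : ℕ) : Matrix X X ℝ :=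
  ∑ m ∈ Finset.range h, distMatrix G m

lemma ballMatrix_apply (h : ℕ) (x y : X) :
    ballMatrix G h x y = if G.dist x y < h then 1 else 0 := by
  simp [ballMatrix, Matrix.sum_apply]

lemma distMatrix_mul_apply (i : ℕ) (M : Matrix X X ℝ) (x y : X) :
    (distMatrix G i * M) x y = ∑ w ∈ sphere G i x, M w y := by
  simp [Matrix.mul_apply, sphere, Finset.sum_filter]

/-- `A (A_0 + ⋯ + A_{h-1}) = k (A_0 + ⋯ + A_{h-1}) - b_{h-1} A_{h-1} + c_h A_h`. -/
lemma distMatrix_one_mul_ballMatrix (hG : IsDistanceRegularWith G D p) {h : ℕ} (h1 : 1 ≤ h)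
    (hh : h ≤ D) :
    distMatrix G 1 * ballMatrix G h = (kNum p 1 : ℝ) • ballMatrix G h
      - (bNum p (h - 1) : ℝ) • distMatrix G (h - 1) + (cNum p h : ℝ) • distMatrix G h := by
  ext x y
  have hk := hG.card_sphere (i := 1) (by omega) x
  rw [distMatrix_mul_apply]
  simp only [ballMatrix_apply, Matrix.add_apply, Matrix.sub_apply, Matrix.smul_apply,
    distMatrix_apply, smul_eq_mul, Finset.sum_boole]
  -- Moving to a neighbour changes the distance by at most 1, so only the boundary spheres h-1 and h
  -- deviate from multiplication by k; the numbers a_i never enter.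
  have tri : ∀ w ∈ sphere G 1 x, G.dist w y ≤ G.dist x y + 1 ∧ G.dist x y ≤ G.dist w y + 1 := by
    intro w hw
    rw [mem_sphere] at hw
    have e1 := hG.triangle x w y
    have e2 := hG.triangle w x y
    rw [dist_symm G w x] at e2
    omega
  rcases lt_trichotomy (G.dist x y) h with hlt | heq | hgt
  · rcases Nat.lt_or_ge (G.dist x y) (h - 1) with hlt' | hge
    · rw [Finset.filter_true_of_mem (fun w hw => by have := tri w hw; omega), hk,
        if_pos hlt, if_neg (by omega), if_neg (by omega)]
      ring
    · have he : G.dist x y = h - 1 := by omega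
      have hb := hG.card_farther (i := h - 1) (by omega) he
      have hsplit := Finset.card_filter_add_card_filter_not (s := sphere G 1 x)
        (fun w => G.dist w y < h)
      have : (sphere G 1 x).filter (fun w => ¬ G.dist w y < h) =
          sphereInter G 1 (h - 1 + 1) x y := by
        ext w
        simp only [Finset.mem_filter, mem_sphere, mem_sphereInter]
        refine and_congr_right fun hw => ?_
        have := tri w (by simpa using hw)
        have := dist_symm G w y
        omega
      rw [this, hb, hk] at hsplit
      rw [if_pos hlt, if_pos he, if_neg (by omega), ← hsplit]
      push_cast
      ring
  · have hc := hG.card_closer h1 heq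
    have : (sphere G 1 x).filter (fun w => G.dist w y < h) = sphereInter G 1 (h - 1) x y := by
      ext w
      simp only [Finset.mem_filter, mem_sphere, mem_sphereInter]
      refine and_congr_right fun hw => ?_
      have := tri w (by simpa using hw)
      have := dist_symm G w y
      omega
    rw [this, hc, if_neg (by omega), if_neg (by omega), if_pos heq]
    ring
  · rw [Finset.filter_false_of_mem (fun w hw => by have := tri w hw; omega),
      if_neg (by omega), if_neg (by omega), if_neg (by omega)]
    simp

end DistanceRegular

/-! ### The bilinear vectors T(M,N). -/

section TripleVec

variable {X : Type*} [Fintype X] [DecidableEq X]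

/-- `∑_w M(y,w) N(w,z) E ŵ`, for symmetric `E`. -/
def tripleVec (E M N : Matrix X X ℝ) (y z : X) : X → ℝ :=
  fun x => ∑ w, E x w * (M y w * N w z)

lemma tripleVec_eq_mul_diagonal_mul (E M N : Matrix X X ℝ) (y z x : X) :
    tripleVec E M N y z x = (M * Matrix.diagonal (E x) * N) y z := by
  rw [Matrix.mul_assoc, Matrix.mul_apply, tripleVec]
  refine Finset.sum_congr rfl fun w _ => ?_
  rw [Matrix.diagonal_mul]
  ring

lemma tripleVec_sum_left {ι : Type*} (E N : Matrix X X ℝ) (y z : X) (s : Finset ι) (c : ι → ℝ)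
    (M : ι → Matrix X X ℝ) :
    tripleVec E (∑ i ∈ s, c i • M i) N y z = ∑ i ∈ s, c i • tripleVec E (M i) N y z := by
  ext x
  simp only [tripleVec, Finset.sum_apply, Pi.smul_apply, smul_eq_mul, Matrix.sum_apply,
    Matrix.smul_apply, Finset.mul_sum, Finset.sum_mul]
  rw [Finset.sum_comm]
  exact Finset.sum_congr rfl fun i _ => Finset.sum_congr rfl fun w _ => by ring

lemma tripleVec_sum_right {ι : Type*} (E M : Matrix X X ℝ) (y z : X) (s : Finset ι) (c : ι → ℝ)
    (N : ι → Matrix X X ℝ) :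
    tripleVec E M (∑ i ∈ s, c i • N i) y z = ∑ i ∈ s, c i • tripleVec E M (N i) y z := by
  ext x
  simp only [tripleVec, Finset.sum_apply, Pi.smul_apply, smul_eq_mul, Matrix.sum_apply,
    Matrix.smul_apply, Finset.mul_sum]
  rw [Finset.sum_comm]
  exact Finset.sum_congr rfl fun i _ => Finset.sum_congr rfl fun w _ => by ring

@[simp] lemma mulVec_hat_apply (E : Matrix X X ℝ) (x y : X) : (E *ᵥ hat y) x = E x y := by
  simp [hat]

lemma tripleVec_one_left (E N : Matrix X X ℝ) (y z : X) :
    tripleVec E 1 N y z = N y z • (E *ᵥ hat y) := by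
  ext x
  simp [tripleVec, Matrix.one_apply, mul_comm]

lemma tripleVec_one_right (E M : Matrix X X ℝ) (y z : X) :
    tripleVec E M 1 y z = M y z • (E *ᵥ hat z) := by
  ext x
  simp [tripleVec, Matrix.one_apply, mul_comm]

lemma tripleVec_zero_left (E N : Matrix X X ℝ) (y z : X) : tripleVec E 0 N y z = 0 := by
  ext x; simp [tripleVec]

lemma tripleVec_zero_right (E M : Matrix X X ℝ) (y z : X) : tripleVec E M 0 y z = 0 := by
  ext x; simp [tripleVec]

lemma tripleVec_const_left (E N : Matrix X X ℝ) (c : ℝ) (y z x : X) :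
    tripleVec E (c • Matrix.of fun _ _ => (1 : ℝ)) N y z x = c * (E * N) x z := by
  simp only [tripleVec, Matrix.mul_apply, Finset.mul_sum, Matrix.smul_apply, Matrix.of_apply]
  exact Finset.sum_congr rfl fun w _ => by simp; ring

lemma tripleVec_const_right (E M : Matrix X X ℝ) (c : ℝ) (y z x : X) :
    tripleVec E M (c • Matrix.of fun _ _ => (1 : ℝ)) y z x = c * (E * Mᵀ) x y := by
  simp only [tripleVec, Matrix.mul_apply, Finset.mul_sum, Matrix.smul_apply, Matrix.of_apply,
    Matrix.transpose_apply]
  exact Finset.sum_congr rfl fun w _ => by simp; ring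

/-- Puts the Norton product into the same bilinear family as the sphere sums, so that both can be
expanded in the primitive idempotents. -/
lemma nortonProd_eq_tripleVec {E : Matrix X X ℝ} (hE : Eᵀ = E) (y z : X) :
    nortonProd E (E *ᵥ hat y) (E *ᵥ hat z) = tripleVec E E E y z := by
  ext x
  simp only [nortonProd, Matrix.mulVec, dotProduct, tripleVec, Pi.mul_apply]
  refine Finset.sum_congr rfl fun w _ => ?_
  have h1 := mulVec_hat_apply E w y
  have h2 := mulVec_hat_apply E w z
  simp only [Matrix.mulVec, dotProduct] at h1 h2
  rw [h1, h2, ← Matrix.transpose_apply E y w, hE]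

end TripleVec

/-- A Q-polynomial ordering of the primitive idempotents, extended by zero past the diameter. -/
structure IsExtendedQOrdering {X : Type*} [Fintype X] [DecidableEq X] (G : SimpleGraph X) (D : ℕ)
    (F : ℕ → Matrix X X ℝ) : Prop where
  ordering : IsQPolynomialOrdering G D F
  eq_zero : ∀ j, D < j → F j = 0

/-! ### Primitive idempotents, triple product relations and the balanced set condition. -/

section Ordering

variable {X : Type*} [Fintype X] [DecidableEq X] {G : SimpleGraph X} {D : ℕ}
  {p : ℕ → ℕ → ℕ → ℕ} {F : ℕ → Matrix X X ℝ}

/-- With E_j = 0 past D, the tridiagonal recursions may mention E_{m+2} without treating the end of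
the range separately. -/
lemma IsQPolynomialIdempotent.exists_extended {E : Matrix X X ℝ} (hD : 1 ≤ D)
    (hE : IsQPolynomialIdempotent G D E) : ∃ F, IsExtendedQOrdering G D F ∧ F 1 = E := by
  obtain ⟨F, ⟨⟨h1, h2, h3, h4, h5, h6⟩, q, h7, h8⟩, rfl⟩ := hE
  have key : ∀ i ≤ D, (if i ≤ D then F i else 0) = F i := fun i hi => if_pos hi
  have key' : (fun i : Fin (D + 1) => if (i : ℕ) ≤ D then F i else 0) =
      fun i : Fin (D + 1) => F i := funext fun i => key i (by omega)
  refine ⟨fun i => if i ≤ D then F i else 0, ⟨⟨⟨?_, ?_, ?_, ?_, ?_, ?_⟩, q, ?_, h8⟩, ?_⟩,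
    key 1 hD⟩
  · simp only [key']
    exact h1
  · simp only [key']
    exact h2
  · simpa using h3
  · rw [← h4]
    exact Finset.sum_congr rfl fun i hi => key i (by rw [Finset.mem_range] at hi; omega)
  · intro i hi
    simp only [key i hi, h5 i hi]
  · intro i hi j hj
    simp only [key i hi, key j hj, h6 i hi j hj]
  · intro i hi j hj
    simp only [key i hi, key j hj, h7 i hi j hj]
    congr 1
    exact Finset.sum_congr rfl fun h hh => by
      rw [key h (by rw [Finset.mem_range] at hh; omega)]
  · intro j hj
    exact if_neg (by omega)

namespace IsExtendedQOrdering

lemma mul_eq (hF : IsExtendedQOrdering G D F) (i j : ℕ) :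
    F i * F j = if i = j then F i else 0 := by
  rcases Nat.lt_or_ge D i with hi | hi
  · simp [hF.eq_zero i hi]
  rcases Nat.lt_or_ge D j with hj | hj
  · rw [hF.eq_zero j hj, if_neg (by omega), mul_zero]
  exact hF.ordering.1.mul_eq i hi j hj

lemma mul_self (hF : IsExtendedQOrdering G D F) (i : ℕ) : F i * F i = F i := by
  rw [hF.mul_eq, if_pos rfl]

lemma mul_of_ne (hF : IsExtendedQOrdering G D F) {i j : ℕ} (h : i ≠ j) : F i * F j = 0 := by
  rw [hF.mul_eq, if_neg h]

lemma transpose_eq (hF : IsExtendedQOrdering G D F) (i : ℕ) : (F i)ᵀ = F i := by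
  rcases Nat.lt_or_ge D i with hi | hi
  · simp [hF.eq_zero i hi]
  exact hF.ordering.1.transpose_eq i hi

lemma symm_apply (hF : IsExtendedQOrdering G D F) (i : ℕ) (x y : X) : F i x y = F i y x :=
  congrFun (congrFun (hF.transpose_eq i) y) x

lemma ne_zero (hF : IsExtendedQOrdering G D F) {i : ℕ} (hi : i ≤ D) : F i ≠ 0 :=
  hF.ordering.1.linearIndependent.ne_zero (⟨i, by omega⟩ : Fin (D + 1))

lemma exists_distFun (hF : IsExtendedQOrdering G D F) (i : ℕ) : ∃ f, F i = distFun G f := by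
  rcases Nat.lt_or_ge D i with hi | hi
  · exact ⟨0, by rw [hF.eq_zero i hi]; ext; simp⟩
  · refine exists_distFun_of_mem_boseMesner (D := D) ?_
    rw [← hF.ordering.1.span_eq]
    exact Submodule.subset_span ⟨⟨i, by omega⟩, rfl⟩

lemma exists_coeff (hF : IsExtendedQOrdering G D F) (hG : IsDistanceRegularWith G D p)
    (f : ℕ → ℝ) : ∃ m : ℕ → ℝ, distFun G f = ∑ j ∈ Finset.range (D + 1), m j • F j := by
  have h := distFun_mem_boseMesner hG f
  rw [← hF.ordering.1.span_eq, Submodule.mem_span_range_iff_exists_fun] at h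
  obtain ⟨c, hc⟩ := h
  refine ⟨fun j => if h : j < D + 1 then c ⟨j, h⟩ else 0, ?_⟩
  rw [← hc, Finset.sum_range]
  exact Finset.sum_congr rfl fun i _ => by simp only [i.2, dif_pos]

lemma sum_smul_mul (hF : IsExtendedQOrdering G D F) (m : ℕ → ℝ) (i : ℕ) :
    (∑ j ∈ Finset.range (D + 1), m j • F j) * F i = m i • F i := by
  rw [Finset.sum_mul]
  simp only [Matrix.smul_mul, hF.mul_eq]
  rw [Finset.sum_eq_single i]
  · simp
  · intro j _ hj
    simp [hj]
  · intro hi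
    rw [hF.eq_zero i (by simpa using hi)]
    simp

lemma mul_sum_smul (hF : IsExtendedQOrdering G D F) (m : ℕ → ℝ) (i : ℕ) :
    F i * (∑ j ∈ Finset.range (D + 1), m j • F j) = m i • F i := by
  rw [Finset.mul_sum]
  simp only [Matrix.mul_smul, hF.mul_eq]
  rw [Finset.sum_eq_single i]
  · simp
  · intro j _ hj
    simp [hj.symm]
  · intro hi
    rw [hF.eq_zero i (by simpa using hi)]
    simp

lemma sum_eq_one (hF : IsExtendedQOrdering G D F) :
    ∑ j ∈ Finset.range (D + 1), F j = 1 := hF.ordering.1.sum_eq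

/-- The triple product relation `E_i A* E_j = 0` for `|i - j| > 1`. -/
lemma mul_diagonal_mul_eq_zero (hF : IsExtendedQOrdering G D F) (hD : 1 ≤ D) {i j : ℕ}
    (hij : i + 1 < j ∨ j + 1 < i) (x : X) : F i * Matrix.diagonal (F 1 x) * F j = 0 := by
  rcases Nat.lt_or_ge D i with hi | hi
  · simp [hF.eq_zero i hi]
  rcases Nat.lt_or_ge D j with hj | hj
  · simp [hF.eq_zero j hj]
  obtain ⟨-, q, hq, hq'⟩ := hF.ordering
  have hq0 : q 1 i j = 0 := (hq' 1 hD i hi j hj).1 (by omega)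
  -- A real matrix M vanishes once tr(MMᵀ) = 0. Here the trace is the (x,x) entry of E (E_i ∘ E_j) E
  -- = |X|⁻¹ q^1_{i,j} E, and this Krein parameter is zero.
  rw [← Matrix.trace_mul_conjTranspose_self_eq_zero_iff, Matrix.conjTranspose_eq_transpose_of_trivial]
  simp only [Matrix.transpose_mul, Matrix.diagonal_transpose, hF.transpose_eq]
  have e1 : F i * Matrix.diagonal (F 1 x) * F j * (F j * (Matrix.diagonal (F 1 x) * F i)) =
      F i * (Matrix.diagonal (F 1 x) * F j * Matrix.diagonal (F 1 x) * F i) := by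
    have := hF.mul_self j
    simp only [Matrix.mul_assoc]
    rw [← Matrix.mul_assoc (F j) (F j), this]
  have e2 : (Matrix.diagonal (F 1 x) * F j * Matrix.diagonal (F 1 x) * F i * F i).trace =
      (F 1 * (Matrix.hadamard (F i) (F j)) * F 1) x x := by
    rw [Matrix.mul_assoc _ (F i), hF.mul_self i]
    have hM : ∀ w v, (Matrix.diagonal (F 1 x) * F j * Matrix.diagonal (F 1 x)) w v =
        F 1 x w * F j w v * F 1 x v := fun w v => by
      rw [Matrix.mul_diagonal, Matrix.diagonal_mul]
    generalize Matrix.diagonal (F 1 x) * F j * Matrix.diagonal (F 1 x) = M at hM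
    simp only [Matrix.trace, Matrix.diag_apply, Matrix.mul_apply, Matrix.hadamard_apply,
      Finset.sum_mul]
    rw [Finset.sum_comm]
    refine Finset.sum_congr rfl fun v _ => Finset.sum_congr rfl fun w _ => ?_
    rw [hM, hF.symm_apply 1 v x, hF.symm_apply i v w]
    ring
  rw [e1, Matrix.trace_mul_comm, e2, hq i hi j hj]
  rw [Matrix.mul_smul, Matrix.smul_mul]
  rw [hF.mul_sum_smul, Matrix.smul_mul, hq0]
  simp

lemma tripleVec_eq_zero (hF : IsExtendedQOrdering G D F) (hD : 1 ≤ D) {i j : ℕ}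
    (hij : i + 1 < j ∨ j + 1 < i) (y z : X) : tripleVec (F 1) (F i) (F j) y z = 0 := by
  ext x
  rw [tripleVec_eq_mul_diagonal_mul, hF.mul_diagonal_mul_eq_zero hD hij]
  rfl

/-- The balanced set condition. -/
theorem balanced_set (hF : IsExtendedQOrdering G D F) (hG : IsDistanceRegularWith G D p)
    (hD : 1 ≤ D) (f g : ℕ → ℝ) : ∃ Y : ℕ → ℝ, ∀ y z : X,
      tripleVec (F 1) (distFun G f) (distFun G g) y z -
        tripleVec (F 1) (distFun G g) (distFun G f) y z =
      Y (G.dist y z) • (F 1 *ᵥ hat z - F 1 *ᵥ hat y) := by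
  obtain ⟨m, hm⟩ := hF.exists_coeff hG f
  obtain ⟨n, hn⟩ := hF.exists_coeff hG g
  -- The aim is T(M,N) - T(N,M) = T(C,1) - T(1,C) with C = ∑ c_i E_i. Comparing coefficients of
  -- T(E_i,E_j) asks for m_i n_j - n_i m_j = c_i - c_j, and only |i-j| ≤ 1 matters, so c can be
  -- defined recursively.
  let c : ℕ → ℝ := fun i => Nat.rec 0 (fun i r => r - (m i * n (i + 1) - n i * m (i + 1))) i
  have hc : ∀ i, c (i + 1) = c i - (m i * n (i + 1) - n i * m (i + 1)) := fun i => rfl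
  obtain ⟨Y, hY⟩ : ∃ Y, ∑ j ∈ Finset.range (D + 1), c j • F j = distFun G Y := by
    refine exists_distFun_of_mem_boseMesner (D := D) ?_
    rw [← hF.ordering.1.span_eq]
    refine Submodule.sum_mem _ fun i hi => Submodule.smul_mem _ _ (Submodule.subset_span ?_)
    exact ⟨⟨i, Finset.mem_range.1 hi⟩, rfl⟩
  refine ⟨Y, fun y z => ?_⟩
  have hsum := hF.sum_eq_one
  have hsum' : ∑ j ∈ Finset.range (D + 1), (1 : ℝ) • F j = 1 := by simpa using hsum
  have e1 : tripleVec (F 1) (distFun G Y) 1 y z - tripleVec (F 1) 1 (distFun G Y) y z =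
      Y (G.dist y z) • (F 1 *ᵥ hat z - F 1 *ᵥ hat y) := by
    rw [tripleVec_one_left, tripleVec_one_right, distFun_apply, smul_sub]
  rw [← e1, hm, hn, ← hY, ← hsum']
  simp only [tripleVec_sum_left, tripleVec_sum_right, Finset.smul_sum, smul_smul,
    ← Finset.sum_sub_distrib]
  refine Finset.sum_congr rfl fun i _ => Finset.sum_congr rfl fun j _ => ?_
  by_cases hij : i + 1 < j ∨ j + 1 < i
  · rw [hF.tripleVec_eq_zero hD hij.symm]
    simp
  · rw [← sub_smul, ← sub_smul]
    congr 1
    have : j = i ∨ j = i + 1 ∨ i = j + 1 := by omega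
    rcases this with rfl | rfl | rfl
    · ring
    · rw [hc]; ring
    · rw [hc]; ring

end IsExtendedQOrdering

end Ordering

/-! ### Eigenvalues and dual eigenvalues: distinctness, nonvanishing, recurrence. -/

section Scalars

variable {X : Type*} [Fintype X] [DecidableEq X] {G : SimpleGraph X} {D : ℕ}
  {p : ℕ → ℕ → ℕ → ℕ} {F : ℕ → Matrix X X ℝ} {θs : ℕ → ℝ}

lemma IsDualEigenvalueSeq.apply {E : Matrix X X ℝ} (hθ : IsDualEigenvalueSeq G D E θs)
    (hG : IsDistanceRegularWith G D p) (x y : X) :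
    E x y = (Fintype.card X : ℝ)⁻¹ * θs (G.dist x y) := by
  conv_lhs => rw [hθ]
  rw [Matrix.smul_apply, sum_smul_distMatrix_apply hG, smul_eq_mul]

namespace IsExtendedQOrdering

/-- The eigenvalues `P h j` of `A_h` on `E_j`. -/
lemma exists_eigenvalues (hF : IsExtendedQOrdering G D F) (hG : IsDistanceRegularWith G D p) :
    ∃ P : ℕ → ℕ → ℝ, ∀ h, distMatrix G h = ∑ j ∈ Finset.range (D + 1), P h j • F j := by
  have : ∀ h, ∃ m : ℕ → ℝ, distMatrix G h = ∑ j ∈ Finset.range (D + 1), m j • F j := fun h => by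
    rw [distMatrix_eq_distFun]
    exact hF.exists_coeff hG _
  choose P hP using this
  exact ⟨P, hP⟩

/-- Since E is symmetric and idempotent, its diagonal entry |X|⁻¹ θ*_0 is the squared norm of any
row; if it were zero, E would vanish. -/
lemma dual_pos (hF : IsExtendedQOrdering G D F) (hG : IsDistanceRegularWith G D p) (hD : 1 ≤ D)
    (hθ : IsDualEigenvalueSeq G D (F 1) θs) : 0 < θs 0 := by
  have hN := hG.card_pos
  have hsq : ∀ x, (Fintype.card X : ℝ)⁻¹ * θs 0 = ∑ w, F 1 x w ^ 2 := fun x => by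
    have h1 := hθ.apply hG x x
    rw [← hF.mul_self 1, Matrix.mul_apply, G.dist_self] at h1
    rw [← h1]
    exact Finset.sum_congr rfl fun w _ => by rw [hF.symm_apply 1 w x, sq]
  obtain ⟨x⟩ := hG.connected.nonempty
  have h0 : 0 ≤ (Fintype.card X : ℝ)⁻¹ * θs 0 := by
    rw [hsq x]
    exact Finset.sum_nonneg fun w _ => sq_nonneg _
  rcases h0.lt_or_eq with h | h
  · exact (pos_iff_pos_of_mul_pos h).1 (inv_pos.2 hN)
  · exfalso
    refine hF.ne_zero hD ?_
    ext y w
    have h2 := hsq y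
    rw [← h, eq_comm, Finset.sum_eq_zero_iff_of_nonneg fun w _ => sq_nonneg _] at h2
    simpa using h2 w (Finset.mem_univ w)

/-- The dual eigenvalues are mutually distinct. -/
lemma dual_injOn (hF : IsExtendedQOrdering G D F) (hG : IsDistanceRegularWith G D p) (hD : 1 ≤ D)
    (hθ : IsDualEigenvalueSeq G D (F 1) θs) {i j : ℕ} (hi : i ≤ D) (hj : j ≤ D) (hij : i ≠ j) :
    θs i ≠ θs j := by
  intro he
  have hN := hG.card_pos
  obtain ⟨x, y, hxy⟩ := hG.exists_dist_eq hi
  obtain ⟨x', y', hxy'⟩ := hG.exists_dist_eq hj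
  obtain ⟨-, q, hq, hq'⟩ := hF.ordering
  -- Entrywise, E_{m+1} is determined by E_0, …, E_m and E_1, because q^{m+1}_{1,m} ≠ 0 in the
  -- expansion of E_1 ∘ E_m. Two pairs with equal entry in E_1 then agree in every E_m, hence in
  -- A_i, which separates them.
  have key : ∀ m ≤ D, F m x y = F m x' y' := by
    intro m
    induction m using Nat.strong_induction_on with
    | _ m ih =>
      intro hm
      rcases m with _ | m
      · rw [hF.ordering.1.zero_eq]
        rfl
      · have h1 := congrFun (congrFun (hq 1 hD m (by omega)) x) y
        have h2 := congrFun (congrFun (hq 1 hD m (by omega)) x') y'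
        have hsplit : ∀ u v, (∑ h ∈ Finset.range (D + 1), q h 1 m • F h) u v =
            (∑ h ∈ Finset.range (m + 1), q h 1 m * F h u v) +
              q (m + 1) 1 m * F (m + 1) u v := fun u v => by
          rw [← Finset.sum_range_succ (fun h => q h 1 m * F h u v)]
          simp only [Matrix.sum_apply, Matrix.smul_apply, smul_eq_mul]
          symm
          refine Finset.sum_subset (fun a ha => ?_) fun a ha ha' => ?_
          · rw [Finset.mem_range] at *
            omega
          · rw [Finset.mem_range] at *
            rw [(hq' a (by omega) 1 hD m (by omega)).1 (by omega), zero_mul]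
        rw [Matrix.hadamard_apply, Matrix.smul_apply, hsplit, hθ.apply hG] at h1 h2
        have h3 : ∑ h ∈ Finset.range (m + 1), q h 1 m * F h x y =
            ∑ h ∈ Finset.range (m + 1), q h 1 m * F h x' y' :=
          Finset.sum_congr rfl fun h hh => by
            rw [Finset.mem_range] at hh
            rw [ih h hh (by omega)]
        rw [h3, hxy, he, ih m (by omega) (by omega)] at h1
        rw [hxy', h1] at h2
        have hq0 := (hq' (m + 1) hm 1 hD m (by omega)).2 (by omega)
        have h4 := smul_right_injective ℝ (inv_ne_zero hN.ne') h2
        exact mul_left_cancel₀ hq0 (add_left_cancel h4)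
  obtain ⟨m, hm⟩ := hF.exists_coeff hG fun h => if h = i then 1 else 0
  have h1 := congrFun (congrFun hm x) y
  have h2 := congrFun (congrFun hm x') y'
  simp only [Matrix.sum_apply, Matrix.smul_apply, distFun_apply] at h1 h2
  rw [if_pos hxy] at h1
  rw [if_neg (by omega)] at h2
  have : (1 : ℝ) = 0 := by
    rw [h1, h2]
    refine Finset.sum_congr rfl fun a ha => ?_
    rw [Finset.mem_range] at ha
    rw [key a (by omega)]
  exact one_ne_zero this

lemma distMatrix_mul (hF : IsExtendedQOrdering G D F) {P : ℕ → ℕ → ℝ}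
    (hP : ∀ h, distMatrix G h = ∑ j ∈ Finset.range (D + 1), P h j • F j) (h j : ℕ) :
    distMatrix G h * F j = P h j • F j := by
  rw [hP, hF.sum_smul_mul]

lemma mul_distMatrix (hF : IsExtendedQOrdering G D F) {P : ℕ → ℕ → ℝ}
    (hP : ∀ h, distMatrix G h = ∑ j ∈ Finset.range (D + 1), P h j • F j) (h j : ℕ) :
    F j * distMatrix G h = P h j • F j := by
  rw [hP, hF.mul_sum_smul]

lemma ballMatrix_mul (hF : IsExtendedQOrdering G D F) {P : ℕ → ℕ → ℝ}
    (hP : ∀ h, distMatrix G h = ∑ j ∈ Finset.range (D + 1), P h j • F j) (h j : ℕ) :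
    ballMatrix G h * F j = (∑ m ∈ Finset.range h, P m j) • F j := by
  rw [ballMatrix, Finset.sum_mul, Finset.sum_smul]
  exact Finset.sum_congr rfl fun m _ => hF.distMatrix_mul hP m j

lemma smul_cancel (hF : IsExtendedQOrdering G D F) {j : ℕ} (hj : j ≤ D) {a b : ℝ}
    (h : a • F j = b • F j) : a = b :=
  smul_left_injective ℝ (hF.ne_zero hj) h

/-- `(θ_j - k) ∑_{m < h} P m j = c_h P h j - b_{h-1} P (h-1) j`. -/
lemma eigenvalue_sum (hF : IsExtendedQOrdering G D F) (hG : IsDistanceRegularWith G D p)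
    {P : ℕ → ℕ → ℝ} (hP : ∀ h, distMatrix G h = ∑ j ∈ Finset.range (D + 1), P h j • F j)
    {h : ℕ} (h1 : 1 ≤ h) (hh : h ≤ D) {j : ℕ} (hj : j ≤ D) :
    P 1 j * ∑ m ∈ Finset.range h, P m j = kNum p 1 * ∑ m ∈ Finset.range h, P m j
      - bNum p (h - 1) * P (h - 1) j + cNum p h * P h j := by
  have e := congrArg (· * F j) (distMatrix_one_mul_ballMatrix hG h1 hh)
  simp only [Matrix.add_mul, Matrix.sub_mul, Matrix.smul_mul, Matrix.mul_assoc,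
    hF.ballMatrix_mul hP, hF.distMatrix_mul hP, Matrix.mul_smul, smul_smul] at e
  rw [← sub_smul, ← add_smul] at e
  have := hF.smul_cancel hj e
  linarith

/-- The eigenvalues of the adjacency matrix are mutually distinct. -/
lemma eigenvalue_injOn (hF : IsExtendedQOrdering G D F) (hG : IsDistanceRegularWith G D p)
    {P : ℕ → ℕ → ℝ} (hP : ∀ h, distMatrix G h = ∑ j ∈ Finset.range (D + 1), P h j • F j)
    {i j : ℕ} (hi : i ≤ D) (hj : j ≤ D) (hij : i ≠ j) : P 1 i ≠ P 1 j := by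
  intro he
  -- Since c_h ≠ 0, `eigenvalue_sum` recovers P h j from P 1 j and the earlier eigenvalues. Equality
  -- for all A_h would carry over to E_i, which has eigenvalue 1 on E_i and 0 on E_j.
  have key : ∀ h ≤ D, P h i = P h j := by
    intro h
    induction h using Nat.strong_induction_on with
    | _ h ih =>
      intro hh
      rcases Nat.eq_zero_or_pos h with rfl | hpos
      · have hone : distMatrix G 0 = 1 := by
          ext x y
          rw [distMatrix_apply, Matrix.one_apply]
          simp only [hG.dist_eq_zero]
        have hz : ∀ l ≤ D, P 0 l = 1 := fun l hl => by
          refine hF.smul_cancel hl ?_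
          rw [← hF.distMatrix_mul hP, hone, one_mul, one_smul]
        rw [hz i hi, hz j hj]
      · have e1 := hF.eigenvalue_sum hG hP hpos hh hi
        have e2 := hF.eigenvalue_sum hG hP hpos hh hj
        have e3 : ∑ m ∈ Finset.range h, P m i = ∑ m ∈ Finset.range h, P m j :=
          Finset.sum_congr rfl fun m hm => by
            rw [Finset.mem_range] at hm
            exact ih m hm (by omega)
        rw [he, e3, e2, ih (h - 1) (by omega) (by omega)] at e1
        have hc : (cNum p h : ℝ) ≠ 0 := by exact_mod_cast (hG.cNum_pos hpos hh).ne'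
        exact (mul_left_cancel₀ hc (add_left_cancel e1)).symm
  obtain ⟨f, hf⟩ := hF.exists_distFun i
  rw [distFun_eq_sum hG] at hf
  have e : ∀ l, F i * F l = (∑ h ∈ Finset.range (D + 1), f h * P h l) • F l := fun l => by
    conv_lhs => rw [hf]
    rw [Finset.sum_mul, Finset.sum_smul]
    refine Finset.sum_congr rfl fun h _ => ?_
    rw [Matrix.smul_mul, hF.distMatrix_mul hP, smul_smul]
  have e1 := e i
  have e2 := e j
  rw [hF.mul_self] at e1
  rw [hF.mul_of_ne hij] at e2
  have s : ∑ h ∈ Finset.range (D + 1), f h * P h i = ∑ h ∈ Finset.range (D + 1), f h * P h j :=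
    Finset.sum_congr rfl fun h hh => by
      rw [Finset.mem_range] at hh
      rw [key h (by omega)]
  rw [s] at e1
  rcases smul_eq_zero.1 e2.symm with h0 | h0
  · rw [h0, zero_smul] at e1
    exact hF.ne_zero hi e1
  · exact hF.ne_zero hj h0

lemma eigenvalue_zero (hF : IsExtendedQOrdering G D F) (hG : IsDistanceRegularWith G D p)
    {P : ℕ → ℕ → ℝ} (hP : ∀ h, distMatrix G h = ∑ j ∈ Finset.range (D + 1), P h j • F j)
    {h : ℕ} (hh : h ≤ D) : P h 0 = kNum p h := by
  refine hF.smul_cancel (Nat.zero_le D) ?_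
  rw [← hF.distMatrix_mul hP]
  ext x y
  rw [distMatrix_mul_apply, hF.ordering.1.zero_eq]
  simp [hG.card_sphere hh]

/-- Compare diagonal entries in A_h E = P h 1 • E. -/
lemma eigenvalue_one (hF : IsExtendedQOrdering G D F) (hG : IsDistanceRegularWith G D p)
    (hθ : IsDualEigenvalueSeq G D (F 1) θs)
    {P : ℕ → ℕ → ℝ} (hP : ∀ h, distMatrix G h = ∑ j ∈ Finset.range (D + 1), P h j • F j)
    {h : ℕ} (hh : h ≤ D) : P h 1 * θs 0 = kNum p h * θs h := by
  obtain ⟨x⟩ := hG.connected.nonempty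
  have hN := hG.card_pos
  have e := congrFun (congrFun (hF.distMatrix_mul hP h 1) x) x
  rw [distMatrix_mul_apply, Matrix.smul_apply, hθ.apply hG, G.dist_self,
    Finset.sum_congr rfl (g := fun _ => (Fintype.card X : ℝ)⁻¹ * θs h), Finset.sum_const,
    hG.card_sphere hh] at e
  · simp only [nsmul_eq_mul, smul_eq_mul] at e
    field_simp at e
    linarith
  · intro w hw
    rw [mem_sphere] at hw
    rw [hθ.apply hG, dist_symm, hw]

/-- `∑_{w ∈ Γ_h(x)} θ*_{∂(w,y)}`. -/
lemma sum_sphere_dual (hF : IsExtendedQOrdering G D F) (hG : IsDistanceRegularWith G D p)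
    (hθ : IsDualEigenvalueSeq G D (F 1) θs)
    {P : ℕ → ℕ → ℝ} (hP : ∀ h, distMatrix G h = ∑ j ∈ Finset.range (D + 1), P h j • F j)
    (h : ℕ) (x y : X) :
    ∑ w ∈ sphere G h x, θs (G.dist w y) = P h 1 * θs (G.dist x y) := by
  have hN := hG.card_pos
  have e := congrFun (congrFun (hF.distMatrix_mul hP h 1) x) y
  rw [distMatrix_mul_apply, Matrix.smul_apply, hθ.apply hG] at e
  simp only [hθ.apply hG, ← Finset.mul_sum, smul_eq_mul] at e
  field_simp at e
  linarith

/-- `θ*_0 + θ*_i ≠ 0` for `1 ≤ i ≤ D - 1`. -/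
lemma dual_add_ne_zero (hF : IsExtendedQOrdering G D F) (hG : IsDistanceRegularWith G D p)
    (hθ : IsDualEigenvalueSeq G D (F 1) θs) {i : ℕ} (h1 : 1 ≤ i) (hi : i < D) :
    θs 0 + θs i ≠ 0 := by
  intro h0
  have hN := hG.card_pos
  obtain ⟨x, y, hxy⟩ := hG.exists_dist_eq hi.le
  -- If θ*_0 + θ*_i = 0, then ‖Ex̂ + Eŷ‖² = 0. Evaluating Ex̂ = -Eŷ at two neighbours of y, at
  -- distances i-1 and i+1 from x, gives θ*_{i-1} = -θ*_1 = θ*_{i+1}, against distinctness.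
  have hsq : ∑ w, (F 1 x w + F 1 y w) ^ 2 = 0 := by
    have e : ∀ u v, ∑ w, F 1 u w * F 1 v w = F 1 u v := fun u v => by
      conv_rhs => rw [← hF.mul_self 1, Matrix.mul_apply]
      exact Finset.sum_congr rfl fun w _ => by rw [hF.symm_apply 1 w v]
    have : ∀ w, (F 1 x w + F 1 y w) ^ 2 =
      F 1 x w * F 1 x w + F 1 y w * F 1 y w + 2 * (F 1 x w * F 1 y w) := fun w => by ring
    simp only [this, Finset.sum_add_distrib, ← Finset.mul_sum, e]
    simp only [hθ.apply hG, G.dist_self, hxy]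
    linear_combination (2 * (Fintype.card X : ℝ)⁻¹) * h0
  rw [Finset.sum_eq_zero_iff_of_nonneg fun w _ => sq_nonneg _] at hsq
  have hneg : ∀ w, θs (G.dist x w) = -θs (G.dist y w) := fun w => by
    have h2 := pow_eq_zero_iff (two_ne_zero) |>.1 (hsq w (Finset.mem_univ w))
    rw [hθ.apply hG, hθ.apply hG, ← mul_add] at h2
    rcases mul_eq_zero.1 h2 with h3 | h3
    · exact absurd h3 (inv_ne_zero hN.ne')
    · linarith
  rw [dist_symm] at hxy
  obtain ⟨z, hz1, hz2⟩ := hG.exists_closer h1 hxy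
  obtain ⟨z', hz1', hz2'⟩ := hG.exists_farther hi hxy
  have e1 := hneg z
  have e2 := hneg z'
  rw [hz1, hz2] at e1
  rw [hz1', hz2'] at e2
  exact hF.dual_injOn hG (by omega) hθ (i := i - 1) (j := i + 1) (by omega) (by omega) (by omega)
    (e1.trans e2.symm)

lemma dual_sq_sub_ne_zero (hF : IsExtendedQOrdering G D F) (hG : IsDistanceRegularWith G D p)
    (hθ : IsDualEigenvalueSeq G D (F 1) θs) {i : ℕ} (h1 : 1 ≤ i) (hi : i < D) :
    θs 0 ^ 2 - θs i ^ 2 ≠ 0 := by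
  have e1 := hF.dual_add_ne_zero hG hθ h1 hi
  have e2 := hF.dual_injOn hG (by omega) hθ (i := 0) (j := i) (by omega) (by omega) (by omega)
  rw [sq_sub_sq]
  exact mul_ne_zero e1 (sub_ne_zero.2 e2)

end IsExtendedQOrdering

/-- The sums in the Norton-balanced condition are T(A_i,A_j). -/
lemma tripleVec_distMatrix (E : Matrix X X ℝ) (i j : ℕ) (y z : X) :
    tripleVec E (distMatrix G i) (distMatrix G j) y z =
      ∑ w ∈ sphereInter G i j y z, E *ᵥ hat w := by
  ext x
  simp only [tripleVec, distMatrix_apply, Finset.sum_apply, mulVec_hat_apply, sphereInter,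
    Finset.sum_filter]
  refine Finset.sum_congr rfl fun w _ => ?_
  rw [dist_symm G w z]
  by_cases h1 : G.dist y w = i <;> by_cases h2 : G.dist z w = j <;> simp [h1, h2]

lemma sum_sphereInter_const {i j : ℕ} {y z : X} {f : X → ℝ} {c : ℝ}
    (h : ∀ w, G.dist y w = i → G.dist z w = j → f w = c) :
    ∑ w ∈ sphereInter G i j y z, f w = (sphereInter G i j y z).card * c := by
  rw [Finset.sum_congr rfl (g := fun _ => c), Finset.sum_const, nsmul_eq_mul]
  intro w hw
  rw [mem_sphereInter] at hw
  exact h w hw.1 hw.2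

/-- The three-term recurrence of the dual eigenvalues. -/
lemma IsExtendedQOrdering.dual_recurrence (hF : IsExtendedQOrdering G D F)
    (hG : IsDistanceRegularWith G D p) (hθ : IsDualEigenvalueSeq G D (F 1) θs)
    {i : ℕ} (hi : i + 3 ≤ D) :
    (θs i - θs (i + 3)) * (θs 1 - θs 2) = (θs 0 - θs 3) * (θs (i + 1) - θs (i + 2)) := by
  have hN := hG.card_pos
  obtain ⟨Y, hY⟩ := hF.balanced_set hG (by omega) (fun j => if j = 1 then 1 else 0)
    (fun j => if j = 2 then 1 else 0)
  simp only [← distMatrix_eq_distFun, tripleVec_distMatrix] at hY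
  -- Evaluate the balanced set condition for A_1, A_2 and a pair y, z at distance 3 at a vertex x
  -- with y on a geodesic from x to z. All distances are then forced, and the scalar Y 3 does not
  -- depend on i; comparison with i = 0 eliminates it.
  have key : ∀ {i : ℕ}, i + 3 ≤ D →
      (p 3 1 2 : ℝ) * (θs (i + 1) - θs (i + 2)) = Y 3 * (θs (i + 3) - θs i) := by
    intro i hi
    obtain ⟨x, z, hxz⟩ := hG.exists_dist_eq hi
    obtain ⟨y, hxy, hyz⟩ := hG.exists_between x z (j := i) (by omega)
    have hyz' : G.dist y z = 3 := by omega
    have e := congrFun (hY y z) x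
    simp only [Pi.sub_apply, Finset.sum_apply, mulVec_hat_apply, Pi.smul_apply, hθ.apply hG,
      smul_eq_mul, ← Finset.mul_sum, hyz', hxz, hxy] at e
    rw [sum_sphereInter_const (c := θs (i + 1)), sum_sphereInter_const (c := θs (i + 2)),
      hG.card_eq 3 1 2 (by omega) (by omega) (by omega) y z hyz'] at e
    · have hc : (sphereInter G 2 1 y z).card = p 3 1 2 := by
        rw [← hG.card_eq 3 1 2 (by omega) (by omega) (by omega) z y (by rw [dist_symm, hyz'])]
        congr 1
        ext w
        simp only [mem_sphereInter, and_comm]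
      rw [hc] at e
      field_simp at e
      linarith
    · intro w h1 h2
      have := hG.triangle x y w
      have := hG.triangle x w z
      have := dist_symm G w z
      congr 1
      omega
    · intro w h1 h2
      have := hG.triangle x y w
      have := hG.triangle x w z
      have := dist_symm G w z
      congr 1
      omega
  have hp : (p 3 1 2 : ℝ) ≠ 0 := by
    have := hG.cNum_pos (i := 3) (by omega) (by omega)
    exact_mod_cast this.ne'
  have e1 := key hi
  have e2 := key (i := 0) (by omega)
  simp only [zero_add] at e2
  apply mul_left_cancel₀ hp
  linear_combination (θs i - θs (i + 3)) * e2 - (θs 0 - θs 3) * e1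

end Scalars

/-! ### Spanning by Ex̂, Eŷ, Ex_y^- and Ex_y^+. -/

section Span

variable {X : Type*} [Fintype X] [DecidableEq X] {G : SimpleGraph X} {D : ℕ}
  {p : ℕ → ℕ → ℕ → ℕ} {F : ℕ → Matrix X X ℝ} {θs : ℕ → ℝ}

lemma mulVec_minusVec_apply (E : Matrix X X ℝ) (x y v : X) : (E *ᵥ minusVec G x y) v =
    ∑ w, if G.dist x w = 1 ∧ G.dist y w + 1 = G.dist x y then E v w else 0 := by
  rw [minusVec, Matrix.mulVec_sum, Finset.sum_apply, Finset.sum_filter]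
  simp only [mulVec_hat_apply]

lemma mulVec_plusVec_apply (E : Matrix X X ℝ) (x y v : X) : (E *ᵥ plusVec G x y) v =
    ∑ w, if G.dist x w = 1 ∧ G.dist y w = G.dist x y + 1 then E v w else 0 := by
  rw [plusVec, Matrix.mulVec_sum, Finset.sum_apply, Finset.sum_filter]
  simp only [mulVec_hat_apply]

/-- The index m + 2 may equal D + 1, outside the range of summation; `h3` makes that term zero. -/
lemma sum_range_of_tridiagonal {V : Type*} [AddCommGroup V] {f : ℕ → V} {m : ℕ} (hm : m + 1 ≤ D)
    (h1 : ∀ h, h < m → f h = 0) (h2 : ∀ h, m + 2 < h → f h = 0) (h3 : ∀ h, D < h → f h = 0) :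
    ∑ h ∈ Finset.range (D + 1), f h = f m + f (m + 1) + f (m + 2) := by
  have e : ∑ h ∈ Finset.range (D + 1), f h = ∑ h ∈ Finset.range (D + 2), f h := by
    rw [Finset.sum_range_succ f (D + 1), h3 (D + 1) (by omega), add_zero]
  rw [e, ← Finset.sum_subset (s₁ := {m, m + 1, m + 2})]
  · rw [Finset.sum_insert (by simp), Finset.sum_insert (by simp), Finset.sum_singleton, add_assoc]
  · intro a ha
    simp only [Finset.mem_insert, Finset.mem_singleton] at ha
    rw [Finset.mem_range]
    omega
  · intro a _ ha
    simp only [Finset.mem_insert, Finset.mem_singleton, not_or] at ha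
    rcases Nat.lt_or_ge a m with h | h
    · exact h1 a h
    · exact h2 a (by omega)

namespace IsExtendedQOrdering

/-- The triple product relations leave three terms in each row. Weights c = 1 turn the left side
into a multiple of Eẑ, and weights c = P h into T(E_{m+1}, A_h). -/
lemma tripleVec_sum_tridiagonal (hF : IsExtendedQOrdering G D F) {m : ℕ} (hm : m + 1 ≤ D)
    (c : ℕ → ℝ) (y z : X) :
    tripleVec (F 1) (F (m + 1)) (∑ h ∈ Finset.range (D + 1), c h • F h) y z =
      c m • tripleVec (F 1) (F (m + 1)) (F m) y z +
      c (m + 1) • tripleVec (F 1) (F (m + 1)) (F (m + 1)) y z +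
      c (m + 2) • tripleVec (F 1) (F (m + 1)) (F (m + 2)) y z := by
  rw [tripleVec_sum_right]
  refine sum_range_of_tridiagonal hm (fun h hh => ?_) (fun h hh => ?_) (fun h hh => ?_)
  · rw [hF.tripleVec_eq_zero (by omega) (by omega), smul_zero]
  · rw [hF.tripleVec_eq_zero (by omega) (by omega), smul_zero]
  · rw [hF.eq_zero h hh, tripleVec_zero_right, smul_zero]

lemma tripleVec_symm_mem (hF : IsExtendedQOrdering G D F) (hG : IsDistanceRegularWith G D p)
    (hD : 1 ≤ D) {S : Submodule ℝ (X → ℝ)} {y z : X} (hy : F 1 *ᵥ hat y ∈ S)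
    (hz : F 1 *ᵥ hat z ∈ S) {f g : ℕ → ℝ}
    (h : tripleVec (F 1) (distFun G f) (distFun G g) y z ∈ S) :
    tripleVec (F 1) (distFun G g) (distFun G f) y z ∈ S := by
  obtain ⟨Y, hY⟩ := hF.balanced_set hG hD f g
  rw [← sub_sub_cancel (tripleVec (F 1) (distFun G f) (distFun G g) y z)
    (tripleVec (F 1) (distFun G g) (distFun G f) y z), hY]
  exact S.sub_mem h (S.smul_mem _ (S.sub_mem hz hy))

lemma tripleVec_zero_mem (hF : IsExtendedQOrdering G D F) {S : Submodule ℝ (X → ℝ)} {y z : X}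
    (hz : F 1 *ᵥ hat z ∈ S) (j : ℕ) : tripleVec (F 1) (F 0) (F j) y z ∈ S := by
  have : tripleVec (F 1) (F 0) (F j) y z =
      ((Fintype.card X : ℝ)⁻¹ * if 1 = j then 1 else 0) • (F 1 *ᵥ hat z) := by
    ext x
    rw [hF.ordering.1.zero_eq, tripleVec_const_left, hF.mul_eq, Pi.smul_apply, mulVec_hat_apply]
    split_ifs <;> simp
  rw [this]
  exact S.smul_mem _ hz

/-- All vectors `∑_w M(y,w) N(w,z) E ŵ` with `M, N` in the Bose-Mesner algebra lie in a subspace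
as soon as `E ŷ`, `E ẑ` and those with `N = A` do. -/
theorem tripleVec_mem (hF : IsExtendedQOrdering G D F) (hG : IsDistanceRegularWith G D p)
    (hD : 1 ≤ D) {S : Submodule ℝ (X → ℝ)} {y z : X} (hy : F 1 *ᵥ hat y ∈ S)
    (hz : F 1 *ᵥ hat z ∈ S)
    (hA : ∀ f, tripleVec (F 1) (distFun G f) (distMatrix G 1) y z ∈ S) (f g : ℕ → ℝ) :
    tripleVec (F 1) (distFun G f) (distFun G g) y z ∈ S := by
  obtain ⟨P, hP⟩ := hF.exists_eigenvalues hG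
  have symm : ∀ i j, tripleVec (F 1) (F i) (F j) y z ∈ S →
      tripleVec (F 1) (F j) (F i) y z ∈ S := fun i j h => by
    obtain ⟨f, hf⟩ := hF.exists_distFun i
    obtain ⟨g, hg⟩ := hF.exists_distFun j
    have := hF.tripleVec_symm_mem hG hD hy hz (f := f) (g := g) (by rwa [← hf, ← hg])
    rwa [← hf, ← hg] at this
  -- In row m+1 the term T(E_{m+1},E_m) is known by symmetry. Weights 1 and P 1 give two equations
  -- for the two remaining terms, with determinant P 1 (m+2) - P 1 (m+1) ≠ 0 (or the last term is
  -- zero).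
  have key : ∀ m, tripleVec (F 1) (F m) (F m) y z ∈ S ∧
      tripleVec (F 1) (F m) (F (m + 1)) y z ∈ S := by
    intro m
    induction m with
    | zero => exact ⟨hF.tripleVec_zero_mem hz _, hF.tripleVec_zero_mem hz _⟩
    | succ m ih =>
      rcases Nat.lt_or_ge D (m + 1) with hm | hm
      · rw [hF.eq_zero _ hm, tripleVec_zero_left, tripleVec_zero_left]
        exact ⟨S.zero_mem, S.zero_mem⟩
      have e0 := symm _ _ ih.2
      have e1 := hF.tripleVec_sum_tridiagonal hm (fun _ => 1) y z
      have e2 := hF.tripleVec_sum_tridiagonal hm (P 1) y z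
      simp only [one_smul, hF.sum_eq_one, tripleVec_one_right] at e1
      rw [← hP] at e2
      have m1 : tripleVec (F 1) (F (m + 1)) (F (m + 1)) y z +
          tripleVec (F 1) (F (m + 1)) (F (m + 2)) y z ∈ S := by
        have := S.sub_mem (S.smul_mem (F (m + 1) y z) hz) e0
        rwa [e1, add_assoc, add_sub_cancel_left] at this
      have m2 : P 1 (m + 1) • tripleVec (F 1) (F (m + 1)) (F (m + 1)) y z +
          P 1 (m + 2) • tripleVec (F 1) (F (m + 1)) (F (m + 2)) y z ∈ S := by
        obtain ⟨f, hf⟩ := hF.exists_distFun (m + 1)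
        have h := hA f
        rw [← hf] at h
        have := S.sub_mem h (S.smul_mem (P 1 m) e0)
        rwa [e2, add_assoc, add_sub_cancel_left] at this
      have m3 : tripleVec (F 1) (F (m + 1)) (F (m + 2)) y z ∈ S := by
        rcases Nat.lt_or_ge D (m + 2) with hm' | hm'
        · rw [hF.eq_zero _ hm', tripleVec_zero_right]
          exact S.zero_mem
        · have hne := hF.eigenvalue_injOn hG hP hm hm' (by omega)
          have := S.sub_mem m2 (S.smul_mem (P 1 (m + 1)) m1)
          rw [smul_add, add_sub_add_left_eq_sub, ← sub_smul] at this
          exact (S.smul_mem_iff (sub_ne_zero.2 hne.symm)).1 this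
      exact ⟨by simpa using S.sub_mem m1 m3, m3⟩
  have all : ∀ i j, tripleVec (F 1) (F i) (F j) y z ∈ S := by
    intro i j
    by_cases hij : i + 1 < j ∨ j + 1 < i
    · rw [hF.tripleVec_eq_zero hD hij]
      exact S.zero_mem
    · have : j = i ∨ j = i + 1 ∨ i = j + 1 := by omega
      rcases this with rfl | rfl | rfl
      · exact (key _).1
      · exact (key _).2
      · exact symm _ _ (key _).2
  obtain ⟨m, hm⟩ := hF.exists_coeff hG f
  obtain ⟨n, hn⟩ := hF.exists_coeff hG g
  rw [hm, hn, tripleVec_sum_left]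
  refine S.sum_mem fun i _ => S.smul_mem _ ?_
  rw [tripleVec_sum_right]
  exact S.sum_mem fun j _ => S.smul_mem _ (all i j)

/-- `E A*(y) A_h ẑ` is a multiple of the Norton product modulo `E ŷ` and `E ẑ`. -/
lemma tripleVec_sub_norton_mem (hF : IsExtendedQOrdering G D F) (hD : 1 ≤ D) {P : ℕ → ℕ → ℝ}
    (hP : ∀ h, distMatrix G h = ∑ j ∈ Finset.range (D + 1), P h j • F j) (h : ℕ) (y z : X) :
    tripleVec (F 1) (F 1) (distMatrix G h) y z -
      (P h 1 - P h 2) • tripleVec (F 1) (F 1) (F 1) y z ∈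
      Submodule.span ℝ {F 1 *ᵥ hat y, F 1 *ᵥ hat z} := by
  -- Rows of E_1 with weights 1 and P h; eliminating T(E_1,E_2) between them leaves T(E_1,E_1) with
  -- coefficient P h 1 - P h 2, and T(E_1,E_0) is a multiple of Eŷ.
  have e1 := hF.tripleVec_sum_tridiagonal (m := 0) hD (fun _ => 1) y z
  have e2 := hF.tripleVec_sum_tridiagonal (m := 0) hD (P h) y z
  simp only [one_smul, hF.sum_eq_one, tripleVec_one_right, zero_add] at e1
  rw [← hP] at e2
  simp only [zero_add] at e2
  have e3 : tripleVec (F 1) (F 1) (F 0) y z = (Fintype.card X : ℝ)⁻¹ • (F 1 *ᵥ hat y) := by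
    ext x
    rw [hF.ordering.1.zero_eq, tripleVec_const_right, hF.transpose_eq, hF.mul_self, Pi.smul_apply,
      mulVec_hat_apply, smul_eq_mul]
  rw [e3] at e1 e2
  rw [Submodule.mem_span_pair]
  refine ⟨(P h 0 - P h 2) * (Fintype.card X : ℝ)⁻¹, P h 2 * F 1 y z, ?_⟩
  rw [mul_smul (P h 2), e1, e2]
  module

/-- `∑_w f(∂(y,w)) E ŵ` over the neighbours `w` of `x`. -/
lemma tripleVec_neighbors (hF : IsExtendedQOrdering G D F) (hG : IsDistanceRegularWith G D p)
    {P : ℕ → ℕ → ℝ}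
    (hP : ∀ h, distMatrix G h = ∑ j ∈ Finset.range (D + 1), P h j • F j) (f : ℕ → ℝ) {i : ℕ}
    (hi : 1 ≤ i) {x y : X} (hxy : G.dist x y = i) :
    tripleVec (F 1) (distFun G f) (distMatrix G 1) y x =
      (f (i - 1) - f i) • (F 1 *ᵥ minusVec G x y) - (f i - f (i + 1)) • (F 1 *ᵥ plusVec G x y) +
        (f i * P 1 1) • (F 1 *ᵥ hat x) := by
  ext v
  -- The neighbours at distance i from y are eliminated through EA = P 1 1 • E: the full neighbour
  -- sum, weighted by f i, is a multiple of Ex̂, and only the spheres i ± 1 need corrections.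
  have e := congrFun (congrFun (hF.mul_distMatrix hP 1 1) v) x
  rw [Matrix.mul_apply, Matrix.smul_apply, smul_eq_mul] at e
  simp only [Pi.add_apply, Pi.sub_apply, Pi.smul_apply, mulVec_minusVec_apply,
    mulVec_plusVec_apply, mulVec_hat_apply, smul_eq_mul, tripleVec]
  rw [mul_assoc, ← e, Finset.mul_sum, Finset.mul_sum, Finset.mul_sum, ← Finset.sum_sub_distrib,
    ← Finset.sum_add_distrib]
  refine Finset.sum_congr rfl fun w _ => ?_
  simp only [distFun_apply, distMatrix_apply, hxy]
  rw [dist_symm G w x]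
  by_cases hw : G.dist x w = 1
  · have t1 := hG.triangle y x w
    have t2 := hG.triangle y w x
    have s1 := dist_symm G w x
    have s2 := dist_symm G x y
    have : G.dist y w = i - 1 ∨ G.dist y w = i ∨ G.dist y w = i + 1 := by omega
    rcases this with h | h | h
    · have h' : i - 1 + 1 = i := by omega
      have h'' : i - 1 ≠ i + 1 := by omega
      simp only [h, hw, h', h'', true_and, if_true, if_false]
      ring
    · simp [h, hw]
      ring
    · have h' : i + 1 + 1 ≠ i := by omega
      simp only [h, hw, h', true_and, if_true, if_false]
      ring
  · simp [-SimpleGraph.dist_eq_one_iff_adj, hw]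

/-- `E x̂ ⋆ E ŷ` in terms of `E x_y^-` and `E x_y^+`. -/
lemma norton_mem (hF : IsExtendedQOrdering G D F) (hG : IsDistanceRegularWith G D p)
    (hD : 1 ≤ D) (hθ : IsDualEigenvalueSeq G D (F 1) θs) {P : ℕ → ℕ → ℝ}
    (hP : ∀ h, distMatrix G h = ∑ j ∈ Finset.range (D + 1), P h j • F j) {i : ℕ}
    (hi : 1 ≤ i) {x y : X} (hxy : G.dist x y = i) :
    (Fintype.card X * (P 1 1 - P 1 2)) • nortonProd (F 1) (F 1 *ᵥ hat x) (F 1 *ᵥ hat y) -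
      ((θs (i - 1) - θs i) • (F 1 *ᵥ minusVec G x y) -
        (θs i - θs (i + 1)) • (F 1 *ᵥ plusVec G x y)) ∈
      Submodule.span ℝ {F 1 *ᵥ hat x, F 1 *ᵥ hat y} := by
  have hN := hG.card_pos
  have e1 := hF.tripleVec_sub_norton_mem hD hP 1 y x
  have hE : F 1 = distFun G fun j => (Fintype.card X : ℝ)⁻¹ * θs j := by
    ext u v
    rw [hθ.apply hG, distFun_apply]
  have e2 := hF.tripleVec_neighbors hG hP (fun j => (Fintype.card X : ℝ)⁻¹ * θs j) hi hxy
  rw [← hE] at e2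
  rw [e2, ← nortonProd_eq_tripleVec (hF.transpose_eq 1),
    show nortonProd (F 1) (F 1 *ᵥ hat y) (F 1 *ᵥ hat x) =
      nortonProd (F 1) (F 1 *ᵥ hat x) (F 1 *ᵥ hat y) by rw [nortonProd, nortonProd, mul_comm],
    Submodule.mem_span_pair] at e1
  obtain ⟨a, b, hab⟩ := e1
  rw [Submodule.mem_span_pair]
  refine ⟨θs i * P 1 1 - Fintype.card X * b, -(Fintype.card X * a), ?_⟩
  have h2 := congrArg (fun V => (Fintype.card X : ℝ) • V) hab
  simp only [smul_add, smul_sub, smul_smul, ← mul_sub] at h2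
  simp only [mul_inv_cancel_left₀ hN.ne', mul_assoc] at h2
  rw [sub_smul, neg_smul, sub_add_eq_add_sub, ← sub_eq_add_neg, sub_sub,
    add_comm ((Fintype.card X * a : ℝ) • _), ← sub_eq_zero]
  rw [← sub_eq_zero] at h2
  rw [← neg_eq_zero, ← h2]
  module

/-- Every vector in the Norton-balanced condition lies in the span of `E x̂`, `E ŷ`, `E x_y^±`. -/
lemma sum_sphereInter_mem (hF : IsExtendedQOrdering G D F) (hG : IsDistanceRegularWith G D p)
    (hD : 1 ≤ D) {S : Submodule ℝ (X → ℝ)} {x y : X} (hxy : 1 ≤ G.dist x y)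
    (hx : F 1 *ᵥ hat x ∈ S) (hy : F 1 *ᵥ hat y ∈ S) (hm : F 1 *ᵥ minusVec G x y ∈ S)
    (hp : F 1 *ᵥ plusVec G x y ∈ S) (i j : ℕ) :
    ∑ z ∈ sphereInter G i j x y, F 1 *ᵥ hat z ∈ S := by
  obtain ⟨P, hP⟩ := hF.exists_eigenvalues hG
  have h := hF.tripleVec_mem hG hD hy hx (fun f => by
    rw [hF.tripleVec_neighbors hG hP f hxy rfl]
    exact S.add_mem (S.sub_mem (S.smul_mem _ hm) (S.smul_mem _ hp)) (S.smul_mem _ hx))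
    (fun l => if l = j then 1 else 0) (fun l => if l = i then 1 else 0)
  rw [← distMatrix_eq_distFun, ← distMatrix_eq_distFun, tripleVec_distMatrix] at h
  convert h using 2
  ext w
  simp only [mem_sphereInter, and_comm]

end IsExtendedQOrdering

end Span

/-! ### Counting kites. -/

section Kites

variable {X : Type*} [Fintype X] [DecidableEq X] {G : SimpleGraph X} {D : ℕ}
  {p : ℕ → ℕ → ℕ → ℕ}

/-- The kite function, set to zero off its domain. -/
def kiteWeight (G : SimpleGraph X) (i : ℕ) (x y z : X) : ℝ :=
  if G.dist x y = i ∧ G.dist x z = 1 ∧ G.dist y z = i - 1 then (kiteFun G i x y z : ℝ) else 0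

lemma sum_kiteWeight_third {i : ℕ} {x y : X} (h : G.dist x y = i) :
    ∑ z, kiteWeight G i x y z = ∑ z ∈ sphereInter G 1 (i - 1) x y, (kiteFun G i x y z : ℝ) := by
  rw [sphereInter, Finset.sum_filter]
  exact Finset.sum_congr rfl fun z _ => by simp only [kiteWeight, h, true_and]

lemma sum_kiteWeight_first {i : ℕ} {y z : X} (h : G.dist y z = i - 1) :
    ∑ x, kiteWeight G i x y z = ∑ x ∈ sphereInter G i 1 y z, (kiteFun G i x y z : ℝ) := by
  rw [sphereInter, Finset.sum_filter]
  exact Finset.sum_congr rfl fun x _ => by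
    simp only [kiteWeight, h, and_true, dist_symm G y x, dist_symm G z x]

lemma sum_kiteWeight_second {i : ℕ} {x z : X} (h : G.dist x z = 1) :
    ∑ y, kiteWeight G i x y z =
      ∑ y ∈ sphereInter G i (i - 1) x z, (kiteFun G i x y z : ℝ) := by
  rw [sphereInter, Finset.sum_filter]
  exact Finset.sum_congr rfl fun y _ => by
    simp only [kiteWeight, h, true_and, dist_symm G z y]

lemma kiteWeight_eq_zero_of_first {i : ℕ} {x y : X} (h : G.dist x y ≠ i) (z : X) :
    kiteWeight G i x y z = 0 := if_neg fun h' => h h'.1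

lemma kiteWeight_eq_zero_of_second {i : ℕ} {x z : X} (h : G.dist x z ≠ 1) (y : X) :
    kiteWeight G i x y z = 0 := if_neg fun h' => h h'.2.1

lemma kiteWeight_eq_zero_of_third {i : ℕ} {y z : X} (h : G.dist y z ≠ i - 1) (x : X) :
    kiteWeight G i x y z = 0 := if_neg fun h' => h h'.2.2

lemma card_kites (i : ℕ) :
    (Set.ncard {t : X × X × X × X | IsKite G i t.1 t.2.1 t.2.2.1 t.2.2.2} : ℝ) =
      ∑ x, ∑ y, ∑ z, kiteWeight G i x y z := by
  classical
  rw [Set.ncard_eq_toFinset_card', Set.toFinset_ofPred, Finset.card_filter]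
  push_cast
  simp only [Fintype.sum_prod_type]
  refine Finset.sum_congr rfl fun x _ => Finset.sum_congr rfl fun y _ =>
    Finset.sum_congr rfl fun z _ => ?_
  rw [kiteWeight, kiteFun, Finset.card_filter]
  push_cast
  split_ifs with h
  · exact Finset.sum_congr rfl fun w _ => by
      simp only [IsKite, h, true_and]
  · refine Finset.sum_eq_zero fun w _ => if_neg ?_
    rintro ⟨h1, h2, h3, -⟩
    exact h ⟨h1, h2, h3⟩

lemma kiteNumber_mul (hG : IsDistanceRegularWith G D p) {i : ℕ} (h1 : 1 ≤ i) (hi : i ≤ D) :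
    kiteNumber G p i * (Fintype.card X * kNum p i * cNum p i) =
      ∑ x, ∑ y, ∑ z, kiteWeight G i x y z := by
  have hN := hG.card_pos
  have hk : (kNum p i : ℝ) ≠ 0 := by exact_mod_cast (hG.kNum_pos hi).ne'
  have hc : (cNum p i : ℝ) ≠ 0 := by exact_mod_cast (hG.cNum_pos h1 hi).ne'
  rw [← card_kites, kiteNumber, div_mul_cancel₀]
  exact mul_ne_zero (mul_ne_zero hN.ne' hk) hc

lemma sum_sum_of_dist (hG : IsDistanceRegularWith G D p) {i : ℕ} (hi : i ≤ D) {f : X → X → ℝ}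
    {c : ℝ} (h1 : ∀ x y, G.dist x y = i → f x y = c) (h0 : ∀ x y, G.dist x y ≠ i → f x y = 0) :
    ∑ x, ∑ y, f x y = Fintype.card X * kNum p i * c := by
  have : ∀ x, ∑ y, f x y = kNum p i * c := fun x => by
    rw [← hG.card_sphere hi x, ← Finset.sum_subset (Finset.subset_univ (sphere G i x)),
      Finset.sum_congr rfl (g := fun _ => c), Finset.sum_const, nsmul_eq_mul]
    · intro y hy
      exact h1 x y (by simpa using hy)
    · intro y _ hy
      exact h0 x y (by simpa using hy)
  simp only [this, Finset.sum_const, nsmul_eq_mul, Finset.card_univ]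
  ring

/-- Reinforcement makes the left average constant on pairs at distance i; averaging over all those
pairs identifies the constant as z_i. -/
lemma IsReinforced.sum_closer (hR : IsReinforced G D p) (hG : IsDistanceRegularWith G D p)
    {i : ℕ} (h2 : 2 ≤ i) (hi : i ≤ D) {x y : X} (hxy : G.dist x y = i) :
    ∑ z ∈ sphereInter G 1 (i - 1) x y, (kiteFun G i x y z : ℝ) =
      cNum p i * kiteNumber G p i := by
  have hN := hG.card_pos
  have hk : (kNum p i : ℝ) ≠ 0 := by exact_mod_cast (hG.kNum_pos hi).ne'
  have hc : (cNum p i : ℝ) ≠ 0 := by exact_mod_cast (hG.cNum_pos (by omega) hi).ne'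
  have e := kiteNumber_mul hG (by omega : 1 ≤ i) hi
  rw [sum_sum_of_dist hG hi
    (c := ∑ z ∈ sphereInter G 1 (i - 1) x y, (kiteFun G i x y z : ℝ))] at e
  · have : (Fintype.card X * kNum p i : ℝ) ≠ 0 := mul_ne_zero hN.ne' hk
    apply mul_left_cancel₀ this
    linear_combination -e
  · intro x' y' h'
    rw [sum_kiteWeight_third h']
    have := (hR i h2 hi).1 x' y' x y h' hxy
    rw [kiteAvgLeft, kiteAvgLeft] at this
    exact mul_left_cancel₀ (inv_ne_zero hc) this
  · intro x' y' h'
    exact Finset.sum_eq_zero fun z _ => kiteWeight_eq_zero_of_first h' z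

/-- The same argument with the right average of index i + 1; k_i b_i = k_{i+1} c_{i+1} matches the
two normalisations. -/
lemma IsReinforced.sum_farther (hR : IsReinforced G D p) (hG : IsDistanceRegularWith G D p)
    {i : ℕ} (h1 : 1 ≤ i) (hi : i < D) {y z : X} (hyz : G.dist y z = i) :
    ∑ x ∈ sphereInter G (i + 1) 1 y z, (kiteFun G (i + 1) x y z : ℝ) =
      bNum p i * kiteNumber G p (i + 1) := by
  have hN := hG.card_pos
  have hk : (kNum p i : ℝ) ≠ 0 := by exact_mod_cast (hG.kNum_pos hi.le).ne'
  have hb : (bNum p i : ℝ) ≠ 0 := by exact_mod_cast (hG.bNum_pos hi).ne'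
  have e := kiteNumber_mul hG (by omega : 1 ≤ i + 1) hi
  have hkb : (kNum p i : ℝ) * bNum p i = kNum p (i + 1) * cNum p (i + 1) := by
    exact_mod_cast hG.kNum_mul_bNum hi
  have comm : ∑ x, ∑ y, ∑ z, kiteWeight G (i + 1) x y z =
      ∑ y, ∑ z, ∑ x, kiteWeight G (i + 1) x y z := by
    rw [Finset.sum_comm]
    exact Finset.sum_congr rfl fun y _ => Finset.sum_comm
  rw [comm, sum_sum_of_dist hG hi.le
    (c := ∑ x ∈ sphereInter G (i + 1) 1 y z, (kiteFun G (i + 1) x y z : ℝ))] at e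
  · have : (Fintype.card X * kNum p i : ℝ) ≠ 0 := mul_ne_zero hN.ne' hk
    apply mul_left_cancel₀ this
    linear_combination -e - Fintype.card X * kiteNumber G p (i + 1) * hkb
  · intro y' z' h'
    rw [sum_kiteWeight_first (i := i + 1) h']
    have := (hR (i + 1) (by omega) hi).2 y' z' y z h' hyz
    rw [kiteAvgRight, kiteAvgRight] at this
    exact mul_left_cancel₀ (inv_ne_zero hb) this
  · intro y' z' h'
    exact Finset.sum_eq_zero fun x _ => kiteWeight_eq_zero_of_third (i := i + 1) h' x

/-- Kites counted by their edge xz. Only the total over all edges is needed, so this holds without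
reinforcement. -/
lemma sum_edges_kites (hG : IsDistanceRegularWith G D p) {i : ℕ} (h1 : 1 ≤ i) (hi : i ≤ D) :
    ∑ x, ∑ z ∈ sphere G 1 x, ∑ y ∈ sphereInter G i (i - 1) x z, (kiteFun G i x y z : ℝ) =
      Fintype.card X * kNum p 1 * (p 1 i (i - 1) * kiteNumber G p i) := by
  have e := kiteNumber_mul hG h1 hi
  have hv : (kNum p 1 : ℝ) * p 1 i (i - 1) = kNum p i * cNum p i := by
    exact_mod_cast hG.valency_mul_edge h1 hi
  have : ∑ x, ∑ y, ∑ z, kiteWeight G i x y z =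
      ∑ x, ∑ z ∈ sphere G 1 x, ∑ y ∈ sphereInter G i (i - 1) x z, (kiteFun G i x y z : ℝ) := by
    refine Finset.sum_congr rfl fun x _ => ?_
    rw [Finset.sum_comm, ← Finset.sum_subset (Finset.subset_univ (sphere G 1 x))]
    · exact Finset.sum_congr rfl fun z hz => sum_kiteWeight_second (mem_sphere.1 hz)
    · intro z _ hz
      exact Finset.sum_eq_zero fun y _ =>
        kiteWeight_eq_zero_of_second (fun h => hz (mem_sphere.2 h)) y
  rw [← this, ← e]
  linear_combination -Fintype.card X * kiteNumber G p i * hv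

end Kites

/-! ### Vectors attached to an edge and their proportionality. -/

section Edge

variable {X : Type*} [Fintype X] [DecidableEq X] {G : SimpleGraph X} {D : ℕ}
  {p : ℕ → ℕ → ℕ → ℕ} {F : ℕ → Matrix X X ℝ} {θs : ℕ → ℝ}

/-- `∑ E ŵ` over the vertices `w` at distance `i` from `x` and `j` from `z`. -/
def interVec (G : SimpleGraph X) (E : Matrix X X ℝ) (i j : ℕ) (x z : X) : X → ℝ :=
  ∑ w ∈ sphereInter G i j x z, E *ᵥ hat w

lemma interVec_apply (E : Matrix X X ℝ) (i j : ℕ) (x z v : X) :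
    interVec G E i j x z v = ∑ w, if G.dist x w = i ∧ G.dist z w = j then E v w else 0 := by
  rw [interVec, Finset.sum_apply, sphereInter, Finset.sum_filter]
  simp only [mulVec_hat_apply]

namespace IsExtendedQOrdering

/-- The balanced set condition for A_i and A_j; it lets Γ_h(x) ∩ Γ_{h+1}(z) be exchanged for
Γ_{h+1}(x) ∩ Γ_h(z) in the telescoping below. -/
lemma interVec_sub_swap_mem (hF : IsExtendedQOrdering G D F) (hG : IsDistanceRegularWith G D p)
    (hD : 1 ≤ D) (i j : ℕ) (x z : X) :
    interVec G (F 1) i j x z - interVec G (F 1) j i x z ∈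
      Submodule.span ℝ {F 1 *ᵥ hat z, F 1 *ᵥ hat x} := by
  obtain ⟨Y, hY⟩ := hF.balanced_set hG hD (fun l => if l = i then 1 else 0)
    (fun l => if l = j then 1 else 0)
  have h := hY x z
  simp only [← distMatrix_eq_distFun, tripleVec_distMatrix] at h
  rw [interVec, interVec, h]
  exact Submodule.smul_mem _ _ (Submodule.sub_mem _ (Submodule.subset_span (by simp))
    (Submodule.subset_span (by simp)))

lemma tripleVec_edge (hF : IsExtendedQOrdering G D F) (hG : IsDistanceRegularWith G D p)
    (hθ : IsDualEigenvalueSeq G D (F 1) θs) {P : ℕ → ℕ → ℝ}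
    (hP : ∀ h, distMatrix G h = ∑ j ∈ Finset.range (D + 1), P h j • F j) {x z : X}
    (hxz : G.dist x z = 1) (h : ℕ) :
    (Fintype.card X : ℝ) • tripleVec (F 1) (F 1) (distMatrix G h) z x =
      (θs (h - 1) - θs h) • interVec G (F 1) h (h - 1) x z -
      (θs h - θs (h + 1)) • interVec G (F 1) h (h + 1) x z +
      (θs h * P h 1) • (F 1 *ᵥ hat x) := by
  have hN := hG.card_pos
  ext v
  have e := congrFun (congrFun (hF.mul_distMatrix hP h 1) v) x
  rw [Matrix.mul_apply, Matrix.smul_apply, smul_eq_mul] at e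
  simp only [Pi.add_apply, Pi.sub_apply, Pi.smul_apply, interVec_apply, mulVec_hat_apply,
    smul_eq_mul, tripleVec]
  rw [mul_assoc, ← e, Finset.mul_sum, Finset.mul_sum, Finset.mul_sum, Finset.mul_sum,
    ← Finset.sum_sub_distrib, ← Finset.sum_add_distrib]
  refine Finset.sum_congr rfl fun w _ => ?_
  rw [hθ.apply hG z w, distMatrix_apply, dist_symm G w x]
  by_cases hw : G.dist x w = h
  · have t1 := hG.triangle z x w
    have t2 := hG.triangle x z w
    have s1 := dist_symm G z x
    have : (1 ≤ h ∧ G.dist z w = h - 1) ∨ G.dist z w = h ∨ G.dist z w = h + 1 := by omega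
    rcases this with ⟨h1, h2⟩ | h2 | h2
    · have h'' : h - 1 ≠ h + 1 := by omega
      simp only [h2, hw, h'', and_self, and_false, if_true, if_false]
      field_simp
      ring
    · have h' : h = h - 1 → θs (h - 1) - θs h = 0 := fun h3 => by rw [← h3, sub_self]
      by_cases h3 : h = h - 1
      · rw [h' h3]
        simp only [h2, hw, if_true, Nat.left_eq_add, one_ne_zero, and_false, if_false]
        field_simp
        ring
      · simp only [h2, hw, h3, if_true, Nat.left_eq_add, one_ne_zero, and_false, if_false]
        field_simp
        ring
    · have h' : h + 1 ≠ h - 1 := by omega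
      simp only [h2, hw, h', and_self, and_false, if_true, if_false]
      field_simp
      ring
  · simp [hw]

/-- Modulo Ex̂ and Eẑ, `tripleVec_edge` writes |X| T(E,A_h) as the difference of consecutive terms
(θ*_{h-1} - θ*_h) I(h,h-1), where I(i,j) is `interVec`, and T(E,A_h) is P h 1 - P h 2 times the
Norton product. Summing over h telescopes; at h = 0 the term is zero because 0 - 1 = 0. -/
lemma edge_telescope (hF : IsExtendedQOrdering G D F) (hG : IsDistanceRegularWith G D p)
    (hD : 1 ≤ D) (hθ : IsDualEigenvalueSeq G D (F 1) θs) {P : ℕ → ℕ → ℝ}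
    (hP : ∀ h, distMatrix G h = ∑ j ∈ Finset.range (D + 1), P h j • F j) {x z : X}
    (hxz : G.dist x z = 1) (h : ℕ) :
    (θs (h - 1) - θs h) • interVec G (F 1) h (h - 1) x z +
      (Fintype.card X * ∑ m ∈ Finset.range h, (P m 1 - P m 2)) •
        tripleVec (F 1) (F 1) (F 1) z x ∈
      Submodule.span ℝ {F 1 *ᵥ hat z, F 1 *ᵥ hat x} := by
  induction h with
  | zero => simp
  | succ h ih =>
    have e1 := hF.tripleVec_edge hG hθ hP hxz h
    have e2 := hF.tripleVec_sub_norton_mem hD hP h z x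
    have e3 := hF.interVec_sub_swap_mem hG hD (h + 1) h x z
    have e4 : F 1 *ᵥ hat x ∈ Submodule.span ℝ {F 1 *ᵥ hat z, F 1 *ᵥ hat x} :=
      Submodule.subset_span (by simp)
    have e5 := Submodule.smul_mem _ (Fintype.card X : ℝ) e2
    rw [smul_sub, e1] at e5
    rw [Finset.sum_range_succ, Nat.add_sub_cancel]
    have e6 := Submodule.sub_mem _ (Submodule.add_mem _ (Submodule.add_mem _ ih
      (Submodule.smul_mem _ (θs h - θs (h + 1)) e3)) (Submodule.smul_mem _ (θs h * P h 1) e4)) e5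
    convert e6 using 1
    module

/-- Take the z-coordinate of the row of E_1 at the pair (z,z). The scalars are the coordinates of
T(E,E_1) and T(E,E_2), normalised by that of T(E,E_0). Together with `eigenvalue_one`, this makes μ
P h 2 / k_h a quadratic polynomial in θ*_h. -/
lemma exists_norton_scalars (hF : IsExtendedQOrdering G D F) (hG : IsDistanceRegularWith G D p)
    (hD : 1 ≤ D) (hθ : IsDualEigenvalueSeq G D (F 1) θs) {P : ℕ → ℕ → ℝ}
    (hP : ∀ h, distMatrix G h = ∑ j ∈ Finset.range (D + 1), P h j • F j) :
    ∃ κ μ : ℝ, 1 + κ + μ = θs 0 ∧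
      ∀ h ≤ D, kNum p h + P h 1 * κ + P h 2 * μ = θs h * P h 1 := by
  obtain ⟨z⟩ := hG.connected.nonempty
  have hN := hG.card_pos
  have hθ0 := hF.dual_pos hG hD hθ
  have e3 : tripleVec (F 1) (F 1) (F 0) z z z =
      (Fintype.card X : ℝ)⁻¹ * ((Fintype.card X : ℝ)⁻¹ * θs 0) := by
    rw [hF.ordering.1.zero_eq, tripleVec_const_right, hF.transpose_eq, hF.mul_self, hθ.apply hG,
      G.dist_self]
  have e1 := congrFun (hF.tripleVec_sum_tridiagonal (m := 0) hD (fun _ => 1) z z) z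
  simp only [one_smul, hF.sum_eq_one, tripleVec_one_right, zero_add, Pi.add_apply, Pi.smul_apply,
    mulVec_hat_apply, e3, hθ.apply hG, G.dist_self, smul_eq_mul] at e1
  set N : ℝ := (Fintype.card X : ℝ)
  refine ⟨tripleVec (F 1) (F 1) (F 1) z z z * N ^ 2 / θs 0,
    tripleVec (F 1) (F 1) (F 2) z z z * N ^ 2 / θs 0, ?_, fun h hh => ?_⟩
  · field_simp at e1 ⊢
    linarith
  · have e2 := congrFun (hF.tripleVec_sum_tridiagonal (m := 0) hD (P h) z z) z
    rw [← hP] at e2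
    simp only [zero_add, Pi.add_apply, Pi.smul_apply, e3, smul_eq_mul] at e2
    have e4 : tripleVec (F 1) (F 1) (distMatrix G h) z z z =
        (N⁻¹ * θs h) * (P h 1 * (N⁻¹ * θs 0)) := by
      have e := congrFun (congrFun (hF.mul_distMatrix hP h 1) z) z
      rw [Matrix.mul_apply, Matrix.smul_apply, smul_eq_mul, hθ.apply hG, G.dist_self] at e
      rw [← e, tripleVec, Finset.mul_sum]
      refine Finset.sum_congr rfl fun w _ => ?_
      by_cases hw : G.dist w z = h
      · rw [hθ.apply hG z w, dist_symm G z w, hw]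
      · simp [hw]
    rw [e4, hF.eigenvalue_zero hG hP hh] at e2
    field_simp at e2 ⊢
    linarith

/-- Partial sums of `P m 1 - P m 2` in terms of the dual eigenvalues. -/
lemma exists_sum_eigenvalue_sub (hF : IsExtendedQOrdering G D F)
    (hG : IsDistanceRegularWith G D p) (hD : 2 ≤ D) (hθ : IsDualEigenvalueSeq G D (F 1) θs)
    {P : ℕ → ℕ → ℝ} (hP : ∀ h, distMatrix G h = ∑ j ∈ Finset.range (D + 1), P h j • F j) :
    ∃ C : ℝ, ∀ h, 1 ≤ h → h ≤ D → ∑ m ∈ Finset.range h, (P m 1 - P m 2) =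
      C * (kNum p h * cNum p h * ((θs (h - 1) - θs h) *
        (θs 0 + θs 1 - θs (h - 1) - θs h))) := by
  obtain ⟨κ, μ, hκ, hrel⟩ := hF.exists_norton_scalars hG (by omega) hθ hP
  have hθ0 := hF.dual_pos hG (by omega) hθ
  have d01 := hF.dual_injOn hG (by omega) hθ (i := 0) (j := 1) (by omega) (by omega) (by omega)
  have d02 := hF.dual_injOn hG (by omega) hθ (i := 0) (j := 2) (by omega) (by omega) (by omega)
  have d12 := hF.dual_injOn hG (by omega) hθ (i := 1) (j := 2) (by omega) (by omega) (by omega)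
  have hk1 := hF.eigenvalue_zero hG hP (h := 1) (by omega)
  have t2 := hF.eigenvalue_injOn hG hP (i := 2) (j := 0) (by omega) (by omega) (by omega)
  have hkpos : ∀ h ≤ D, (kNum p h : ℝ) ≠ 0 := fun h hh => by
    exact_mod_cast (hG.kNum_pos hh).ne'
  have hone := fun h hh => hF.eigenvalue_one hG hθ hP (h := h) hh
  -- Otherwise every θ*_h would be a root of (T - θ*_0)(T + 1), forcing θ*_1 = θ*_2.
  have hμ : μ ≠ 0 := by
    rintro rfl
    have key : ∀ h ≤ D, (θs h - θs 0) * (θs h + 1) = 0 := fun h hh => by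
      have e1 := hrel h hh
      have e2 := hone h hh
      apply mul_left_cancel₀ (hkpos h hh)
      linear_combination (κ - θs h) * e2 - θs 0 * e1 + kNum p h * θs h * hκ
    have e1 := (mul_eq_zero.1 (key 1 (by omega))).resolve_left (sub_ne_zero.2 d01.symm)
    have e2 := (mul_eq_zero.1 (key 2 hD)).resolve_left (sub_ne_zero.2 d02.symm)
    exact d12 (by linarith)
  have hkb : ∀ h, 1 ≤ h → h ≤ D →
      (kNum p (h - 1) : ℝ) * bNum p (h - 1) = kNum p h * cNum p h := fun h h1 hh => by
    have := hG.kNum_mul_bNum (i := h - 1) (by omega)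
    rw [Nat.sub_add_cancel h1] at this
    exact_mod_cast this
  have s1 : ∀ h, 1 ≤ h → h ≤ D → θs 0 * (P 1 1 - kNum p 1) * ∑ m ∈ Finset.range h, P m 1 =
      kNum p h * cNum p h * (θs h - θs (h - 1)) := fun h h1 hh => by
    have e := hF.eigenvalue_sum hG hP h1 hh (j := 1) (by omega)
    have e1 := hone h hh
    have e2 := hone (h - 1) (by omega)
    linear_combination θs 0 * e + cNum p h * e1 - bNum p (h - 1) * e2 - θs (h - 1) * hkb h h1 hh
  have s2 : ∀ h, 1 ≤ h → h ≤ D →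
      θs 0 * μ * (P 1 2 - kNum p 1) * ∑ m ∈ Finset.range h, P m 2 =
      kNum p h * cNum p h * (θs h - θs (h - 1)) * (θs h + θs (h - 1) - κ) := fun h h1 hh => by
    have e := hF.eigenvalue_sum hG hP h1 hh (j := 2) hD
    have e1 := hone h hh
    have e2 := hone (h - 1) (by omega)
    have r1 := hrel h hh
    have r2 := hrel (h - 1) (by omega)
    linear_combination θs 0 * μ * e + cNum p h * (θs h - κ) * e1
      - bNum p (h - 1) * (θs (h - 1) - κ) * e2 + θs 0 * cNum p h * r1
      - θs 0 * bNum p (h - 1) * r2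
      + (θs 0 - (θs (h - 1) - κ) * θs (h - 1)) * hkb h h1 hh
  have hP0 : ∀ j ≤ D, P 0 j = 1 := fun j hj => by
    refine hF.smul_cancel hj ?_
    rw [← hF.distMatrix_mul hP, one_smul]
    have hone : distMatrix G 0 = 1 := by
      ext x y
      rw [distMatrix_apply, Matrix.one_apply]
      simp only [hG.dist_eq_zero]
    rw [hone, one_mul]
  -- For h = 1 both sums equal 1, which evaluates the unknown factors in front of the sums. In the
  -- difference of the normalised sums κ cancels: (θ*_0 + θ*_1 - κ) - (θ*_{h-1} + θ*_h - κ).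
  have b1 := s1 1 le_rfl (by omega)
  have b2 := s2 1 le_rfl (by omega)
  simp only [Finset.sum_range_one, hP0 1 (by omega), hP0 2 hD, mul_one, Nat.sub_self] at b1 b2
  have hc1 : (cNum p 1 : ℝ) ≠ 0 := by exact_mod_cast (hG.cNum_pos le_rfl (by omega)).ne'
  have hne : (kNum p 1 : ℝ) * cNum p 1 * (θs 1 - θs 0) * (θs 1 + θs 0 - κ) ≠ 0 := by
    rw [← b2]
    exact mul_ne_zero (mul_ne_zero hθ0.ne' hμ) (sub_ne_zero.2 (by rw [← hk1]; exact t2))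
  refine ⟨-((kNum p 1 : ℝ) * cNum p 1 * (θs 1 - θs 0) * (θs 1 + θs 0 - κ))⁻¹, fun h h1 hh => ?_⟩
  have e1 := s1 h h1 hh
  have e2 := s2 h h1 hh
  rw [b1] at e1
  rw [b2] at e2
  rw [Finset.sum_sub_distrib]
  apply mul_left_cancel₀ hne
  rw [← mul_assoc, mul_neg, mul_inv_cancel₀ hne]
  linear_combination (θs 1 + θs 0 - κ) * e1 - e2

/-- For an edge `xz`, the vectors `∑ E ŵ` over `Γ_h(x) ∩ Γ_{h-1}(z)` are proportional modulo
`E x̂` and `E ẑ`. -/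
theorem edge_proportional (hF : IsExtendedQOrdering G D F) (hG : IsDistanceRegularWith G D p)
    (hD : 2 ≤ D) (hθ : IsDualEigenvalueSeq G D (F 1) θs) {x z : X} (hxz : G.dist x z = 1) {h : ℕ}
    (h1 : 1 ≤ h) (hh : h ≤ D) :
    ((p 1 2 1 : ℝ) * (θs 0 - θs 2)) • interVec G (F 1) h (h - 1) x z -
      ((p 1 h (h - 1) : ℝ) * (θs 0 + θs 1 - θs (h - 1) - θs h)) •
        interVec G (F 1) 2 1 x z ∈
      Submodule.span ℝ {F 1 *ᵥ hat z, F 1 *ᵥ hat x} := by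
  obtain ⟨P, hP⟩ := hF.exists_eigenvalues hG
  obtain ⟨C, hC⟩ := hF.exists_sum_eigenvalue_sub hG hD hθ hP
  -- Each such vector is a multiple of the Norton product once the factor θ*_{h-1} - θ*_h is
  -- cancelled; cross-multiplying the cases h and 2 eliminates the Norton product.
  have key : ∀ h, 1 ≤ h → h ≤ D → interVec G (F 1) h (h - 1) x z +
      (Fintype.card X * C * kNum p 1 * p 1 h (h - 1) * (θs 0 + θs 1 - θs (h - 1) - θs h)) •
        tripleVec (F 1) (F 1) (F 1) z x ∈
      Submodule.span ℝ {F 1 *ᵥ hat z, F 1 *ᵥ hat x} := by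
    intro h h1 hh
    have e := hF.edge_telescope hG (by omega) hθ hP hxz h
    have hv : (kNum p 1 : ℝ) * p 1 h (h - 1) = kNum p h * cNum p h := by
      exact_mod_cast hG.valency_mul_edge h1 hh
    have hne : θs (h - 1) - θs h ≠ 0 := sub_ne_zero.2
      (hF.dual_injOn hG (by omega) hθ (by omega) hh (by omega))
    rw [hC h h1 hh, ← hv] at e
    rw [← Submodule.smul_mem_iff _ hne]
    convert e using 1
    module
  have e1 := key h h1 hh
  have e2 := key 2 (by omega) hD
  have e3 := Submodule.sub_mem _ (Submodule.smul_mem _ ((p 1 2 1 : ℝ) * (θs 0 - θs 2)) e1)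
    (Submodule.smul_mem _ ((p 1 h (h - 1) : ℝ) * (θs 0 + θs 1 - θs (h - 1) - θs h)) e2)
  convert e3 using 1
  module

end IsExtendedQOrdering

end Edge

/-! ### All kite numbers in terms of z_2. -/

section KiteRelation

variable {X : Type*} [Fintype X] [DecidableEq X] {G : SimpleGraph X} {D : ℕ}
  {p : ℕ → ℕ → ℕ → ℕ} {F : ℕ → Matrix X X ℝ} {θs : ℕ → ℝ}

namespace IsExtendedQOrdering

/-- From the sum over all neighbours of x, remove z and the common neighbours of x and z. The latter
lie at distance i-1 or i from y, and the kite function counts those at distance i-1. -/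
lemma sum_dual_inter_two (hF : IsExtendedQOrdering G D F) (hG : IsDistanceRegularWith G D p)
    (hD : 1 ≤ D) (hθ : IsDualEigenvalueSeq G D (F 1) θs)
    {P : ℕ → ℕ → ℝ} (hP : ∀ h, distMatrix G h = ∑ j ∈ Finset.range (D + 1), P h j • F j)
    {i : ℕ} {x y z : X} (hxz : G.dist x z = 1) (hi : 1 ≤ i) (hxy : G.dist x y = i)
    (hzy : G.dist z y = i - 1) :
    ∑ w ∈ sphereInter G 1 2 x z, θs (G.dist w y) = P 1 1 * θs i - θs (i - 1) -
      (kiteFun G i x y z * θs (i - 1) + (aNum p 1 - kiteFun G i x y z) * θs i) := by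
  have e := hF.sum_sphere_dual hG hθ hP 1 x y
  have ha := hG.card_eq 1 1 1 hD hD hD x z hxz
  rw [hxy] at e
  rw [← e, aNum, ← ha, sphereInter, sphereInter, sphere, kiteFun, Finset.card_filter,
    Finset.card_filter, Finset.sum_filter, Finset.sum_filter]
  push_cast
  rw [← Finset.sum_sub_distrib, Finset.sum_mul, Finset.sum_mul, ← Finset.sum_add_distrib]
  have hz : θs (i - 1) = ∑ w, if w = z then θs (i - 1) else 0 := by simp
  conv_rhs => rw [sub_right_comm]; arg 2; rw [hz]
  rw [← Finset.sum_sub_distrib, ← Finset.sum_sub_distrib]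
  refine Finset.sum_congr rfl fun w _ => ?_
  by_cases hxw : G.dist x w = 1
  · have t1 := hG.triangle z x w
    have t2 := hG.triangle x w y
    have t3 := hG.triangle w x y
    have t4 := hG.triangle w z y
    have s1 := dist_symm G x z
    have s2 := dist_symm G x w
    have s3 := dist_symm G z w
    have s4 := dist_symm G y w
    by_cases hwz : w = z
    · subst hwz
      simp [hzy, hxz, -SimpleGraph.dist_eq_one_iff_adj]
    · have hne : G.dist z w ≠ 0 := fun h => hwz (hG.dist_eq_zero.1 h).symm
      have : G.dist z w = 1 ∨ G.dist z w = 2 := by omega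
      rcases this with h | h
      · have : G.dist w y = i - 1 ∨ G.dist w y = i := by omega
        rcases this with h' | h'
        · simp [h, h', hwz, hxw, s4, -SimpleGraph.dist_eq_one_iff_adj]
        · have : i ≠ i - 1 := by omega
          simp [h, h', hwz, hxw, s4, this, -SimpleGraph.dist_eq_one_iff_adj]
      · simp [h, hwz, hxw, -SimpleGraph.dist_eq_one_iff_adj]
  · have hwz : w ≠ z := by
      rintro rfl
      exact hxw hxz
    simp [hxw, hwz, -SimpleGraph.dist_eq_one_iff_adj]

/-- The kite sums over an edge, as a linear function of those with `i = 2`. -/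
lemma edge_kite_relation (hF : IsExtendedQOrdering G D F) (hG : IsDistanceRegularWith G D p)
    (hD : 2 ≤ D) (hθ : IsDualEigenvalueSeq G D (F 1) θs)
    {P : ℕ → ℕ → ℝ} (hP : ∀ h, distMatrix G h = ∑ j ∈ Finset.range (D + 1), P h j • F j)
    {x z : X} (hxz : G.dist x z = 1) {i : ℕ} (hi : 1 ≤ i) (hiD : i ≤ D) {R S : ℝ}
    (h1 : R * θs 0 + S * θs 1 = bNum p 1 * θs 1) (h2 : R * θs 1 + S * θs 0 = bNum p 1 * θs 2) :
    (p 1 2 1 * (θs 0 - θs 2)) * (p 1 i (i - 1) * ((P 1 1 - aNum p 1 - R) * θs i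
        - (1 + S) * θs (i - 1)) - (θs (i - 1) - θs i) *
        ∑ y ∈ sphereInter G i (i - 1) x z, (kiteFun G i x y z : ℝ)) =
    (p 1 i (i - 1) * (θs 0 + θs 1 - θs (i - 1) - θs i)) *
      (p 1 2 1 * ((P 1 1 - aNum p 1 - R) * θs 2
        - (1 + S) * θs 1) - (θs 1 - θs 2) *
        ∑ y ∈ sphereInter G 2 1 x z, (kiteFun G 2 x y z : ℝ)) := by
  have hN := hG.card_pos
  have hzx : G.dist z x = 1 := by rw [dist_symm, hxz]
  -- `h1` and `h2` say exactly that L kills Ex̂ and Eẑ, so applying L to `edge_proportional` leaves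
  -- a scalar identity, whose entries `sum_dual_inter_two` turns into kite functions.
  let L : (X → ℝ) →ₗ[ℝ] ℝ := (Fintype.card X : ℝ) •
    (∑ w ∈ sphereInter G 1 2 x z, LinearMap.proj w - R • LinearMap.proj x - S • LinearMap.proj z)
  have hL : ∀ V : X → ℝ, L V = Fintype.card X *
      (∑ w ∈ sphereInter G 1 2 x z, V w - R * V x - S * V z) := fun V => by
    simp [L, LinearMap.sum_apply]
  have hLE : ∀ y, L (F 1 *ᵥ hat y) = ∑ w ∈ sphereInter G 1 2 x z, θs (G.dist w y)
      - R * θs (G.dist x y) - S * θs (G.dist z y) := fun y => by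
    rw [hL]
    simp only [mulVec_hat_apply, hθ.apply hG, ← Finset.mul_sum]
    field_simp
  have hb : (sphereInter G 1 2 x z).card = bNum p 1 := hG.card_farther (by omega) hxz
  have hLx : L (F 1 *ᵥ hat x) = 0 := by
    rw [hLE, sum_sphereInter_const (c := θs 1), hb, G.dist_self, hzx]
    · linarith
    · intro w h _
      rw [dist_symm, h]
  have hLz : L (F 1 *ᵥ hat z) = 0 := by
    rw [hLE, sum_sphereInter_const (c := θs 2), hb, G.dist_self, hxz]
    · linarith
    · intro w _ h
      rw [dist_symm, h]
  have hLi : ∀ i, 1 ≤ i → i ≤ D → L (interVec G (F 1) i (i - 1) x z) =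
      p 1 i (i - 1) * ((P 1 1 - aNum p 1 - R) * θs i
        - (1 + S) * θs (i - 1)) - (θs (i - 1) - θs i) *
        ∑ y ∈ sphereInter G i (i - 1) x z, (kiteFun G i x y z : ℝ) := fun i hi hiD => by
    have hn := hG.card_eq 1 i (i - 1) (by omega) hiD (by omega) x z hxz
    rw [interVec, map_sum, Finset.mul_sum, ← hn, ← nsmul_eq_mul, ← Finset.sum_const,
      ← Finset.sum_sub_distrib]
    refine Finset.sum_congr rfl fun y hy => ?_
    rw [mem_sphereInter] at hy
    rw [hLE, hF.sum_dual_inter_two hG (by omega) hθ hP hxz hi hy.1 hy.2, hy.1, hy.2]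
    ring
  have hp := hF.edge_proportional hG hD hθ hxz hi hiD
  obtain ⟨a, b, hab⟩ := Submodule.mem_span_pair.1 hp
  have := congrArg L hab
  rw [map_add, map_smul, map_smul, hLx, hLz, map_sub, map_smul, map_smul, hLi i hi hiD,
    hLi 2 (by omega) hD] at this
  simp only [smul_eq_mul, mul_zero, add_zero] at this
  linarith

/-- `z_i = α_i z_2 + a_1 β_i`. -/
theorem kiteNumber_eq (hF : IsExtendedQOrdering G D F) (hG : IsDistanceRegularWith G D p)
    (hD : 2 ≤ D) (hθ : IsDualEigenvalueSeq G D (F 1) θs) {i : ℕ} (hi : 2 ≤ i) (hiD : i ≤ D) :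
    kiteNumber G p i = kiteAlpha θs i * kiteNumber G p 2 + aNum p 1 * kiteBeta θs i := by
  obtain ⟨P, hP⟩ := hF.exists_eigenvalues hG
  have hN := hG.card_pos
  have d01 := hF.dual_injOn hG (by omega) hθ (i := 0) (j := 1) (by omega) (by omega) (by omega)
  have d02 := hF.dual_injOn hG (by omega) hθ (i := 0) (j := 2) (by omega) (by omega) (by omega)
  have di := hF.dual_injOn hG (by omega) hθ (i := i - 1) (j := i) (by omega) hiD (by omega)
  have hs := hF.dual_add_ne_zero hG hθ (i := 1) le_rfl (by omega)
  have hsq := hF.dual_sq_sub_ne_zero hG hθ (i := 1) le_rfl (by omega)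
  -- The solution of a 2 × 2 linear system with determinant θ*_0² - θ*_1² ≠ 0.
  obtain ⟨R, S, h1, h2⟩ : ∃ R S : ℝ, R * θs 0 + S * θs 1 = bNum p 1 * θs 1 ∧
      R * θs 1 + S * θs 0 = bNum p 1 * θs 2 :=
    ⟨bNum p 1 * ((θs 0 * θs 1 - θs 2 * θs 1) / (θs 0 ^ 2 - θs 1 ^ 2)),
      bNum p 1 * ((θs 0 * θs 2 - θs 1 * θs 1) / (θs 0 ^ 2 - θs 1 ^ 2)),
      by field_simp; ring, by field_simp; ring⟩
  have hk : (kNum p 1 : ℝ) ≠ 0 := by exact_mod_cast (hG.kNum_pos (by omega : 1 ≤ D)).ne'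
  have hn : ∀ h, 1 ≤ h → h ≤ D → (p 1 h (h - 1) : ℝ) ≠ 0 := fun h h1 hh => by
    have e1 := hG.valency_mul_edge h1 hh
    have e2 := Nat.mul_pos (hG.kNum_pos hh) (hG.cNum_pos h1 hh)
    rw [← e1] at e2
    exact_mod_cast (Nat.pos_of_mul_pos_left e2).ne'
  -- sum over all edges
  have key : (p 1 2 1 * (θs 0 - θs 2)) * (p 1 i (i - 1) * ((P 1 1 - aNum p 1 - R) * θs i
        - (1 + S) * θs (i - 1)) - (θs (i - 1) - θs i) * (p 1 i (i - 1) * kiteNumber G p i)) =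
    (p 1 i (i - 1) * (θs 0 + θs 1 - θs (i - 1) - θs i)) *
      (p 1 2 1 * ((P 1 1 - aNum p 1 - R) * θs 2
        - (1 + S) * θs 1) - (θs 1 - θs 2) * (p 1 2 1 * kiteNumber G p 2)) := by
    have e : ∀ x, ∀ z ∈ sphere G 1 x, _ := fun x z hz =>
      hF.edge_kite_relation hG hD hθ hP (mem_sphere.1 hz) (by omega : 1 ≤ i) hiD h1 h2
    have e' := Finset.sum_congr (rfl : (Finset.univ : Finset X) = _)
      fun x _ => Finset.sum_congr rfl (e x)
    simp only [← Finset.mul_sum, Finset.sum_sub_distrib] at e'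
    have s1 := sum_edges_kites hG (by omega : 1 ≤ i) hiD
    have s2 := sum_edges_kites hG (by omega : 1 ≤ 2) hD
    simp only [show 2 - 1 = 1 from rfl] at s2
    rw [s1, s2] at e'
    simp only [Finset.sum_const, hG.card_sphere (by omega : 1 ≤ D), Finset.card_univ,
      nsmul_eq_mul] at e'
    apply mul_left_cancel₀ (mul_ne_zero hN.ne' hk)
    linear_combination e'
  -- the relations at distances `0` and `1`
  have hk1 : P 1 1 * θs 0 = kNum p 1 * θs 1 := hF.eigenvalue_one hG hθ hP (by omega)
  obtain ⟨x, z, hxz⟩ := hG.exists_dist_eq (i := 1) (by omega)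
  have hb1 : (bNum p 1 : ℝ) * θs 2 = P 1 1 * θs 1 - θs 0 - aNum p 1 * θs 1 := by
    have e := hF.sum_dual_inter_two hG (by omega) hθ hP hxz le_rfl hxz (by simp)
    rw [sum_sphereInter_const (c := θs 2), hG.card_farther (i := 1) (by omega) hxz] at e
    · have : kiteFun G 1 x z z = 0 := by
        rw [kiteFun, Finset.card_eq_zero, Finset.filter_eq_empty_iff]
        rintro w - ⟨-, h, h'⟩
        omega
      rw [this] at e
      push_cast at e
      linear_combination e
    · intro w _ h
      rw [dist_symm, h]
  have hkk : (kNum p 1 : ℝ) = 1 + aNum p 1 + bNum p 1 := by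
    have h3 : sphere G 1 x = ({z} ∪ sphereInter G 1 1 x z) ∪ sphereInter G 1 (1 + 1) x z := by
      ext w
      simp only [mem_sphere, Finset.mem_union, Finset.mem_singleton, mem_sphereInter]
      constructor
      · intro hw
        have t := hG.triangle z x w
        have s := dist_symm G x z
        by_cases h0 : G.dist z w = 0
        · exact Or.inl (Or.inl (hG.dist_eq_zero.1 h0).symm)
        · have : G.dist z w = 1 ∨ G.dist z w = 1 + 1 := by omega
          tauto
      · rintro ((rfl | h) | h)
        · exact hxz
        · exact h.1
        · exact h.1
    have h4 : Disjoint {z} (sphereInter G 1 1 x z) := by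
      rw [Finset.disjoint_singleton_left, mem_sphereInter, G.dist_self]
      omega
    have h5 : Disjoint ({z} ∪ sphereInter G 1 1 x z) (sphereInter G 1 (1 + 1) x z) := by
      rw [Finset.disjoint_left]
      intro w hw hw'
      rw [mem_sphereInter] at hw'
      rw [Finset.mem_union, Finset.mem_singleton, mem_sphereInter] at hw
      rcases hw with rfl | hw
      · rw [G.dist_self] at hw'
        omega
      · omega
    rw [← hG.card_sphere (by omega : 1 ≤ D) x, h3, Finset.card_union_of_disjoint h5,
      Finset.card_union_of_disjoint h4, Finset.card_singleton,
      hG.card_farther (i := 1) (by omega) hxz,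
      hG.card_eq 1 1 1 (by omega) (by omega) (by omega) x z hxz, aNum]
    push_cast
    ring
  -- The neighbour sums seen from x and from z give two equations for P 1 1 - R and 1 + S. Their
  -- difference shows that these are opposite, so both are expressed by a_1, θ*_0 and θ*_1, and b_1
  -- and P 1 1 drop out of `key`.
  have r1 : (P 1 1 - R) * θs 0 - (1 + S) * θs 1 = aNum p 1 * θs 1 := by
    rw [hkk] at hk1
    linear_combination hk1 - h1
  have r2 : (P 1 1 - R) * θs 1 - (1 + S) * θs 0 = aNum p 1 * θs 1 := by
    linear_combination -hb1 - h2
  have r3 : 1 + S = -(P 1 1 - R) := by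
    apply mul_left_cancel₀ (sub_ne_zero.2 d01)
    linear_combination r1 - r2
  have r4 : (P 1 1 - R) = aNum p 1 * θs 1 / (θs 0 + θs 1) := by
    rw [eq_div_iff hs]
    linear_combination r1 + θs 1 * r3
  have r5 : P 1 1 - aNum p 1 - R = aNum p 1 * θs 1 / (θs 0 + θs 1) - aNum p 1 := by
    rw [← r4]
    ring
  rw [r5, r3, r4] at key
  have key' : (θs 0 - θs 2) * (((aNum p 1 * θs 1 / (θs 0 + θs 1) - aNum p 1) * θs i
        + (aNum p 1 * θs 1 / (θs 0 + θs 1)) * θs (i - 1))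
        - (θs (i - 1) - θs i) * kiteNumber G p i) =
      (θs 0 + θs 1 - θs (i - 1) - θs i) *
      (((aNum p 1 * θs 1 / (θs 0 + θs 1) - aNum p 1) * θs 2
        + (aNum p 1 * θs 1 / (θs 0 + θs 1)) * θs 1) - (θs 1 - θs 2) * kiteNumber G p 2) := by
    apply mul_left_cancel₀ (mul_ne_zero (hn i (by omega) hiD) (hn 2 (by omega) hD))
    simp only [show 2 - 1 = 1 from rfl]
    linear_combination key
  have d02' := sub_ne_zero.2 d02
  have di' := sub_ne_zero.2 di
  rw [kiteAlpha, kiteBeta]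
  field_simp at key' ⊢
  apply mul_left_cancel₀ hs
  linear_combination -key'

end IsExtendedQOrdering

end KiteRelation

/-! ### Dependence of two vectors via the Gram determinant. -/

section LinearAlgebra

variable {X : Type*} [Fintype X]

/-- The equality case of Cauchy–Schwarz: the squared norm of the difference of the two sides is
⟨b,b⟩ times the Gram determinant. -/
lemma smul_eq_smul_of_gram {a b : X → ℝ} (h : (a ⬝ᵥ a) * (b ⬝ᵥ b) = (a ⬝ᵥ b) ^ 2) :
    (b ⬝ᵥ b) • a = (a ⬝ᵥ b) • b := by
  rw [← sub_eq_zero, ← dotProduct_self_eq_zero]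
  simp only [sub_dotProduct, dotProduct_sub, smul_dotProduct, dotProduct_smul, smul_eq_mul,
    dotProduct_comm b a]
  linear_combination (b ⬝ᵥ b) * h

lemma gram_of_smul {a b e : X → ℝ} {ε δ : ℝ} (ha : a = ε • e) (hb : b = δ • e) :
    (a ⬝ᵥ a) * (b ⬝ᵥ b) = (a ⬝ᵥ b) ^ 2 := by
  rw [ha, hb]
  simp only [smul_dotProduct, dotProduct_smul, smul_eq_mul]
  ring

lemma eq_smul_iff_of_gram {a b : X → ℝ} (h : (a ⬝ᵥ a) * (b ⬝ᵥ b) = (a ⬝ᵥ b) ^ 2)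
    (hab : a ⬝ᵥ b ≠ 0) (l : ℝ) : a = l • b ↔ l * (a ⬝ᵥ b) = a ⬝ᵥ a := by
  constructor
  · intro e
    conv_rhs => arg 2; rw [e]
    rw [dotProduct_smul, smul_eq_mul]
  · intro e
    have hbb : b ⬝ᵥ b ≠ 0 := by
      intro h0
      rw [h0, mul_zero, eq_comm, sq_eq_zero_iff] at h
      exact hab h
    apply smul_right_injective _ hbb
    change (b ⬝ᵥ b) • a = (b ⬝ᵥ b) • l • b
    rw [smul_eq_smul_of_gram h, smul_smul]
    congr 1
    apply mul_right_cancel₀ hab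
    linear_combination -h - b ⬝ᵥ b * e

/-- One of the vectors is zero, and the other is recovered from s•a - t•b by dividing by s or by -t.
-/
lemma exists_smul_of_dotProduct_eq_zero {a b : X → ℝ} {s t : ℝ} (hs : s ≠ 0) (ht : t ≠ 0)
    (h : (a ⬝ᵥ a) * (b ⬝ᵥ b) = 0) :
    ∃ ε δ : ℝ, a = ε • (s • a - t • b) ∧ b = δ • (s • a - t • b) := by
  rcases mul_eq_zero.1 h with h | h
  · rw [dotProduct_self_eq_zero] at h
    refine ⟨0, -t⁻¹, by simp [h], ?_⟩
    rw [h, smul_zero, zero_sub, smul_neg, neg_smul, neg_neg, inv_smul_smul₀ ht]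
  · rw [dotProduct_self_eq_zero] at h
    refine ⟨s⁻¹, 0, ?_, by simp [h]⟩
    rw [h, smul_zero, sub_zero, inv_smul_smul₀ hs]

/-- With zero Gram determinant a = l•b and b ≠ 0, so s•a - t•b = (sl - t)•b; this spans a and b
exactly when sl ≠ t. -/
lemma exists_smul_iff_of_dotProduct_ne_zero {a b : X → ℝ} {s t l : ℝ} (hs : s ≠ 0)
    (hab : a ⬝ᵥ b ≠ 0) (hl : l * (a ⬝ᵥ b) = a ⬝ᵥ a) :
    (∃ ε δ : ℝ, a = ε • (s • a - t • b) ∧ b = δ • (s • a - t • b)) ↔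
      (a ⬝ᵥ a) * (b ⬝ᵥ b) = (a ⬝ᵥ b) ^ 2 ∧ l ≠ t / s := by
  constructor
  · rintro ⟨ε, δ, ha, hb⟩
    have hg := gram_of_smul ha hb
    refine ⟨hg, ?_⟩
    rintro rfl
    have e := (eq_smul_iff_of_gram hg hab _).2 hl
    have e' : s • a - t • b = 0 := by
      nth_rewrite 1 [e]
      rw [smul_smul, mul_div_cancel₀ _ hs, sub_self]
    rw [e', smul_zero] at ha
    rw [ha, zero_dotProduct] at hab
    exact hab rfl
  · rintro ⟨hg, hne⟩
    have e := (eq_smul_iff_of_gram hg hab _).2 hl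
    have hst : s * l - t ≠ 0 := fun h => hne (by
      rw [eq_div_iff hs]
      linear_combination h)
    have e' : s • a - t • b = (s * l - t) • b := by
      nth_rewrite 1 [e]
      rw [sub_smul, smul_smul]
    rw [e']
    refine ⟨l * (s * l - t)⁻¹, (s * l - t)⁻¹, ?_, ?_⟩
    · rw [smul_smul, inv_mul_cancel_right₀ hst]
      exact e
    · rw [smul_smul, inv_mul_cancel₀ hst, one_smul]

end LinearAlgebra

/-! ### Inner products of the orthogonal components of Ex_y^- and Ex_y^+. -/

section Gram

variable {X : Type*} [Fintype X] [DecidableEq X] {G : SimpleGraph X} {D : ℕ}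
  {p : ℕ → ℕ → ℕ → ℕ} {F : ℕ → Matrix X X ℝ} {θs : ℕ → ℝ}

lemma mulVec_minusVec (E : Matrix X X ℝ) {i : ℕ} (hi : 1 ≤ i) {x y : X} (hxy : G.dist x y = i) :
    E *ᵥ minusVec G x y = interVec G E 1 (i - 1) x y := by
  ext v
  rw [mulVec_minusVec_apply, interVec_apply, hxy]
  refine Finset.sum_congr rfl fun w _ => if_congr (and_congr_right fun _ => ?_) rfl rfl
  omega

lemma mulVec_plusVec (E : Matrix X X ℝ) {i : ℕ} {x y : X} (hxy : G.dist x y = i) :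
    E *ᵥ plusVec G x y = interVec G E 1 (i + 1) x y := by
  ext v
  rw [mulVec_plusVec_apply, interVec_apply, hxy]

/-- The component of `E x_y^-` orthogonal to `E x̂` and `E ŷ`. -/
def lowVec (G : SimpleGraph X) (p : ℕ → ℕ → ℕ → ℕ) (E : Matrix X X ℝ) (θs : ℕ → ℝ) (i : ℕ)
    (x y : X) : X → ℝ :=
  E *ᵥ minusVec G x y - rLow p θs i • (E *ᵥ hat x) - sLow p θs i • (E *ᵥ hat y)

/-- The component of `E x_y^+` orthogonal to `E x̂` and `E ŷ`. -/
def upVec (G : SimpleGraph X) (p : ℕ → ℕ → ℕ → ℕ) (E : Matrix X X ℝ) (θs : ℕ → ℝ) (i : ℕ)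
    (x y : X) : X → ℝ :=
  E *ᵥ plusVec G x y - rUp p θs i • (E *ᵥ hat x) - sUp p θs i • (E *ᵥ hat y)

/-- Sums of dual eigenvalues over a set of neighbours of `x`. -/
lemma sum_dual_neighbors (hG : IsDistanceRegularWith G D p) {s : Finset X} {x w : X}
    (hs : ∀ v ∈ s, G.dist x v = 1) (hw : w ∈ s) :
    ∑ v ∈ s, θs (G.dist w v) = θs 0 +
      (s.filter fun v => G.dist w v = 1).card * (θs 1 - θs 2) + (s.card - 1) * θs 2 := by
  have : ∀ v ∈ s, θs (G.dist w v) = (if v = w then θs 0 - θs 2 else 0) +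
      (if G.dist w v = 1 then θs 1 - θs 2 else 0) + θs 2 := fun v hv => by
    have t := hG.triangle w x v
    rw [dist_symm G w x, hs w hw, hs v hv] at t
    by_cases hvw : v = w
    · subst hvw
      simp
    · have hne : G.dist w v ≠ 0 := fun h => hvw (hG.dist_eq_zero.1 h).symm
      have : G.dist w v = 1 ∨ G.dist w v = 2 := by omega
      rcases this with h | h
      · simp [h, hvw, -SimpleGraph.dist_eq_one_iff_adj]
      · simp [h, hvw]
  rw [Finset.sum_congr rfl this, Finset.sum_add_distrib, Finset.sum_add_distrib,
    Finset.sum_ite_eq' s w, if_pos hw, ← Finset.sum_filter, Finset.sum_const, Finset.sum_const]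
  simp only [nsmul_eq_mul]
  ring

namespace IsExtendedQOrdering

lemma mulVec_dotProduct (hF : IsExtendedQOrdering G D F) (u v : X → ℝ) :
    (F 1 *ᵥ u) ⬝ᵥ (F 1 *ᵥ v) = u ⬝ᵥ (F 1 *ᵥ v) := by
  rw [Matrix.dotProduct_mulVec, ← Matrix.mulVec_transpose, hF.transpose_eq, Matrix.mulVec_mulVec,
    hF.mul_self, Matrix.dotProduct_mulVec, ← Matrix.mulVec_transpose, hF.transpose_eq]

lemma interVec_dual (hG : IsDistanceRegularWith G D p)
    (hθ : IsDualEigenvalueSeq G D (F 1) θs) (i j : ℕ) (x y v : X) :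
    Fintype.card X * interVec G (F 1) i j x y v =
      ∑ w ∈ sphereInter G i j x y, θs (G.dist v w) := by
  have hN := hG.card_pos
  rw [interVec, Finset.sum_apply]
  simp only [mulVec_hat_apply, hθ.apply hG, ← Finset.mul_sum]
  rw [mul_inv_cancel_left₀ hN.ne']

lemma card_mul_mulVec_hat (hG : IsDistanceRegularWith G D p)
    (hθ : IsDualEigenvalueSeq G D (F 1) θs) (x v : X) :
    Fintype.card X * (F 1 *ᵥ hat x) v = θs (G.dist v x) := by
  rw [mulVec_hat_apply, hθ.apply hG, mul_inv_cancel_left₀ hG.card_pos.ne']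

lemma lowVec_dual (hG : IsDistanceRegularWith G D p)
    (hθ : IsDualEigenvalueSeq G D (F 1) θs) {i : ℕ} (hi : 1 ≤ i) {x y : X}
    (hxy : G.dist x y = i) (v : X) :
    Fintype.card X * lowVec G p (F 1) θs i x y v =
      ∑ w ∈ sphereInter G 1 (i - 1) x y, θs (G.dist v w) - rLow p θs i * θs (G.dist v x)
        - sLow p θs i * θs (G.dist v y) := by
  rw [lowVec, mulVec_minusVec _ hi hxy, ← interVec_dual hG hθ, ← card_mul_mulVec_hat hG hθ,
    ← card_mul_mulVec_hat hG hθ]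
  simp only [Pi.sub_apply, Pi.smul_apply, smul_eq_mul]
  ring

lemma upVec_dual (hG : IsDistanceRegularWith G D p)
    (hθ : IsDualEigenvalueSeq G D (F 1) θs) {i : ℕ} {x y : X}
    (hxy : G.dist x y = i) (v : X) :
    Fintype.card X * upVec G p (F 1) θs i x y v =
      ∑ w ∈ sphereInter G 1 (i + 1) x y, θs (G.dist v w) - rUp p θs i * θs (G.dist v x)
        - sUp p θs i * θs (G.dist v y) := by
  rw [upVec, mulVec_plusVec _ hxy, ← interVec_dual hG hθ, ← card_mul_mulVec_hat hG hθ,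
    ← card_mul_mulVec_hat hG hθ]
  simp only [Pi.sub_apply, Pi.smul_apply, smul_eq_mul]
  ring

/-- For vectors in the column space of E, the x-coordinate is the inner product with Ex̂. The
scalars r_i and s_i solve the two resulting equations, with determinant θ*_0² - θ*_i². -/
lemma lowVec_orthogonal (hF : IsExtendedQOrdering G D F) (hG : IsDistanceRegularWith G D p)
    (hθ : IsDualEigenvalueSeq G D (F 1) θs) {i : ℕ} (hi : 1 ≤ i) (hiD : i < D) {x y : X}
    (hxy : G.dist x y = i) :
    lowVec G p (F 1) θs i x y x = 0 ∧ lowVec G p (F 1) θs i x y y = 0 := by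
  have hN := hG.card_pos
  have hsq := hF.dual_sq_sub_ne_zero hG hθ hi hiD
  constructor
  · apply mul_left_cancel₀ hN.ne'
    rw [lowVec_dual hG hθ hi hxy, sum_sphereInter_const (c := θs 1), hG.card_closer hi hxy,
      G.dist_self, hxy, rLow, sLow]
    · field_simp
      ring
    · intro w h _
      rw [h]
  · apply mul_left_cancel₀ hN.ne'
    rw [lowVec_dual hG hθ hi hxy, sum_sphereInter_const (c := θs (i - 1)), hG.card_closer hi hxy,
      G.dist_self, dist_symm, hxy, rLow, sLow]
    · field_simp
      ring
    · intro w _ h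
      rw [h]

lemma upVec_orthogonal (hF : IsExtendedQOrdering G D F) (hG : IsDistanceRegularWith G D p)
    (hθ : IsDualEigenvalueSeq G D (F 1) θs) {i : ℕ} (hi : 1 ≤ i) (hiD : i < D) {x y : X}
    (hxy : G.dist x y = i) :
    upVec G p (F 1) θs i x y x = 0 ∧ upVec G p (F 1) θs i x y y = 0 := by
  have hN := hG.card_pos
  have hsq := hF.dual_sq_sub_ne_zero hG hθ hi hiD
  constructor
  · apply mul_left_cancel₀ hN.ne'
    rw [upVec_dual hG hθ hxy, sum_sphereInter_const (c := θs 1), hG.card_farther hiD hxy,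
      G.dist_self, hxy, rUp, sUp]
    · field_simp
      ring
    · intro w h _
      rw [h]
  · apply mul_left_cancel₀ hN.ne'
    rw [upVec_dual hG hθ hxy, sum_sphereInter_const (c := θs (i + 1)), hG.card_farther hiD hxy,
      G.dist_self, dist_symm, hxy, rUp, sUp]
    · field_simp
      ring
    · intro w _ h
      rw [h]

lemma mulVec_lowVec (hF : IsExtendedQOrdering G D F) (i : ℕ) (x y : X) :
    F 1 *ᵥ lowVec G p (F 1) θs i x y = lowVec G p (F 1) θs i x y := by
  simp only [lowVec, Matrix.mulVec_sub, Matrix.mulVec_smul, Matrix.mulVec_mulVec, hF.mul_self]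

lemma mulVec_upVec (hF : IsExtendedQOrdering G D F) (i : ℕ) (x y : X) :
    F 1 *ᵥ upVec G p (F 1) θs i x y = upVec G p (F 1) θs i x y := by
  simp only [upVec, Matrix.mulVec_sub, Matrix.mulVec_smul, Matrix.mulVec_mulVec, hF.mul_self]

lemma mulVec_hat_dotProduct (hF : IsExtendedQOrdering G D F) {b : X → ℝ} (hb : F 1 *ᵥ b = b)
    (x : X) : (F 1 *ᵥ hat x) ⬝ᵥ b = b x := by
  rw [← hb, hF.mulVec_dotProduct, hb, hat, single_one_dotProduct]

lemma interVec_dotProduct (hF : IsExtendedQOrdering G D F) {b : X → ℝ} (hb : F 1 *ᵥ b = b)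
    (i j : ℕ) (x y : X) :
    interVec G (F 1) i j x y ⬝ᵥ b = ∑ w ∈ sphereInter G i j x y, b w := by
  rw [interVec, sum_dotProduct]
  exact Finset.sum_congr rfl fun w _ => hF.mulVec_hat_dotProduct hb w

/-- When b is fixed by E and orthogonal to Ex̂ and Eŷ, the correction terms contribute nothing, and
the inner product is a sum of coordinates of b. -/
lemma lowVec_dotProduct (hF : IsExtendedQOrdering G D F) {b : X → ℝ} (hb : F 1 *ᵥ b = b)
    {i : ℕ} (hi : 1 ≤ i) {x y : X} (hxy : G.dist x y = i) (hx : b x = 0) (hy : b y = 0) :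
    lowVec G p (F 1) θs i x y ⬝ᵥ b = ∑ w ∈ sphereInter G 1 (i - 1) x y, b w := by
  rw [lowVec, sub_dotProduct, sub_dotProduct, smul_dotProduct, smul_dotProduct,
    hF.mulVec_hat_dotProduct hb, hF.mulVec_hat_dotProduct hb, hx, hy, mulVec_minusVec _ hi hxy,
    hF.interVec_dotProduct hb]
  simp

lemma upVec_dotProduct (hF : IsExtendedQOrdering G D F) {b : X → ℝ} (hb : F 1 *ᵥ b = b)
    {i : ℕ} {x y : X} (hxy : G.dist x y = i) (hx : b x = 0) (hy : b y = 0) :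
    upVec G p (F 1) θs i x y ⬝ᵥ b = ∑ w ∈ sphereInter G 1 (i + 1) x y, b w := by
  rw [upVec, sub_dotProduct, sub_dotProduct, smul_dotProduct, smul_dotProduct,
    hF.mulVec_hat_dotProduct hb, hF.mulVec_hat_dotProduct hb, hx, hy, mulVec_plusVec _ hxy,
    hF.interVec_dotProduct hb]
  simp

/-- The squared norm of `lowVec`. -/
lemma lowVec_dotProduct_self (hF : IsExtendedQOrdering G D F) (hG : IsDistanceRegularWith G D p)
    (hθ : IsDualEigenvalueSeq G D (F 1) θs) (hR : IsReinforced G D p) {i : ℕ} (hi : 2 ≤ i)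
    (hiD : i < D) {x y : X} (hxy : G.dist x y = i) :
    Fintype.card X * (lowVec G p (F 1) θs i x y ⬝ᵥ lowVec G p (F 1) θs i x y) =
      cNum p i * ((θs 1 - θs 2) * (kiteNumber G p i - zMinus p θs i)) := by
  have horth := hF.lowVec_orthogonal hG hθ (by omega) hiD hxy
  have d12 := sub_ne_zero.2
    (hF.dual_injOn hG (by omega) hθ (i := 1) (j := 2) (by omega) (by omega) (by omega))
  rw [hF.lowVec_dotProduct (hF.mulVec_lowVec i x y) (by omega) hxy horth.1 horth.2,
    Finset.mul_sum]
  -- Two neighbours of x are at distance 0, 1 or 2, and the number at distance 1 from w is the kite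
  -- function. Each coordinate is thus affine in it, and reinforcement evaluates the sum.
  have e : ∀ w ∈ sphereInter G 1 (i - 1) x y,
      Fintype.card X * lowVec G p (F 1) θs i x y w =
        kiteFun G i x y w * (θs 1 - θs 2) + (θs 0 + (cNum p i - 1) * θs 2
          - rLow p θs i * θs 1 - sLow p θs i * θs (i - 1)) := fun w hw => by
    rw [lowVec_dual hG hθ (by omega) hxy, sum_dual_neighbors hG (x := x)
      (fun v hv => (mem_sphereInter.1 hv).1) hw, hG.card_closer (by omega) hxy]
    have hf : ((sphereInter G 1 (i - 1) x y).filter fun v => G.dist w v = 1).card =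
        kiteFun G i x y w := by
      rw [kiteFun]
      congr 1
      ext v
      simp only [Finset.mem_filter, mem_sphereInter, Finset.mem_univ, true_and, and_assoc]
    rw [hf]
    rw [mem_sphereInter] at hw
    rw [dist_symm G w x, dist_symm G w y, hw.1, hw.2]
    ring
  rw [Finset.sum_congr rfl e, Finset.sum_add_distrib, ← Finset.sum_mul,
    hR.sum_closer hG hi hiD.le hxy, Finset.sum_const, hG.card_closer (by omega) hxy, zMinus,
    nsmul_eq_mul]
  field_simp
  ring

/-- The squared norm of `upVec`. -/
lemma upVec_dotProduct_self (hF : IsExtendedQOrdering G D F) (hG : IsDistanceRegularWith G D p)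
    (hθ : IsDualEigenvalueSeq G D (F 1) θs) (hR : IsReinforced G D p) {i : ℕ} (hi : 2 ≤ i)
    (hiD : i < D) {x y : X} (hxy : G.dist x y = i) :
    Fintype.card X * (upVec G p (F 1) θs i x y ⬝ᵥ upVec G p (F 1) θs i x y) =
      bNum p i * ((θs 1 - θs 2) * (zPlusSucc p θs i - kiteNumber G p (i + 1))) := by
  have horth := hF.upVec_orthogonal hG hθ (by omega) hiD hxy
  have d12 := sub_ne_zero.2
    (hF.dual_injOn hG (by omega) hθ (i := 1) (j := 2) (by omega) (by omega) (by omega))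
  rw [hF.upVec_dotProduct (hF.mulVec_upVec i x y) hxy horth.1 horth.2, Finset.mul_sum]
  have e : ∀ w ∈ sphereInter G 1 (i + 1) x y,
      Fintype.card X * upVec G p (F 1) θs i x y w =
        -(kiteFun G (i + 1) w y x * (θs 1 - θs 2)) + (θs 0 + aNum p 1 * (θs 1 - θs 2)
          + (bNum p i - 1) * θs 2 - rUp p θs i * θs 1 - sUp p θs i * θs (i + 1)) := fun w hw => by
    rw [upVec_dual hG hθ hxy, sum_dual_neighbors hG (x := x)
      (fun v hv => (mem_sphereInter.1 hv).1) hw, hG.card_farther hiD hxy]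
    rw [mem_sphereInter] at hw
    -- The a_1 common neighbours of x and w lie at distance i+1 or i from y; those at distance i are
    -- counted by the kite function with x in its third slot.
    have hf : ((sphereInter G 1 (i + 1) x y).filter fun v => G.dist w v = 1).card +
        kiteFun G (i + 1) w y x = aNum p 1 := by
      rw [aNum, ← hG.card_eq 1 1 1 (by omega) (by omega) (by omega) x w hw.1, kiteFun,
        ← Finset.card_union_of_disjoint]
      · congr 1
        ext v
        simp only [Finset.mem_union, Finset.mem_filter, mem_sphereInter, Finset.mem_univ, true_and,
          Nat.add_sub_cancel]
        constructor
        · rintro (h | h)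
          · exact ⟨h.1.1, h.2⟩
          · exact ⟨h.2.2, h.1⟩
        · rintro ⟨h1, h2⟩
          have t1 := hG.triangle y x v
          have t2 := hG.triangle y v w
          have s1 := dist_symm G y x
          have s2 := dist_symm G v w
          have : G.dist y v = i + 1 ∨ G.dist y v = i := by omega
          tauto
      · rw [Finset.disjoint_left]
        intro v h1 h2
        simp only [Finset.mem_filter, mem_sphereInter, Finset.mem_univ, true_and] at h1 h2
        omega
    have hf' : (((sphereInter G 1 (i + 1) x y).filter fun v => G.dist w v = 1).card : ℝ) =
        aNum p 1 - kiteFun G (i + 1) w y x := by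
      rw [← hf]
      push_cast
      ring
    rw [hf', dist_symm G w x, dist_symm G w y, hw.1, hw.2]
    ring
  have hsum : ∑ w ∈ sphereInter G 1 (i + 1) x y, (kiteFun G (i + 1) w y x : ℝ) =
      bNum p i * kiteNumber G p (i + 1) := by
    rw [← hR.sum_farther hG (by omega : 1 ≤ i) hiD (y := y) (z := x) (by rw [dist_symm, hxy])]
    refine Finset.sum_congr ?_ fun _ _ => rfl
    ext w
    simp only [mem_sphereInter, and_comm]
  rw [Finset.sum_congr rfl e, Finset.sum_add_distrib, Finset.sum_neg_distrib, ← Finset.sum_mul,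
    hsum, Finset.sum_const, hG.card_farther hiD hxy, zPlusSucc, nsmul_eq_mul]
  field_simp
  ring

lemma dual_three_term (hF : IsExtendedQOrdering G D F)
    (hG : IsDistanceRegularWith G D p) (hθ : IsDualEigenvalueSeq G D (F 1) θs)
    {i : ℕ} (hi : i + 2 ≤ D) :
    θs i + θs (i + 2) = gammaStar θs + betaPar θs * θs (i + 1) := by
  induction i with
  | zero => rw [gammaStar]; ring
  | succ i ih =>
    have e := hF.dual_recurrence hG hθ (i := i) (by omega)
    have d12 := sub_ne_zero.2
      (hF.dual_injOn hG (by omega) hθ (i := 1) (j := 2) (by omega) (by omega) (by omega))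
    have e' : (betaPar θs + 1) * (θs (i + 1) - θs (i + 2)) = θs i - θs (i + 3) := by
      rw [betaPar]
      field_simp
      linarith
    have := ih (by omega)
    simp only [show i + 1 + 2 = i + 3 from rfl, show i + 1 + 1 = i + 2 from rfl]
    linear_combination this + e'

/-- A quadratic invariant of the three-term recurrence: θ*_i θ*_{i+2} - θ*_{i+1}² + γ* θ*_{i+1} does
not depend on i, and its value is read off at i = 0. -/
lemma dual_mul_three_term (hF : IsExtendedQOrdering G D F)
    (hG : IsDistanceRegularWith G D p) (hθ : IsDualEigenvalueSeq G D (F 1) θs)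
    {i : ℕ} (hi : i + 2 ≤ D) :
    θs i * θs (i + 2) = θs (i + 1) ^ 2 - gammaStar θs * θs (i + 1) -
      (θs 1 ^ 2 - gammaStar θs * θs 1 - θs 0 * θs 2) := by
  induction i with
  | zero => ring_nf
  | succ i ih =>
    have h1 := ih (by omega)
    have h2 := hF.dual_three_term hG hθ (i := i) (by omega)
    have h3 := hF.dual_three_term hG hθ (i := i + 1) (by omega)
    simp only [show i + 1 + 2 = i + 3 from rfl, show i + 1 + 1 = i + 2 from rfl] at *
    linear_combination h1 - θs (i + 2) * h2 + θs (i + 1) * h3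

/-- The inner product of `lowVec` and `upVec`. -/
lemma lowVec_dotProduct_upVec (hF : IsExtendedQOrdering G D F) (hG : IsDistanceRegularWith G D p)
    (hθ : IsDualEigenvalueSeq G D (F 1) θs) {i : ℕ} (hi : 1 ≤ i)
    (hiD : i < D) {x y : X} (hxy : G.dist x y = i) :
    Fintype.card X * (lowVec G p (F 1) θs i x y ⬝ᵥ upVec G p (F 1) θs i x y) =
      cNum p i * bNum p i * (gammaStar θs * ((θs i - θs 1) / (θs i + θs 0))) := by
  have horth := hF.lowVec_orthogonal hG hθ hi hiD hxy
  have hs := hF.dual_add_ne_zero hG hθ hi hiD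
  rw [add_comm] at hs
  have d0 := sub_ne_zero.2
    (hF.dual_injOn hG (by omega) hθ (i := 0) (j := i) (by omega) (by omega) (by omega))
  have hsq := hF.dual_sq_sub_ne_zero hG hθ hi hiD
  -- Each neighbour of x closer to y is at distance exactly 2 from each one farther from y, so
  -- `lowVec` is constant on Γ(x) ∩ Γ_{i+1}(y) and no kite number appears.
  rw [dotProduct_comm, hF.upVec_dotProduct (hF.mulVec_lowVec i x y) hxy horth.1 horth.2,
    Finset.mul_sum, sum_sphereInter_const (c := cNum p i * θs 2 - rLow p θs i * θs 1
      - sLow p θs i * θs (i + 1)), hG.card_farther hiD hxy]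
  · obtain ⟨j, rfl⟩ : ∃ j, i = j + 1 := ⟨i - 1, by omega⟩
    have h1 := hF.dual_three_term hG hθ (i := j) (by omega)
    have h2 := hF.dual_mul_three_term hG hθ (i := j) (by omega)
    have h3 := hF.dual_three_term hG hθ (i := 0) (by omega)
    rw [rLow, sLow]
    simp only [Nat.add_sub_cancel, show j + 1 + 1 = j + 2 from rfl, zero_add] at *
    have key : (θs 0 ^ 2 - θs (j + 1) ^ 2) * θs 2 - (θs 0 * θs 1 - θs j * θs (j + 1)) * θs 1
        - (θs 0 * θs j - θs 1 * θs (j + 1)) * θs (j + 2) =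
        gammaStar θs * (θs 0 - θs (j + 1)) * (θs (j + 1) - θs 1) := by
      linear_combination θs 1 * θs (j + 1) * h1 - θs 0 * h2 - θs (j + 1) ^ 2 * h3
    have hq : θs 0 ^ 2 - θs (j + 1) ^ 2 = (θs (j + 1) + θs 0) * (θs 0 - θs (j + 1)) := by ring
    have hsplit : gammaStar θs * ((θs (j + 1) - θs 1) / (θs (j + 1) + θs 0)) =
        gammaStar θs * (θs 0 - θs (j + 1)) * (θs (j + 1) - θs 1) /
          (θs 0 ^ 2 - θs (j + 1) ^ 2) := by
      rw [hq]
      field_simp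
    rw [hsplit, ← key]
    field_simp
  · intro w h1 h2
    rw [lowVec_dual hG hθ hi hxy, sum_sphereInter_const (c := θs 2), hG.card_closer hi hxy,
      dist_symm G w x, dist_symm G w y, h1, h2]
    intro v h3 h4
    have t1 := hG.triangle w x v
    have t2 := hG.triangle y v w
    have s1 := dist_symm G w x
    have s2 := dist_symm G v w
    have : G.dist w v = 2 := by omega
    rw [this]

/-- `Φ_i(z_2)` is, up to a nonzero factor, the Gram determinant of `lowVec` and `upVec`. -/
lemma phi_eval_eq_zero_iff (hF : IsExtendedQOrdering G D F) (hG : IsDistanceRegularWith G D p)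
    (hθ : IsDualEigenvalueSeq G D (F 1) θs) (hR : IsReinforced G D p) {i : ℕ} (hi : 2 ≤ i)
    (hiD : i < D) {x y : X} (hxy : G.dist x y = i) :
    (Phi p θs i).eval (kiteNumber G p 2) = 0 ↔
      (lowVec G p (F 1) θs i x y ⬝ᵥ lowVec G p (F 1) θs i x y) *
        (upVec G p (F 1) θs i x y ⬝ᵥ upVec G p (F 1) θs i x y) =
      (lowVec G p (F 1) θs i x y ⬝ᵥ upVec G p (F 1) θs i x y) ^ 2 := by
  have hN := hG.card_pos.ne'
  have d12 := sub_ne_zero.2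
    (hF.dual_injOn hG (by omega) hθ (i := 1) (j := 2) (by omega) (by omega) (by omega))
  have hc : (cNum p i : ℝ) ≠ 0 := by exact_mod_cast (hG.cNum_pos (by omega) hiD.le).ne'
  have hb : (bNum p i : ℝ) ≠ 0 := by exact_mod_cast (hG.bNum_pos hiD).ne'
  have gA := hF.lowVec_dotProduct_self hG hθ hR hi hiD hxy
  have gB := hF.upVec_dotProduct_self hG hθ hR hi hiD hxy
  have gC := hF.lowVec_dotProduct_upVec hG hθ (by omega) hiD hxy
  have k1 := hF.kiteNumber_eq hG (by omega) hθ hi hiD.le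
  have k2 := hF.kiteNumber_eq hG (by omega) hθ (i := i + 1) (by omega) hiD
  -- Φ_i is the product of the two norm factors minus the squared inner product term, after z_i and
  -- z_{i+1} are replaced by their affine expressions in z_2.
  have hPhi : (Phi p θs i).eval (kiteNumber G p 2) =
      (kiteNumber G p i - zMinus p θs i) * (zPlusSucc p θs i - kiteNumber G p (i + 1)) -
      cNum p i * bNum p i *
      (gammaStar θs / (θs 1 - θs 2) * ((θs i - θs 1) / (θs i + θs 0))) ^ 2 := by
    rw [k1, k2, Phi, phiU, phiV, phiW]
    simp only [Polynomial.eval_add, Polynomial.eval_mul, Polynomial.eval_C, Polynomial.eval_pow,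
      Polynomial.eval_X]
    ring
  rw [hPhi]
  set a := lowVec G p (F 1) θs i x y ⬝ᵥ lowVec G p (F 1) θs i x y
  set b := upVec G p (F 1) θs i x y ⬝ᵥ upVec G p (F 1) θs i x y
  set c := lowVec G p (F 1) θs i x y ⬝ᵥ upVec G p (F 1) θs i x y
  have key : (cNum p i : ℝ) * bNum p i * (θs 1 - θs 2) ^ 2 *
      ((kiteNumber G p i - zMinus p θs i) * (zPlusSucc p θs i - kiteNumber G p (i + 1)) -
      cNum p i * bNum p i *
      (gammaStar θs / (θs 1 - θs 2) * ((θs i - θs 1) / (θs i + θs 0))) ^ 2) =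
      (Fintype.card X : ℝ) ^ 2 * (a * b - c ^ 2) := by
    have e1 : (Fintype.card X : ℝ) ^ 2 * (a * b - c ^ 2) = (Fintype.card X * a) *
      (Fintype.card X * b) - (Fintype.card X * c) ^ 2 := by ring
    have e2 : (cNum p i : ℝ) * bNum p i * (θs 1 - θs 2) ^ 2 * (cNum p i * bNum p i *
        (gammaStar θs / (θs 1 - θs 2) * ((θs i - θs 1) / (θs i + θs 0))) ^ 2) =
        (cNum p i * bNum p i * (gammaStar θs * ((θs i - θs 1) / (θs i + θs 0)))) ^ 2 := by
      rw [mul_pow, mul_pow, div_pow]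
      field_simp
    rw [e1, gA, gB, gC, ← e2]
    ring
  have hf : (cNum p i : ℝ) * bNum p i * (θs 1 - θs 2) ^ 2 ≠ 0 :=
    mul_ne_zero (mul_ne_zero hc hb) (pow_ne_zero _ d12)
  rw [← mul_right_inj' hf, mul_zero, key, mul_eq_zero, or_iff_right (pow_ne_zero 2 hN),
    sub_eq_zero]

end IsExtendedQOrdering

end Gram

/-! ### The Norton-balanced condition, one pair of vertices at a time. -/

section Main

variable {X : Type*} [Fintype X] [DecidableEq X] {G : SimpleGraph X} {D : ℕ}
  {p : ℕ → ℕ → ℕ → ℕ} {F : ℕ → Matrix X X ℝ} {θs : ℕ → ℝ}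

/-- The Norton-balanced condition for the pair `x, y`. -/
def IsNortonBalancedAt (G : SimpleGraph X) (D : ℕ) (E : Matrix X X ℝ) (x y : X) : Prop :=
  ∀ i ≤ D, ∀ j ≤ D,
    ∑ z ∈ sphereInter G i j x y, E *ᵥ hat z ∈
      Submodule.span ℝ
        {E *ᵥ hat x, E *ᵥ hat y, nortonProd E (E *ᵥ hat x) (E *ᵥ hat y)}

namespace IsExtendedQOrdering

lemma isNortonBalancedAt_self (hF : IsExtendedQOrdering G D F)
    (hG : IsDistanceRegularWith G D p) (x : X) : IsNortonBalancedAt G D (F 1) x x := by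
  obtain ⟨P, hP⟩ := hF.exists_eigenvalues hG
  intro i _ j _
  by_cases hij : i = j
  · subst hij
    have : ∑ z ∈ sphereInter G i i x x, F 1 *ᵥ hat z = P i 1 • (F 1 *ᵥ hat x) := by
      ext v
      have e := congrFun (congrFun (hF.mul_distMatrix hP i 1) v) x
      rw [Matrix.mul_apply, Matrix.smul_apply] at e
      rw [Pi.smul_apply, mulVec_hat_apply, ← e, Finset.sum_apply, sphereInter, Finset.sum_filter]
      refine Finset.sum_congr rfl fun w _ => ?_
      simp only [distMatrix_apply, dist_symm G w x, mulVec_hat_apply, and_self, mul_ite, mul_one,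
        mul_zero]
    rw [this]
    exact Submodule.smul_mem _ _ (Submodule.subset_span (by simp))
  · have : sphereInter G i j x x = ∅ := by
      ext w
      simp only [mem_sphereInter, Finset.notMem_empty, iff_false]
      omega
    rw [this, Finset.sum_empty]
    exact Submodule.zero_mem _

/-- Ex_y^± are two of the sphere sums, and they generate all the others together with Ex̂ and Eŷ. At
distance D the set defining x_y^+ is empty. -/
lemma isNortonBalancedAt_iff (hF : IsExtendedQOrdering G D F)
    (hG : IsDistanceRegularWith G D p) {x y : X} (hxy : 1 ≤ G.dist x y) :
    IsNortonBalancedAt G D (F 1) x y ↔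
      F 1 *ᵥ minusVec G x y ∈ Submodule.span ℝ
        {F 1 *ᵥ hat x, F 1 *ᵥ hat y, nortonProd (F 1) (F 1 *ᵥ hat x) (F 1 *ᵥ hat y)} ∧
      F 1 *ᵥ plusVec G x y ∈ Submodule.span ℝ
        {F 1 *ᵥ hat x, F 1 *ᵥ hat y, nortonProd (F 1) (F 1 *ᵥ hat x) (F 1 *ᵥ hat y)} := by
  have hle := hG.dist_le x y
  constructor
  · intro h
    rw [mulVec_minusVec _ hxy rfl, mulVec_plusVec _ rfl]
    refine ⟨h 1 (by omega) _ (by omega), ?_⟩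
    rcases Nat.lt_or_ge D (G.dist x y + 1) with hD | hD
    · have : sphereInter G 1 (G.dist x y + 1) x y = ∅ := by
        ext w
        have := hG.dist_le y w
        simp only [mem_sphereInter, Finset.notMem_empty, iff_false]
        omega
      rw [interVec, this, Finset.sum_empty]
      exact Submodule.zero_mem _
    · exact h 1 (by omega) _ hD
  · rintro ⟨hm, hp⟩ i _ j _
    exact hF.sum_sphereInter_mem hG (by omega) hxy (Submodule.subset_span (by simp))
      (Submodule.subset_span (by simp)) hm hp i j

lemma span_pair_le_span_triple {u v w : X → ℝ} :
    Submodule.span ℝ {u, v} ≤ Submodule.span ℝ {u, v, w} :=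
  Submodule.span_mono (by
    intro a ha
    simp only [Set.mem_insert_iff, Set.mem_singleton_iff] at ha ⊢
    tauto)

lemma norton_combination_mem (hF : IsExtendedQOrdering G D F)
    (hG : IsDistanceRegularWith G D p) (hθ : IsDualEigenvalueSeq G D (F 1) θs)
    {x y : X} (hxy : 1 ≤ G.dist x y) :
    (θs (G.dist x y - 1) - θs (G.dist x y)) • (F 1 *ᵥ minusVec G x y) -
        (θs (G.dist x y) - θs (G.dist x y + 1)) • (F 1 *ᵥ plusVec G x y) ∈ Submodule.span ℝ
        {F 1 *ᵥ hat x, F 1 *ᵥ hat y, nortonProd (F 1) (F 1 *ᵥ hat x) (F 1 *ᵥ hat y)} := by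
  have hle := hG.dist_le x y
  obtain ⟨P, hP⟩ := hF.exists_eigenvalues hG
  have h := span_pair_le_span_triple
    (w := nortonProd (F 1) (F 1 *ᵥ hat x) (F 1 *ᵥ hat y))
    (hF.norton_mem hG (by omega) hθ hP hxy rfl)
  have h2 := Submodule.sub_mem _ (Submodule.smul_mem _ (Fintype.card X * (P 1 1 - P 1 2))
    (Submodule.subset_span (by simp : nortonProd (F 1) (F 1 *ᵥ hat x) (F 1 *ᵥ hat y) ∈
      ({F 1 *ᵥ hat x, F 1 *ᵥ hat y,
        nortonProd (F 1) (F 1 *ᵥ hat x) (F 1 *ᵥ hat y)} : Set (X → ℝ))))) h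
  rwa [sub_sub_cancel] at h2

/-- Here x_y^- is ŷ, so `norton_combination_mem` yields Ex_y^+ because θ*_1 ≠ θ*_2. -/
lemma isNortonBalancedAt_one (hF : IsExtendedQOrdering G D F)
    (hG : IsDistanceRegularWith G D p) (hD : 2 ≤ D) (hθ : IsDualEigenvalueSeq G D (F 1) θs)
    {x y : X} (hxy : G.dist x y = 1) : IsNortonBalancedAt G D (F 1) x y := by
  rw [hF.isNortonBalancedAt_iff hG (by omega)]
  have hm : F 1 *ᵥ minusVec G x y = F 1 *ᵥ hat y := by
    rw [mulVec_minusVec _ le_rfl hxy, interVec]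
    have : sphereInter G 1 (1 - 1) x y = {y} := by
      ext w
      rw [mem_sphereInter, Finset.mem_singleton, Nat.sub_self, hG.dist_eq_zero]
      constructor
      · rintro ⟨-, h⟩
        exact h.symm
      · rintro rfl
        exact ⟨hxy, rfl⟩
    rw [this, Finset.sum_singleton]
  have hm' : F 1 *ᵥ minusVec G x y ∈ Submodule.span ℝ
      {F 1 *ᵥ hat x, F 1 *ᵥ hat y, nortonProd (F 1) (F 1 *ᵥ hat x) (F 1 *ᵥ hat y)} := by
    rw [hm]
    exact Submodule.subset_span (by simp)
  refine ⟨hm', ?_⟩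
  have h := hF.norton_combination_mem hG hθ (x := x) (y := y) (by omega)
  rw [Submodule.sub_mem_iff_right _ (Submodule.smul_mem _ _ hm'), Submodule.smul_mem_iff] at h
  · exact h
  · rw [hxy]
    exact sub_ne_zero.2 (hF.dual_injOn hG (by omega) hθ (by omega) hD (by omega))

/-- Here x_y^+ = 0, so `norton_combination_mem` yields Ex_y^- because θ*_{D-1} ≠ θ*_D. -/
lemma isNortonBalancedAt_diam (hF : IsExtendedQOrdering G D F)
    (hG : IsDistanceRegularWith G D p) (hD : 1 ≤ D) (hθ : IsDualEigenvalueSeq G D (F 1) θs)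
    {x y : X} (hxy : G.dist x y = D) : IsNortonBalancedAt G D (F 1) x y := by
  rw [hF.isNortonBalancedAt_iff hG (by omega)]
  have hp : F 1 *ᵥ plusVec G x y = 0 := by
    rw [mulVec_plusVec _ hxy, interVec]
    have : sphereInter G 1 (D + 1) x y = ∅ := by
      ext w
      have := hG.dist_le y w
      simp only [mem_sphereInter, Finset.notMem_empty, iff_false]
      omega
    rw [this, Finset.sum_empty]
  have h := hF.norton_combination_mem hG hθ (x := x) (y := y) (by omega)
  rw [hp, smul_zero, sub_zero, Submodule.smul_mem_iff] at h
  · rw [hp]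
    exact ⟨h, Submodule.zero_mem _⟩
  · rw [hxy]
    exact sub_ne_zero.2 (hF.dual_injOn hG hD hθ (by omega) le_rfl (by omega))

/-- For `2 ≤ ∂(x,y) ≤ D - 1` the Norton-balanced condition says that `lowVec` and `upVec` are
multiples of the component of the Norton product orthogonal to `E x̂` and `E ŷ`. -/
lemma isNortonBalancedAt_iff_exists (hF : IsExtendedQOrdering G D F)
    (hG : IsDistanceRegularWith G D p) (hθ : IsDualEigenvalueSeq G D (F 1) θs) {i : ℕ}
    (hi : 1 ≤ i) (hiD : i < D) {x y : X} (hxy : G.dist x y = i) :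
    IsNortonBalancedAt G D (F 1) x y ↔ ∃ ε δ : ℝ,
      lowVec G p (F 1) θs i x y = ε • ((θs (i - 1) - θs i) • lowVec G p (F 1) θs i x y -
        (θs i - θs (i + 1)) • upVec G p (F 1) θs i x y) ∧
      upVec G p (F 1) θs i x y = δ • ((θs (i - 1) - θs i) • lowVec G p (F 1) θs i x y -
        (θs i - θs (i + 1)) • upVec G p (F 1) θs i x y) := by
  have hN := hG.card_pos
  rw [hF.isNortonBalancedAt_iff hG (by omega)]
  obtain ⟨P, hP⟩ := hF.exists_eigenvalues hG
  have hsq := hF.dual_sq_sub_ne_zero hG hθ hi hiD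
  obtain ⟨ax, ay⟩ := hF.lowVec_orthogonal hG hθ hi hiD hxy
  obtain ⟨bx, byy⟩ := hF.upVec_orthogonal hG hθ hi hiD hxy
  have hn := hF.norton_mem hG (by omega) hθ hP hi hxy
  have hne := hF.eigenvalue_injOn hG hP (i := 1) (j := 2) (by omega) (by omega) (by omega)
  have hc0 : Fintype.card X * (P 1 1 - P 1 2) ≠ 0 := mul_ne_zero hN.ne' (sub_ne_zero.2 hne)
  set m := F 1 *ᵥ minusVec G x y with hm
  set q := F 1 *ᵥ plusVec G x y with hq
  set ex := F 1 *ᵥ hat x with hex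
  set ey := F 1 *ᵥ hat y with hey
  set e := nortonProd (F 1) ex ey
  have ha : lowVec G p (F 1) θs i x y = m - rLow p θs i • ex - sLow p θs i • ey := rfl
  have hb : upVec G p (F 1) θs i x y = q - rUp p θs i • ex - sUp p θs i • ey := rfl
  set a := lowVec G p (F 1) θs i x y
  set b := upVec G p (F 1) θs i x y
  set e' := (θs (i - 1) - θs i) • a - (θs i - θs (i + 1)) • b with he'
  have hex1 : ex ∈ Submodule.span ℝ {ex, ey} := Submodule.subset_span (by simp)
  have hey1 : ey ∈ Submodule.span ℝ {ex, ey} := Submodule.subset_span (by simp)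
  -- The Gram determinant of Ex̂ and Eŷ is a nonzero multiple of θ*_0² - θ*_i²; vanishing at x and y
  -- means orthogonality to both.
  have hlin : ∀ w ∈ Submodule.span ℝ {ex, ey}, w x = 0 → w y = 0 → w = 0 := by
    intro w hw hwx hwy
    obtain ⟨s, t, rfl⟩ := Submodule.mem_span_pair.1 hw
    simp only [Pi.add_apply, Pi.smul_apply, hex, hey, mulVec_hat_apply, hθ.apply hG, G.dist_self,
      dist_symm G y x, hxy, smul_eq_mul] at hwx hwy
    have h1 : s * θs 0 + t * θs i = 0 := by
      field_simp at hwx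
      linear_combination hwx
    have h2 : s * θs i + t * θs 0 = 0 := by
      field_simp at hwy
      linear_combination hwy
    have hs : s = 0 := by
      apply mul_right_cancel₀ hsq
      linear_combination θs 0 * h1 - θs i * h2
    have ht : t = 0 := by
      apply mul_right_cancel₀ hsq
      linear_combination θs 0 * h2 - θs i * h1
    rw [hs, ht]
    simp
  have hee : (Fintype.card X * (P 1 1 - P 1 2)) • e - e' ∈ Submodule.span ℝ {ex, ey} := by
    have h2 := Submodule.add_mem _ hn (Submodule.add_mem _ (Submodule.smul_mem _
      ((θs (i - 1) - θs i) * rLow p θs i - (θs i - θs (i + 1)) * rUp p θs i) hex1)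
      (Submodule.smul_mem _
      ((θs (i - 1) - θs i) * sLow p θs i - (θs i - θs (i + 1)) * sUp p θs i) hey1))
    convert h2 using 1
    rw [he', ha, hb]
    module
  have he'x : e' x = 0 := by simp [he', ax, bx]
  have he'y : e' y = 0 := by simp [he', ay, byy]
  have he'3 : e' ∈ Submodule.span ℝ {ex, ey, e} := by
    have h2 := Submodule.sub_mem _ (Submodule.smul_mem _ (Fintype.card X * (P 1 1 - P 1 2))
      (Submodule.subset_span (s := {ex, ey, e}) (by simp : e ∈ {ex, ey, e})))
      (span_pair_le_span_triple (w := e) hee)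
    rwa [sub_sub_cancel] at h2
  clear_value e'
  -- e' is the component of a nonzero multiple of the Norton product orthogonal to Ex̂ and Eŷ. Hence
  -- membership of v in the triple span depends only on its orthogonal component w being a multiple
  -- of e'.
  have main : ∀ v w : X → ℝ, v - w ∈ Submodule.span ℝ {ex, ey} → w x = 0 → w y = 0 →
      (v ∈ Submodule.span ℝ {ex, ey, e} ↔ ∃ ε : ℝ, w = ε • e') := by
    intro v w hvw hwx hwy
    have hvw3 := span_pair_le_span_triple (w := e) hvw
    constructor
    · intro hv
      obtain ⟨s, t, ε, hst⟩ := Submodule.mem_span_triple.1 hv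
      refine ⟨ε / (Fintype.card X * (P 1 1 - P 1 2)), ?_⟩
      rw [← sub_eq_zero]
      refine hlin _ ?_ (by simp [hwx, he'x]) (by simp [hwy, he'y])
      have h3 := Submodule.sub_mem _ (Submodule.add_mem _ (Submodule.add_mem _
        (Submodule.smul_mem _ s hex1) (Submodule.smul_mem _ t hey1)) (Submodule.smul_mem _
        (ε / (Fintype.card X * (P 1 1 - P 1 2))) hee)) hvw
      convert h3 using 1
      have hcancel : ε • e = (ε / (Fintype.card X * (P 1 1 - P 1 2))) •
          (Fintype.card X * (P 1 1 - P 1 2)) • e := by rw [smul_smul, div_mul_cancel₀ _ hc0]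
      rw [← hst, hcancel]
      module
    · rintro ⟨ε, rfl⟩
      have := Submodule.add_mem _ hvw3 (Submodule.smul_mem _ ε he'3)
      rwa [sub_add_cancel] at this
  have hma : m - a ∈ Submodule.span ℝ {ex, ey} := by
    rw [Submodule.mem_span_pair]
    exact ⟨rLow p θs i, sLow p θs i, by rw [ha]; module⟩
  have hqb : q - b ∈ Submodule.span ℝ {ex, ey} := by
    rw [Submodule.mem_span_pair]
    exact ⟨rUp p θs i, sUp p θs i, by rw [hb]; module⟩
  rw [main m a hma ax ay, main q b hqb bx byy, exists_and_exists_comm]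

/-- Identifies λ_i as ⟨a,a⟩/⟨a,b⟩, the only possible ratio a : b; the denominator is nonzero because
γ* ≠ 0 and θ*_i ≠ θ*_1. -/
lemma depScalar_mul (hF : IsExtendedQOrdering G D F) (hG : IsDistanceRegularWith G D p)
    (hθ : IsDualEigenvalueSeq G D (F 1) θs) (hR : IsReinforced G D p)
    (hγ : gammaStar θs ≠ 0) {i : ℕ} (hi : 2 ≤ i) (hiD : i < D) {x y : X} (hxy : G.dist x y = i) :
    lowVec G p (F 1) θs i x y ⬝ᵥ upVec G p (F 1) θs i x y ≠ 0 ∧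
    depScalar G p θs i * (lowVec G p (F 1) θs i x y ⬝ᵥ upVec G p (F 1) θs i x y) =
      lowVec G p (F 1) θs i x y ⬝ᵥ lowVec G p (F 1) θs i x y := by
  have hN := hG.card_pos.ne'
  have hc : (cNum p i : ℝ) ≠ 0 := by exact_mod_cast (hG.cNum_pos (by omega) hiD.le).ne'
  have hb : (bNum p i : ℝ) ≠ 0 := by exact_mod_cast (hG.bNum_pos hiD).ne'
  have gA := hF.lowVec_dotProduct_self hG hθ hR hi hiD hxy
  have gC := hF.lowVec_dotProduct_upVec hG hθ (by omega) hiD hxy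
  have hs := hF.dual_add_ne_zero hG hθ (by omega) hiD
  rw [add_comm] at hs
  have d1 := sub_ne_zero.2
    (hF.dual_injOn hG (by omega) hθ (i := i) (j := 1) (by omega) (by omega) (by omega))
  constructor
  · intro h
    rw [h, mul_zero] at gC
    exact mul_ne_zero (mul_ne_zero hc hb) (mul_ne_zero hγ (div_ne_zero d1 hs)) gC.symm
  · apply mul_left_cancel₀ hN
    rw [mul_left_comm, gA, gC, depScalar]
    field_simp

lemma isNortonBalancedAt_iff_phi (hF : IsExtendedQOrdering G D F)
    (hG : IsDistanceRegularWith G D p) (hθ : IsDualEigenvalueSeq G D (F 1) θs)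
    (hR : IsReinforced G D p) (hγ : gammaStar θs = 0) {i : ℕ} (hi : 2 ≤ i) (hiD : i < D) {x y : X}
    (hxy : G.dist x y = i) :
    IsNortonBalancedAt G D (F 1) x y ↔ (Phi p θs i).eval (kiteNumber G p 2) = 0 := by
  have hN := hG.card_pos.ne'
  have ds := sub_ne_zero.2
    (hF.dual_injOn hG (by omega) hθ (i := i - 1) (j := i) (by omega) (by omega) (by omega))
  have dt := sub_ne_zero.2
    (hF.dual_injOn hG (by omega) hθ (i := i) (j := i + 1) (by omega) (by omega) (by omega))
  rw [hF.isNortonBalancedAt_iff_exists hG hθ (by omega) hiD hxy,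
    hF.phi_eval_eq_zero_iff hG hθ hR hi hiD hxy]
  constructor
  · rintro ⟨ε, δ, ha, hb⟩
    exact gram_of_smul ha hb
  · intro h
    have gC := hF.lowVec_dotProduct_upVec hG hθ (by omega) hiD hxy
    rw [hγ, zero_mul, mul_zero] at gC
    -- With γ* = 0 the two components are orthogonal, so the determinant condition says that one of
    -- them is zero.
    rw [(mul_eq_zero.1 gC).resolve_left hN, sq, mul_zero] at h
    exact exists_smul_of_dotProduct_eq_zero ds dt h

lemma isNortonBalancedAt_iff_phi_and (hF : IsExtendedQOrdering G D F)
    (hG : IsDistanceRegularWith G D p) (hθ : IsDualEigenvalueSeq G D (F 1) θs)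
    (hR : IsReinforced G D p) (hγ : gammaStar θs ≠ 0) {i : ℕ} (hi : 2 ≤ i) (hiD : i < D) {x y : X}
    (hxy : G.dist x y = i) :
    IsNortonBalancedAt G D (F 1) x y ↔ (Phi p θs i).eval (kiteNumber G p 2) = 0 ∧
      depScalar G p θs i ≠ (θs i - θs (i + 1)) / (θs (i - 1) - θs i) := by
  have ds := sub_ne_zero.2
    (hF.dual_injOn hG (by omega) hθ (i := i - 1) (j := i) (by omega) (by omega) (by omega))
  obtain ⟨h1, h2⟩ := hF.depScalar_mul hG hθ hR hγ hi hiD hxy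
  rw [hF.isNortonBalancedAt_iff_exists hG hθ (by omega) hiD hxy,
    hF.phi_eval_eq_zero_iff hG hθ hR hi hiD hxy,
    exists_smul_iff_of_dotProduct_ne_zero ds h1 h2]

/-- Distances 0, 1 and D impose nothing. At the others the criterion depends only on i, and some
pair realises each distance. -/
lemma isNortonBalanced_iff (hF : IsExtendedQOrdering G D F) (hG : IsDistanceRegularWith G D p)
    (hD : 2 ≤ D) (hθ : IsDualEigenvalueSeq G D (F 1) θs) {Q : ℕ → Prop}
    (hQ : ∀ i, 2 ≤ i → i < D → ∀ x y, G.dist x y = i → (IsNortonBalancedAt G D (F 1) x y ↔ Q i)) :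
    IsNortonBalanced G D (F 1) ↔ ∀ i, 2 ≤ i → i ≤ D - 1 → Q i := by
  constructor
  · intro h i hi hiD
    obtain ⟨x, y, hxy⟩ := hG.exists_dist_eq (i := i) (by omega)
    exact (hQ i hi (by omega) x y hxy).1 (h x y)
  · intro h x y
    have hle := hG.dist_le x y
    change IsNortonBalancedAt G D (F 1) x y
    have : G.dist x y = 0 ∨ G.dist x y = 1 ∨ G.dist x y = D ∨
      (2 ≤ G.dist x y ∧ G.dist x y < D) := by omega
    rcases this with h0 | h0 | h0 | ⟨h0, h1⟩
    · rw [hG.dist_eq_zero] at h0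
      subst h0
      exact hF.isNortonBalancedAt_self hG x
    · exact hF.isNortonBalancedAt_one hG hD hθ h0
    · exact hF.isNortonBalancedAt_diam hG (by omega) hθ h0
    · exact (hQ _ h0 h1 x y rfl).2 (h _ h0 (by omega))

end IsExtendedQOrdering

end Main

end NortonBalanced

end

theorem mainTheorem6 {X : Type*} [Fintype X] [DecidableEq X] (G : SimpleGraph X)
    (D : ℕ) (hD : 3 ≤ D) (p : ℕ → ℕ → ℕ → ℕ)
    (hG : NortonBalanced.IsDistanceRegularWith G D p) (hk : 3 ≤ NortonBalanced.kNum p 1)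
    (E : Matrix X X ℝ) (hE : NortonBalanced.IsQPolynomialIdempotent G D E)
    (θs : ℕ → ℝ) (hθ : NortonBalanced.IsDualEigenvalueSeq G D E θs)
    (hR : NortonBalanced.IsReinforced G D p) :
    (NortonBalanced.gammaStar θs = 0 →
      (NortonBalanced.IsNortonBalanced G D E ↔
        ∀ i : ℕ, 2 ≤ i → i ≤ D - 1 →
          (NortonBalanced.Phi p θs i).eval (NortonBalanced.kiteNumber G p 2) = 0)) ∧
    (NortonBalanced.gammaStar θs ≠ 0 →
      (∀ i : ℕ, 2 ≤ i → i ≤ D - 1 →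
        (NortonBalanced.Phi p θs i).eval (NortonBalanced.kiteNumber G p 2) = 0 →
          ∀ x y : X, G.dist x y = i → ∀ l : ℝ,
            NortonBalanced.DependencyRel G p E θs i x y l ↔
              l = NortonBalanced.depScalar G p θs i) ∧
      (NortonBalanced.IsNortonBalanced G D E ↔
        ∀ i : ℕ, 2 ≤ i → i ≤ D - 1 →
          (NortonBalanced.Phi p θs i).eval (NortonBalanced.kiteNumber G p 2) = 0 ∧
          NortonBalanced.depScalar G p θs i ≠
            (θs i - θs (i + 1)) / (θs (i - 1) - θs i))) := by
  obtain ⟨F, hF, rfl⟩ := hE.exists_extended (by omega)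
  refine ⟨fun hγ => hF.isNortonBalanced_iff hG (by omega) hθ fun i hi hiD x y hxy =>
    hF.isNortonBalancedAt_iff_phi hG hθ hR hγ hi hiD hxy, fun hγ => ⟨?_, ?_⟩⟩
  · intro i hi hiD hΦ x y hxy l
    obtain ⟨h1, h2⟩ := hF.depScalar_mul hG hθ hR hγ hi (by omega) hxy
    have hg := (hF.phi_eval_eq_zero_iff hG hθ hR hi (by omega) hxy).1 hΦ
    -- The relation is a = l•b, equivalent to l⟨a,b⟩ = ⟨a,a⟩ = λ_i⟨a,b⟩, and ⟨a,b⟩ ≠ 0 cancels; this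
    -- gives existence and uniqueness together.
    refine (NortonBalanced.eq_smul_iff_of_gram hg h1 l).trans ?_
    rw [← h2]
    exact mul_left_inj' h1
  · exact hF.isNortonBalanced_iff hG (by omega) hθ fun i hi hiD x y hxy =>
      hF.isNortonBalancedAt_iff_phi_and hG hθ hR hγ hi hiD hxy
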